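/- Let $M$ be a smooth $n$-dimensional Riemannian manifold without boundary (Hausdorff; neither compactness, nor orientability, nor $n\ge 3$ is needed), with Levi-Civita connection $\nabla^L$, and let $V$ be a smooth vector field on $M$ with $|V|=1$. On $\bigwedge^*T^*M\otimes\mathbb C$ let $c(v)=\epsilon(v^*)-\iota(v^*)$ and $\widehat c(v)=\epsilon(v^*)+\iota(v^*)$ be the two Clifford actions, where $v^*=g(v,\cdot)$, $\epsilon(v^*)$ is exterior multiplication by $v^*$ and $\iota(v^*)$ is interior multiplication by $v$. Let $\nabla^{\bigwedge^*T^*M}$ be the connection induced by $\nabla^L$ on forms, and also the connection this induces on endomorphisms of the bundle of forms. Let $d$ be the exterior derivative, $\delta$ its formal adjoint, and $$D_V=\sqrt{-1}\,\widehat c(V)(d+\delta),\qquad D_V^*=-\sqrt{-1}\,(d+\delta)\widehat c(V).$$ For an operator $P$ of Laplace type on smooth forms, "the connection associated with $P$" is the connection $\nabla$ on $\bigwedge^*T^*M\otimes\mathbb C$ for which there is an endomorphism field $E$ with $P=-\big[g^{ij}(\nabla_{\partial_i}\nabla_{\partial_j}-\nabla_{\nabla^L_{\partial_i}\partial_j})+E\big]$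 in all local coordinates. (1) The connection associated with $D_V^*D_V$ exists, is unique, and is $\nabla=\nabla^{\bigwedge^*T^*M}$. The connection associated with $D_V^2$ exists, is unique, and is $$\nabla^{V}_X=\nabla^{\bigwedge^*T^*M}_X-\frac12\,\widehat c(V)\sum_{q=1}^n\widehat c(\nabla^L_{e_q}V)c(e_q)c(X).$$ (2) On smooth forms, in all local coordinates and for every smooth local orthonormal frame $e_1,\dots,e_n$, $$D_V^*D_V=(d+\delta)^2=-\Big[g^{ij}(\nabla_{\partial_i}\nabla_{\partial_j}-\nabla_{\nabla^L_{\partial_i}\partial_j})\Big]-\frac18\sum_{i,j,k,l}R_{ijkl}\,\widehat c(e_i)\widehat c(e_j)c(e_k)c(e_l)+\frac14K,$$ where $\nabla=\nabla^{\bigwedge^*T^*M}$, and $$\begin{aligned}D_V^2={}&-\Big[g^{ij}(\nabla^V_{\partial_i}\nabla^V_{\partial_j}-\nabla^V_{\nabla^L_{\partial_i}\partial_j})\Big]-\frac18\sum_{i,j,k,l}R_{ijkl}\,\widehat c(e_i)\widehat c(e_j)c(e_k)c(e_l)+\frac14K\\&+\frac14\sum_{i=1}^n\Big[\widehat c(V)\sum_{q=1}^n\widehat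 c(\nabla^L_{e_q}V)c(e_q)c(e_i)\Big]^2-\frac12\sum_{j=1}^n\Big[\nabla^{\bigwedge^*T^*M}_{e_j}\Big(\widehat c(V)\sum_{q=1}^n\widehat c(\nabla^L_{e_q}V)c(e_q)\Big)\Big]c(e_j).\end{aligned}$$ Here $R_{ijkl}=g(R(e_i,e_j)e_k,e_l)$ with $R(X,Y)=\nabla^L_X\nabla^L_Y-\nabla^L_Y\nabla^L_X-\nabla^L_{[X,Y]}$, and $K=\sum_{i,j}g(R(e_i,e_j)e_j,e_i)$ is the scalar curvature. -/

import Mathlib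

open Bundle VectorField Module
open scoped Manifold ContDiff Topology

namespace RiemannianForms

section LeviCivita

variable {E : Type*} [NormedAddCommGroup E] [NormedSpace ℝ E]
  {H : Type*} [TopologicalSpace H] {I : ModelWithCorners ℝ E H}
  {M : Type*} [TopologicalSpace M] [ChartedSpace H M] [IsManifold I ∞ M]
  [RiemannianBundle (fun x : M => TangentSpace I x)]

/-- The right-hand side of the Koszul formula for `⟨∇_X Y, Z⟩` at `x`:
`(X⟨Y, Z⟩ + Y⟨X, Z⟩ - Z⟨X, Y⟩ + ⟨[X, Y], Z⟩ - ⟨[X, Z], Y⟩ - ⟨[Y, Z], X⟩) / 2`. -/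
noncomputable def koszul (Y X Z : Π x : M, TangentSpace I x) (x : M) : ℝ :=
  (1 / 2) * (mvfderiv I (fun y => inner ℝ (Y y) (Z y)) x (X x)
    + mvfderiv I (fun y => inner ℝ (X y) (Z y)) x (Y x)
    - mvfderiv I (fun y => inner ℝ (X y) (Y y)) x (Z x)
    + inner ℝ (mlieBracket I X Y x) (Z x)
    - inner ℝ (mlieBracket I X Z x) (Y x)
    - inner ℝ (mlieBracket I Y Z x) (X x))

variable [IsContMDiffRiemannianBundle I ∞ E (fun x : M => TangentSpace I x)]
  {X Y Z : Π x : M, TangentSpace I x} {x : M}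

theorem mdifferentiableAt_inner (hX : MDiffAt (T% X) x) (hY : MDiffAt (T% Y) x) :
    MDiffAt (fun y => inner ℝ (X y) (Y y)) x :=
  MDifferentiableAt.inner_bundle (E := fun x : M => TangentSpace I x) hX hY

variable [FiniteDimensional ℝ E]

theorem tensorialAt_koszul_dir
    (hY : MDiffAt (T% Y) x) (hZ : MDiffAt (T% Z) x) :
    TensorialAt I E (fun X => koszul Y X Z x) x where
  smul {f X} hf hX := by
    have h1 := mvfderiv_fun_mul hf (mdifferentiableAt_inner hX hZ)
    have h2 := mvfderiv_fun_mul hf (mdifferentiableAt_inner hX hY)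
    simp [koszul, inner_smul_left, inner_smul_right, h1, h2, mlieBracket_smul_left hf hX,
      inner_add_left]
    ring
  add {X X'} hX hX' := by
    have h1 := mvfderiv_fun_add (mdifferentiableAt_inner hX hZ) (mdifferentiableAt_inner hX' hZ)
    have h2 := mvfderiv_fun_add (mdifferentiableAt_inner hX hY) (mdifferentiableAt_inner hX' hY)
    simp [koszul, h1, h2, mlieBracket_add_left hX hX', inner_add_left, inner_add_right]
    ring

theorem tensorialAt_koszul_test
    (hY : MDiffAt (T% Y) x) (hX : MDiffAt (T% X) x) :
    TensorialAt I E (fun Z => koszul Y X Z x) x where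
  smul {f Z} hf hZ := by
    have h1 := mvfderiv_fun_mul hf (mdifferentiableAt_inner hX hZ)
    have h2 := mvfderiv_fun_mul hf (mdifferentiableAt_inner hY hZ)
    simp [koszul, inner_smul_right, inner_smul_left, h1, h2, mlieBracket_smul_right hf hZ,
      inner_add_left]
    simp only [real_inner_comm]
    ring
  add {Z Z'} hZ hZ' := by
    have h1 := mvfderiv_fun_add (mdifferentiableAt_inner hX hZ) (mdifferentiableAt_inner hX hZ')
    have h2 := mvfderiv_fun_add (mdifferentiableAt_inner hY hZ) (mdifferentiableAt_inner hY hZ')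
    simp [koszul, h1, h2, mlieBracket_add_right hZ hZ', inner_add_left, inner_add_right]
    ring

theorem koszul_add {Y' : Π x : M, TangentSpace I x}
    (hY : MDiffAt (T% Y) x) (hY' : MDiffAt (T% Y') x) (hX : MDiffAt (T% X) x)
    (hZ : MDiffAt (T% Z) x) :
    koszul (Y + Y') X Z x = koszul Y X Z x + koszul Y' X Z x := by
  have h1 := mvfderiv_fun_add (mdifferentiableAt_inner hX hY) (mdifferentiableAt_inner hX hY')
  have h2 := mvfderiv_fun_add (mdifferentiableAt_inner hY hZ) (mdifferentiableAt_inner hY' hZ)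
  simp [koszul, h1, h2, mlieBracket_add_right hY hY', mlieBracket_add_left hY hY',
    inner_add_left, inner_add_right]
  ring

theorem koszul_smul {f : M → ℝ} (hf : MDiffAt f x)
    (hY : MDiffAt (T% Y) x) (hX : MDiffAt (T% X) x) (hZ : MDiffAt (T% Z) x) :
    koszul (f • Y) X Z x
      = f x * koszul Y X Z x + mvfderiv I f x (X x) * inner ℝ (Y x) (Z x) := by
  have h1 := mvfderiv_fun_mul hf (mdifferentiableAt_inner hX hY)
  have h2 := mvfderiv_fun_mul hf (mdifferentiableAt_inner hY hZ)
  simp [koszul, h1, h2, mlieBracket_smul_right hf hY, mlieBracket_smul_left hf hY,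
    inner_add_left, inner_smul_left, inner_smul_right]
  simp only [real_inner_comm]
  ring

instance finiteDimensional_tangentSpace (x : M) : FiniteDimensional ℝ (TangentSpace I x) :=
  inferInstanceAs (FiniteDimensional ℝ E)

open Classical in
/-- The endomorphism `v ↦ ∇_v Y` of `T_x M`, obtained from the Koszul formula by the Riesz
representation; it is `0` where `Y` is not differentiable. -/
noncomputable def leviCivitaAt (Y : Π x : M, TangentSpace I x) (x : M) :
    TangentSpace I x →L[ℝ] TangentSpace I x :=
  if hY : MDiffAt (T% Y) x then
    LinearMap.toContinuousLinearMap
      { toFun := fun v => (InnerProductSpace.toDual ℝ (TangentSpace I x)).symm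
          (TensorialAt.mkHom₂ (I := I) (F := E) (F' := E) (fun X Z => koszul Y X Z x) x
            (fun _ hZ => tensorialAt_koszul_dir hY hZ)
            (fun _ hX => tensorialAt_koszul_test hY hX) v)
        map_add' := by simp
        map_smul' := by simp }
  else 0

theorem inner_leviCivitaAt (hY : MDiffAt (T% Y) x) (hX : MDiffAt (T% X) x)
    (hZ : MDiffAt (T% Z) x) :
    inner ℝ (leviCivitaAt Y x (X x)) (Z x) = koszul Y X Z x := by
  simp only [leviCivitaAt, hY, dite_true, LinearMap.coe_toContinuousLinearMap', LinearMap.coe_mk,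
    AddHom.coe_mk, InnerProductSpace.toDual_symm_apply]
  exact TensorialAt.mkHom₂_apply (I := I) (F := E) (F' := E) _ _ hX hZ

/-- The Levi-Civita connection `∇^L` of a Riemannian metric; `leviCivita Y x v` is `∇^L_v Y`. -/
noncomputable def leviCivita : CovariantDerivative I E (fun x : M => TangentSpace I x) where
  toFun := leviCivitaAt
  isCovariantDerivativeOnUniv :=
    { add := by
        intro Y Y' x hY hY' _
        ext1 v
        refine ext_inner_right ℝ fun w => ?_
        obtain ⟨X, hX, rfl⟩ : ∃ X : Π y : M, TangentSpace I y, MDiffAt (T% X) x ∧ X x = v :=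
          ⟨_, FiberBundle.mdifferentiableAt_extend I E v, by simp⟩
        obtain ⟨Z, hZ, rfl⟩ : ∃ Z : Π y : M, TangentSpace I y, MDiffAt (T% Z) x ∧ Z x = w :=
          ⟨_, FiberBundle.mdifferentiableAt_extend I E w, by simp⟩
        rw [inner_leviCivitaAt (mdifferentiableAt_add_section hY hY') hX hZ,
          koszul_add hY hY' hX hZ, add_apply, inner_add_left,
          inner_leviCivitaAt hY hX hZ, inner_leviCivitaAt hY' hX hZ]
      leibniz := by
        intro Y f x hY hf _
        ext1 v
        refine ext_inner_right ℝ fun w => ?_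
        obtain ⟨X, hX, rfl⟩ : ∃ X : Π y : M, TangentSpace I y, MDiffAt (T% X) x ∧ X x = v :=
          ⟨_, FiberBundle.mdifferentiableAt_extend I E v, by simp⟩
        obtain ⟨Z, hZ, rfl⟩ : ∃ Z : Π y : M, TangentSpace I y, MDiffAt (T% Z) x ∧ Z x = w :=
          ⟨_, FiberBundle.mdifferentiableAt_extend I E w, by simp⟩
        rw [inner_leviCivitaAt (hf.smul_section hY) hX hZ, koszul_smul hf hY hX hZ]
        simp [inner_add_left, inner_smul_left, inner_leviCivitaAt hY hX hZ] }

/-- The Levi-Civita connection is torsion free. -/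
theorem torsion_leviCivita :
    (leviCivita : CovariantDerivative I E (fun x : M => TangentSpace I x)).torsion = 0 := by
  rw [CovariantDerivative.torsion_eq_zero_iff]
  intro X Y x hX hY
  refine ext_inner_right ℝ fun w => ?_
  obtain ⟨Z, hZ, rfl⟩ : ∃ Z : Π y : M, TangentSpace I y, MDiffAt (T% Z) x ∧ Z x = w :=
    ⟨_, FiberBundle.mdifferentiableAt_extend I E w, by simp⟩
  rw [inner_sub_left]
  change inner ℝ (leviCivitaAt Y x (X x)) (Z x) - inner ℝ (leviCivitaAt X x (Y x)) (Z x) = _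
  rw [inner_leviCivitaAt hY hX hZ, inner_leviCivitaAt hX hY hZ, koszul, koszul,
    mlieBracket_swap_apply (V := Y) (W := X)]
  simp only [real_inner_comm, inner_neg_left]
  ring

/-- The Levi-Civita connection is metric. -/
theorem mvfderiv_inner_leviCivita (hX : MDiffAt (T% X) x) (hY : MDiffAt (T% Y) x)
    (hZ : MDiffAt (T% Z) x) :
    mvfderiv I (fun y => inner ℝ (Y y) (Z y)) x (X x)
      = inner ℝ (leviCivita Y x (X x)) (Z x) + inner ℝ (Y x) (leviCivita Z x (X x)) := by
  have h1 := inner_leviCivitaAt hY hX hZ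
  have h2 := inner_leviCivitaAt hZ hX hY
  rw [real_inner_comm] at h2
  change _ = inner ℝ (leviCivitaAt Y x (X x)) (Z x) + inner ℝ (Y x) (leviCivitaAt Z x (X x))
  rw [h1, h2, koszul, koszul, mlieBracket_swap_apply (V := Z) (W := Y)]
  simp only [real_inner_comm, inner_neg_left]
  ring

end LeviCivita

/-! ### Complex differential forms of mixed degree and the two Clifford actions -/

section Forms

variable {n : ℕ} {M : Type*} [TopologicalSpace M] [ChartedSpace (EuclideanSpace ℝ (Fin n)) M]

variable (n) in
/-- The fibre at `x` of `Λ^* T^*M ⊗ ℂ`: a family of complex-valued alternating `k`-forms on `T_x M`,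
one for each degree `k` (those of degree `k > n` vanish). -/
abbrev Form (x : M) : Type := Π k : ℕ, TangentSpace (𝓡 n) x [⋀^Fin k]→L[ℝ] ℂ

/-- The coordinate representation, in a chart `φ`, of the degree `k` part of a differential form:
its pullback under `φ⁻¹`. -/
noncomputable def inChart (φ : OpenPartialHomeomorph M (EuclideanSpace ℝ (Fin n)))
    (η : Π x : M, Form n x) (k : ℕ) (z : EuclideanSpace ℝ (Fin n)) :
    EuclideanSpace ℝ (Fin n) [⋀^Fin k]→L[ℝ] ℂ :=
  (η (φ.symm z) k).compContinuousLinearMap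
    (mfderiv 𝓘(ℝ, EuclideanSpace ℝ (Fin n)) (𝓡 n) φ.symm z)

/-- Smooth differential forms: all coordinate representations are smooth. -/
def IsSmoothForm (η : Π x : M, Form n x) : Prop :=
  ∀ φ ∈ IsManifold.maximalAtlas (𝓡 n) ∞ M, ∀ k, ContDiffOn ℝ ∞ (inChart φ η k) φ.target

/-- Smoothness of a differential form at a point. -/
def IsSmoothFormAt (η : Π x : M, Form n x) (x : M) : Prop :=
  ∀ k, ContDiffAt ℝ ∞ (inChart (chartAt (EuclideanSpace ℝ (Fin n)) x) η k)
    (chartAt (EuclideanSpace ℝ (Fin n)) x x)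

/-- The coordinate vector field `∂_i` of a chart `φ` (on the domain of `φ`). -/
noncomputable def coordField (φ : OpenPartialHomeomorph M (EuclideanSpace ℝ (Fin n))) (i : Fin n) :
    Π x : M, TangentSpace (𝓡 n) x :=
  mpullback (𝓡 n) 𝓘(ℝ, EuclideanSpace ℝ (Fin n)) φ fun _ => EuclideanSpace.basisFun (Fin n) ℝ i

/-- The coordinate covector `dx^i` of a chart `φ`. -/
noncomputable def coordCovector (φ : OpenPartialHomeomorph M (EuclideanSpace ℝ (Fin n)))
    (i : Fin n) (x : M) : TangentSpace (𝓡 n) x →L[ℝ] ℝ :=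
  (EuclideanSpace.proj i : EuclideanSpace ℝ (Fin n) →L[ℝ] ℝ).comp
    (mfderiv (𝓡 n) 𝓘(ℝ, EuclideanSpace ℝ (Fin n)) φ x)

section Clifford

variable [RiemannianBundle (fun x : M => TangentSpace (𝓡 n) x)]

/-- Exterior multiplication `α ↦ ξ ∧ α` by a covector `ξ`, where
`(ξ ∧ α)(v_0, …, v_k) = ∑ i, (-1)^i ξ(v_i) α(v_0, …, v_(i-1), v_(i+1), …, v_k)`. -/
noncomputable def wedge {x : M} (ξ : TangentSpace (𝓡 n) x →L[ℝ] ℝ) : Module.End ℂ (Form n x) where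
  toFun α
    | 0 => 0
    | k + 1 => .alternatizeUncurryFin (ξ.smulRight (α k))
  map_add' α β := by
    funext k
    cases k with
    | zero => simp
    | succ k =>
      ext v
      simp [ContinuousAlternatingMap.alternatizeUncurryFin_apply, Finset.sum_add_distrib]
  map_smul' c α := by
    funext k
    cases k with
    | zero => exact (smul_zero (A := TangentSpace (𝓡 n) x [⋀^Fin 0]→L[ℝ] ℂ) c).symm
    | succ k =>
      ext v
      simp [ContinuousAlternatingMap.alternatizeUncurryFin_apply, Finset.mul_sum]
      exact Finset.sum_congr rfl fun i _ => by ring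

/-- Interior multiplication `(ι_v α)(v_1, …, v_k) = α(v, v_1, …, v_k)` by a vector `v`. -/
noncomputable def contract {x : M} (v : TangentSpace (𝓡 n) x) : Module.End ℂ (Form n x) where
  toFun α k := (α (k + 1)).curryLeft v
  map_add' α β := by funext k; ext w; simp
  map_smul' c α := by funext k; ext w; simp

/-- The Clifford action `c(v) = ε(v^*) - ι(v^*)`, where `v^* = ⟨v, ·⟩`. -/
noncomputable def cliff {x : M} (v : TangentSpace (𝓡 n) x) : Module.End ℂ (Form n x) :=
  wedge (innerSL ℝ v) - contract v

/-- The Clifford action `ĉ(v) = ε(v^*) + ι(v^*)`, where `v^* = ⟨v, ·⟩`. -/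
noncomputable def cliffHat {x : M} (v : TangentSpace (𝓡 n) x) : Module.End ℂ (Form n x) :=
  wedge (innerSL ℝ v) + contract v

end Clifford

/-! ### The operators `d`, `δ`, `D_V` and `D_V^*` -/

/-- The exterior derivative, computed at `x` in the preferred chart at `x`. -/
noncomputable def extD (η : Π x : M, Form n x) (x : M) : Form n x
  | 0 => 0
  | k + 1 =>
    (extDeriv (inChart (chartAt (EuclideanSpace ℝ (Fin n)) x) η k)
      (chartAt (EuclideanSpace ℝ (Fin n)) x x)).compContinuousLinearMap
        (mfderiv (𝓡 n) 𝓘(ℝ, EuclideanSpace ℝ (Fin n)) (chartAt (EuclideanSpace ℝ (Fin n)) x) x)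

variable [RiemannianBundle (fun x : M => TangentSpace (𝓡 n) x)]

/-- The matrix `(g_ij)` of the metric in the coordinates of a chart `φ`. -/
noncomputable def gram (φ : OpenPartialHomeomorph M (EuclideanSpace ℝ (Fin n))) (x : M) :
    Matrix (Fin n) (Fin n) ℝ :=
  Matrix.of fun i j => inner ℝ (coordField φ i x) (coordField φ j x)

/-- In the coordinates of a chart `φ`, the density `√(det g) • α^♯`, where `α^♯` is the degree `k`
part of `η` with all indices raised, `α^(i_1 … i_k) = g^(i_1 j_1) ⋯ g^(i_k j_k) α_(j_1 … j_k)`,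
regarded as an alternating map whose components are these numbers. -/
noncomputable def raisedDensity (φ : OpenPartialHomeomorph M (EuclideanSpace ℝ (Fin n)))
    (η : Π x : M, Form n x) (k : ℕ) (z : EuclideanSpace ℝ (Fin n)) :
    EuclideanSpace ℝ (Fin n) [⋀^Fin k]→L[ℝ] ℂ :=
  √(gram φ (φ.symm z)).det • (inChart φ η k z).compContinuousLinearMap
    (Matrix.toEuclideanCLM (𝕜 := ℝ) (gram φ (φ.symm z))⁻¹)

/-- The codifferential `δ`, the formal adjoint of `d`, computed at `x` in the preferred chart at
`x` by the formula
`(δη)^(i_1 … i_k) = - (det g)^(-1/2) ∑ j, ∂_j ((det g)^(1/2) η^(j i_1 … i_k))`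
that integration by parts gives, followed by lowering the indices `i_1, …, i_k`. -/
noncomputable def codiff (η : Π x : M, Form n x) (x : M) : Form n x := fun k =>
  (-(√(gram (chartAt (EuclideanSpace ℝ (Fin n)) x) x).det)⁻¹ •
    ∑ j : Fin n,
      (fderiv ℝ (raisedDensity (chartAt (EuclideanSpace ℝ (Fin n)) x) η (k + 1))
        (chartAt (EuclideanSpace ℝ (Fin n)) x x) (EuclideanSpace.basisFun (Fin n) ℝ j)).curryLeft
          (EuclideanSpace.basisFun (Fin n) ℝ j)).compContinuousLinearMap
    ((Matrix.toEuclideanCLM (𝕜 := ℝ) (gram (chartAt (EuclideanSpace ℝ (Fin n)) x) x)).comp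
      (mfderiv (𝓡 n) 𝓘(ℝ, EuclideanSpace ℝ (Fin n)) (chartAt (EuclideanSpace ℝ (Fin n)) x) x))

/-- The operator `D = d + δ`. -/
noncomputable def hodgeD (η : Π x : M, Form n x) (x : M) : Form n x :=
  extD η x + codiff η x

/-- The operator `D_V = √-1 ĉ(V) (d + δ)`. -/
noncomputable def opDV (V : Π x : M, TangentSpace (𝓡 n) x) (η : Π x : M, Form n x) (x : M) :
    Form n x :=
  Complex.I • cliffHat (V x) (hodgeD η x)

/-- The operator `D_V^* = -√-1 (d + δ) ĉ(V)`. -/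
noncomputable def opDVStar (V : Π x : M, TangentSpace (𝓡 n) x) (η : Π x : M, Form n x) (x : M) :
    Form n x :=
  -Complex.I • hodgeD (fun y => cliffHat (V y) (η y)) x

/-! ### Connections on the bundle of forms -/

variable [IsManifold (𝓡 n) ∞ M]

/-- A (complex linear) connection on `Λ^* T^*M ⊗ ℂ`; `cov σ x v` stands for `∇_v σ`. -/
structure IsFormConnection (cov : (Π x : M, Form n x) → Π x : M, TangentSpace (𝓡 n) x → Form n x) :
    Prop where
  add_dir : ∀ σ x (v w : TangentSpace (𝓡 n) x), IsSmoothFormAt σ x →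
    cov σ x (v + w) = cov σ x v + cov σ x w
  smul_dir : ∀ σ x (a : ℝ) (v : TangentSpace (𝓡 n) x), IsSmoothFormAt σ x →
    cov σ x (a • v) = a • cov σ x v
  add : ∀ σ τ x (v : TangentSpace (𝓡 n) x), IsSmoothFormAt σ x → IsSmoothFormAt τ x →
    cov (σ + τ) x v = cov σ x v + cov τ x v
  leibniz : ∀ (f : M → ℂ) σ x (v : TangentSpace (𝓡 n) x),
    ContMDiffAt (𝓡 n) 𝓘(ℝ, ℂ) ∞ f x → IsSmoothFormAt σ x →
    cov (fun y => f y • σ y) x v = f x • cov σ x v + mvfderiv (𝓡 n) f x v • σ x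
  smooth : ∀ σ (X : Π x : M, TangentSpace (𝓡 n) x) x, IsSmoothFormAt σ x →
    ContMDiffAt (𝓡 n) (𝓡 n).tangent ∞ (T% X) x → IsSmoothFormAt (fun y => cov σ y (X y)) x

variable [IsContMDiffRiemannianBundle (𝓡 n) ∞ (EuclideanSpace ℝ (Fin n))
    (fun x : M => TangentSpace (𝓡 n) x)]

/-- The connection `∇` on `Λ^* T^*M ⊗ ℂ` induced by the Levi-Civita connection, computed at `x` in
the preferred chart at `x`: `∇_v η = v(η) - ∑ j, dx^j ∧ ι_(∇_v ∂_j) η`, where `v(η)` differentiates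
the components of `η`. In components,
`(∇_v η)(∂_(i_1), …, ∂_(i_k)) = v(η(∂_(i_1), …)) - ∑ a, η(…, ∇_v ∂_(i_a), …)`. -/
noncomputable def formNabla (η : Π x : M, Form n x) (x : M) (v : TangentSpace (𝓡 n) x) :
    Form n x :=
  (fun k => (fderiv ℝ (inChart (chartAt (EuclideanSpace ℝ (Fin n)) x) η k)
      (chartAt (EuclideanSpace ℝ (Fin n)) x x)
      (mfderiv (𝓡 n) 𝓘(ℝ, EuclideanSpace ℝ (Fin n)) (chartAt (EuclideanSpace ℝ (Fin n)) x) x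
        v)).compContinuousLinearMap
      (mfderiv (𝓡 n) 𝓘(ℝ, EuclideanSpace ℝ (Fin n)) (chartAt (EuclideanSpace ℝ (Fin n)) x) x))
    - ∑ j : Fin n, wedge (coordCovector (chartAt (EuclideanSpace ℝ (Fin n)) x) j x)
        (contract (leviCivita (coordField (chartAt (EuclideanSpace ℝ (Fin n)) x) j) x v) (η x))

/-- The extension of `α ∈ Λ^* T_x^*M ⊗ ℂ` to a form around `x` with constant components in the
preferred chart at `x`. -/
noncomputable def extendForm {x : M} (α : Form n x) (y : M) : Form n y := fun k =>
  (α k).compContinuousLinearMap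
    ((mfderiv (𝓡 n) 𝓘(ℝ, EuclideanSpace ℝ (Fin n)) (chartAt (EuclideanSpace ℝ (Fin n)) x)
        x).inverse.comp
      (mfderiv (𝓡 n) 𝓘(ℝ, EuclideanSpace ℝ (Fin n)) (chartAt (EuclideanSpace ℝ (Fin n)) x) y))

/-- The covariant derivative `∇_v A` at `x` of a field `A` of endomorphisms of `Λ^* T^*M ⊗ ℂ`:
the endomorphism `(∇_v A) α = ∇_v (A α) - A (∇_v α)`, with `α` extended around `x`. -/
noncomputable def endNabla (A : Π x : M, Module.End ℂ (Form n x)) (x : M)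
    (v : TangentSpace (𝓡 n) x) (α : Form n x) : Form n x :=
  formNabla (fun y => A y (extendForm α y)) x v - A x (formNabla (extendForm α) x v)

/-- The second order operator `∑ i j, g^ij (∇_(∂_i) ∇_(∂_j) - ∇_(∇^L_(∂_i) ∂_j))` of a
connection `∇`, in the coordinates of a chart `φ`. -/
noncomputable def traceHessian
    (cov : (Π x : M, Form n x) → Π x : M, TangentSpace (𝓡 n) x → Form n x)
    (φ : OpenPartialHomeomorph M (EuclideanSpace ℝ (Fin n))) (η : Π x : M, Form n x) (x : M) :
    Form n x :=
  ∑ i : Fin n, ∑ j : Fin n, (gram φ x)⁻¹ i j •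
    (cov (fun y => cov η y (coordField φ j y)) x (coordField φ i x)
      - cov η x (leviCivita (coordField φ j) x (coordField φ i x)))

/-- `∇` is the connection associated with the operator `P` of Laplace type: there is a field `F` of
endomorphisms with `P = -(g^ij (∇_(∂_i) ∇_(∂_j) - ∇_(∇^L_(∂_i) ∂_j)) + F)` in every chart. -/
def IsLaplaceConnection (P : (Π x : M, Form n x) → Π x : M, Form n x)
    (cov : (Π x : M, Form n x) → Π x : M, TangentSpace (𝓡 n) x → Form n x) : Prop :=
  IsFormConnection cov ∧ ∃ F : Π x : M, Module.End ℂ (Form n x),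
    ∀ η, IsSmoothForm η → ∀ φ ∈ IsManifold.maximalAtlas (𝓡 n) ∞ M, ∀ x ∈ φ.source,
      P η x = -(traceHessian cov φ η x + F x (η x))

/-- The endomorphism `ĉ(V) ∑ q, ĉ(∇^L_(e_q) V) c(e_q)` at `x`, for a family `e` of vectors in
`T_x M`. -/
noncomputable def cliffNabla (V : Π x : M, TangentSpace (𝓡 n) x) (x : M) {ι : Type} [Fintype ι]
    (e : ι → TangentSpace (𝓡 n) x) : Module.End ℂ (Form n x) :=
  cliffHat (V x) * ∑ q, cliffHat (leviCivita V x (e q)) * cliff (e q)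

/-- The connection `∇_v - (1/2) ĉ(V) ∑ q, ĉ(∇^L_(e_q) V) c(e_q) c(v)`, where `e` is any orthonormal
basis of `T_x M`. -/
noncomputable def twistedNabla (V : Π x : M, TangentSpace (𝓡 n) x) (η : Π x : M, Form n x) (x : M)
    (v : TangentSpace (𝓡 n) x) : Form n x :=
  formNabla η x v - (1 / 2 : ℝ) •
    cliffNabla V x (stdOrthonormalBasis ℝ (TangentSpace (𝓡 n) x)) (cliff v (η x))

/-! ### Orthonormal frames and curvature -/

/-- A smooth local orthonormal frame `e_1, …, e_n` on an open set `U`. -/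
structure IsOrthonormalFrameOn (e : Fin n → Π x : M, TangentSpace (𝓡 n) x) (U : Set M) : Prop where
  isOpen : IsOpen U
  smooth : ∀ i, ContMDiffOn (𝓡 n) (𝓡 n).tangent ∞ (T% (e i)) U
  orthonormal : ∀ x ∈ U, Orthonormal ℝ fun i => e i x

/-- The curvature `R(X, Y) Z = ∇_X ∇_Y Z - ∇_Y ∇_X Z - ∇_[X, Y] Z` of the Levi-Civita connection. -/
noncomputable def curvature (X Y Z : Π x : M, TangentSpace (𝓡 n) x) (x : M) :
    TangentSpace (𝓡 n) x :=
  leviCivita (fun y => leviCivita Z y (Y y)) x (X x)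
    - leviCivita (fun y => leviCivita Z y (X y)) x (Y x)
    - leviCivita Z x (mlieBracket (𝓡 n) X Y x)

/-- `R_ijkl = ⟨R(e_i, e_j) e_k, e_l⟩`. -/
noncomputable def riem (e : Fin n → Π x : M, TangentSpace (𝓡 n) x) (x : M) (i j k l : Fin n) : ℝ :=
  inner ℝ (curvature (e i) (e j) (e k) x) (e l x)

/-- The scalar curvature `K = ∑ i j, ⟨R(e_i, e_j) e_j, e_i⟩`, for an orthonormal frame `e`; it is
positive for a round sphere. -/
noncomputable def scalarCurvature (e : Fin n → Π x : M, TangentSpace (𝓡 n) x) (x : M) : ℝ :=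
  ∑ i, ∑ j, riem e x i j j i

/-- The endomorphism `-(1/8) ∑ i j k l, R_ijkl ĉ(e_i) ĉ(e_j) c(e_k) c(e_l) + K/4` at `x`. -/
noncomputable def weitzenbock (e : Fin n → Π x : M, TangentSpace (𝓡 n) x) (x : M) :
    Module.End ℂ (Form n x) :=
  -(1 / 8 : ℝ) • (∑ i, ∑ j, ∑ k, ∑ l, riem e x i j k l •
      (cliffHat (e i x) * cliffHat (e j x) * cliff (e k x) * cliff (e l x)))
    + (1 / 4 * scalarCurvature e x) • (1 : Module.End ℂ (Form n x))

end Forms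

end RiemannianForms

open RiemannianForms

/-!
Write `D = d + δ`, let `∇` be the connection on forms, and let
`T = ĉ(V) ∑ q, ĉ(∇_(e_q) V) c(e_q)` for an orthonormal frame `e`.

The connection on forms is characterised by the Leibniz rule `mvfderiv_form_apply`. Evaluating on
fields that are parallel at a point (`exists_parallel_extension`), it yields the product rules for
`c(X)` and `ĉ(X)` and the Ricci identity `formHessian_sub_formHessian`. Comparing coordinate
expressions, with the symmetry of the Christoffel symbols and the formula for the derivative of
`√(det g)`, gives `d = ∑ dx^j ∧ ∇_(∂_j)` and `δ = -∑ ι_(grad x^j) ∇_(∂_j)`, hence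
`D = ∑ c(e_q) ∇_(e_q)` in any orthonormal basis (`hodgeD_eq_sum_cliff`).

Squaring, the derivatives of the frame cancel because its connection matrix is skew, and
`D² = ∑ c(e_i) c(e_j) ∇²_(e_i, e_j)`. The Clifford relations separate the trace of `∇²` from the
antisymmetric part, which is the curvature; the symmetries of the curvature tensor reduce the
product of four `c` to the scalar curvature (`sum_clifford_hessian`). This is the Weitzenböck
formula `hodgeD_hodgeD_eq`.

As `ĉ(V)² = 1` and `ĉ(V)` anticommutes with every `c(e_q)`, one finds `D_V^* D_V = D²` and
`D_V² = D² + T D` (`opDV_opDV`). The twisted connection `∇_X - T c(X) / 2` has second covariant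
derivative with trace
`∑ ∇²_(e_i, e_i) - (1/2) ∑ (∇_(e_i) T) c(e_i) - T D + (1/4) ∑ (T c(e_i))²`
(`traceHessian_twistedNabla`), so it absorbs the first order term `T D`.

For uniqueness, let two connections be associated with the same operator `P`, let `f` be a smooth
function vanishing at `x`, and compare the expressions for `P (f η)` at `x`. Only terms with one
derivative on `f` and one on `η` depend on the connection, and since `df` is arbitrary at `x` (bump
functions exist on a Hausdorff manifold), the two connections agree on `η` at `x`
(`IsLaplaceConnection.unique`).
-/

set_option linter.unusedSectionVars false

namespace RiemannianForms

/-! ### Coordinate fields and orthonormal frames -/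

section Fields

variable {n : ℕ} {M : Type*} [TopologicalSpace M] [ChartedSpace (EuclideanSpace ℝ (Fin n)) M]
  [IsManifold (𝓡 n) ∞ M] {X Y Z : Π x : M, TangentSpace (𝓡 n) x} {x : M}
  {F : Type*} [NormedAddCommGroup F] [NormedSpace ℝ F]

/-- Smoothness of a vector field at a point. -/
abbrev SmoothFieldAt (X : Π x : M, TangentSpace (𝓡 n) x) (x : M) : Prop :=
  ContMDiffAt (𝓡 n) (𝓡 n).tangent ∞ (T% X) x

/-- Differentiability of a vector field at a point. -/
abbrev DiffFieldAt (X : Π x : M, TangentSpace (𝓡 n) x) (x : M) : Prop :=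
  MDifferentiableAt (𝓡 n) (𝓡 n).tangent (T% X) x

theorem SmoothFieldAt.diff (hX : SmoothFieldAt X x) : DiffFieldAt X x :=
  ContMDiffAt.mdifferentiableAt hX (by simp)

theorem SmoothFieldAt.eventually_diff (hX : SmoothFieldAt X x) : ∀ᶠ y in 𝓝 x, DiffFieldAt X y := by
  have h1 : ContMDiffAt (𝓡 n) (𝓡 n).tangent 1 (T% X) x := hX.of_le (by simp)
  filter_upwards [(contMDiffAt_iff_contMDiffAt_nhds (by simp)).1 h1] with y hy
  exact ContMDiffAt.mdifferentiableAt hy (by simp)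

theorem SmoothFieldAt.one (hX : SmoothFieldAt X x) :
    ContMDiffAt (𝓡 n) (𝓡 n).tangent 1 (T% X) x := ContMDiffAt.of_le hX (by simp)

theorem eventually_mdifferentiableAt {f : M → F} (hf : ContMDiffAt (𝓡 n) 𝓘(ℝ, F) ∞ f x) :
    ∀ᶠ y in 𝓝 x, MDifferentiableAt (𝓡 n) 𝓘(ℝ, F) f y := by
  filter_upwards [(contMDiffAt_iff_contMDiffAt_nhds (by simp)).1
    (hf.of_le (show (1 : ℕ∞ω) ≤ ∞ by simp))] with y hy
  exact ContMDiffAt.mdifferentiableAt hy (by simp)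

theorem contMDiffAt_mvfderiv_apply {m : ℕ∞ω} (hm : m ≤ ∞) {f : M → F}
    (hf : ContMDiffAt (𝓡 n) 𝓘(ℝ, F) ∞ f x) (hX : ContMDiffAt (𝓡 n) (𝓡 n).tangent m (T% X) x) :
    ContMDiffAt (𝓡 n) 𝓘(ℝ, F) m (fun y => mvfderiv (𝓡 n) f y (X y)) x := by
  have hm1 : m + 1 ≤ ∞ := by
    have := add_le_add_left hm 1
    simpa using this
  have h1 := hf.mfderiv_const hm1
  rw [contMDiffAt_section] at hX
  have h2 := ContMDiffAt.clm_apply h1 hX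
  refine h2.congr_of_eventuallyEq ?_
  have hb := (trivializationAt (EuclideanSpace ℝ (Fin n))
    (TangentSpace (𝓡 n)) x).open_baseSet.mem_nhds (FiberBundle.mem_baseSet_trivializationAt' x)
  filter_upwards [hb] with y hy
  have hy' : f y ∈ (trivializationAt F (TangentSpace 𝓘(ℝ, F)) (f x)).baseSet := by
    rw [TangentBundle.trivializationAt_baseSet]; exact Set.mem_univ _
  unfold inTangentCoordinates
  erw [ContinuousLinearMap.inCoordinates_eq hy hy']
  simp [mvfderiv]
  exact congrArg (mfderiv (𝓡 n) 𝓘(ℝ, F) f y) (Trivialization.symm_apply_apply_mk _ hy _).symm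

theorem chart_mdifferentiable {φ : OpenPartialHomeomorph M (EuclideanSpace ℝ (Fin n))}
    (hφ : φ ∈ IsManifold.maximalAtlas (𝓡 n) ∞ M) :
    φ.MDifferentiable (𝓡 n) 𝓘(ℝ, EuclideanSpace ℝ (Fin n)) :=
  have h1 := IsManifold.maximalAtlas_subset_of_le (I := 𝓡 n) (M := M) (m := 1) (n := ∞)
    (by simp) hφ
  ⟨fun _ hy => (mdifferentiableAt_of_mem_maximalAtlas h1 hy).mdifferentiableWithinAt,
    fun _ hy => (mdifferentiableAt_symm_of_mem_maximalAtlas h1 hy).mdifferentiableWithinAt⟩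

theorem isInvertible_mfderiv_chart {φ : OpenPartialHomeomorph M (EuclideanSpace ℝ (Fin n))}
    (hφ : φ ∈ IsManifold.maximalAtlas (𝓡 n) ∞ M) (hx : x ∈ φ.source) :
    (mfderiv (𝓡 n) 𝓘(ℝ, EuclideanSpace ℝ (Fin n)) φ x).IsInvertible :=
  ⟨(chart_mdifferentiable hφ).mfderiv hx, rfl⟩

theorem smoothFieldAt_coordField {φ : OpenPartialHomeomorph M (EuclideanSpace ℝ (Fin n))}
    (hφ : φ ∈ IsManifold.maximalAtlas (𝓡 n) ∞ M) (hx : x ∈ φ.source) (i : Fin n) :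
    SmoothFieldAt (coordField φ i) x := by
  refine ContMDiffAt.mpullback_vectorField_preimage (n := ∞) (m := ∞) ?_ ?_
    (isInvertible_mfderiv_chart hφ hx) (by simp)
  · exact (contMDiffAt_vectorSpace_iff_contDiffAt
      (V := fun _ => EuclideanSpace.basisFun (Fin n) ℝ i)).2 contDiffAt_const
  · exact contMDiffAt_of_mem_maximalAtlas hφ hx

theorem mfderiv_coordField {φ : OpenPartialHomeomorph M (EuclideanSpace ℝ (Fin n))}
    (hφ : φ ∈ IsManifold.maximalAtlas (𝓡 n) ∞ M) (hx : x ∈ φ.source) (i : Fin n) :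
    mfderiv (𝓡 n) 𝓘(ℝ, EuclideanSpace ℝ (Fin n)) φ x (coordField φ i x)
      = EuclideanSpace.basisFun (Fin n) ℝ i :=
  (isInvertible_mfderiv_chart hφ hx).self_apply_inverse _

/-- The expansion of a tangent vector in the coordinate basis. -/
theorem sum_coord_smul_coordField {φ : OpenPartialHomeomorph M (EuclideanSpace ℝ (Fin n))}
    (hφ : φ ∈ IsManifold.maximalAtlas (𝓡 n) ∞ M) (hx : x ∈ φ.source) (v : TangentSpace (𝓡 n) x) :
    ∑ i, coordCovector φ i x v • coordField φ i x = v := by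
  apply (chart_mdifferentiable hφ).mfderiv_injective hx
  rw [map_sum]
  simp only [map_smul, mfderiv_coordField hφ hx]
  exact (EuclideanSpace.basisFun (Fin n) ℝ).sum_repr
    (mfderiv (𝓡 n) 𝓘(ℝ, EuclideanSpace ℝ (Fin n)) φ x v)

theorem linearIndependent_coordField {φ : OpenPartialHomeomorph M (EuclideanSpace ℝ (Fin n))}
    (hφ : φ ∈ IsManifold.maximalAtlas (𝓡 n) ∞ M) (hx : x ∈ φ.source) :
    LinearIndependent ℝ fun i => coordField φ i x := by
  refine LinearIndependent.of_comp
    (mfderiv (𝓡 n) 𝓘(ℝ, EuclideanSpace ℝ (Fin n)) φ x).toLinearMap ?_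
  have : (mfderiv (𝓡 n) 𝓘(ℝ, EuclideanSpace ℝ (Fin n)) φ x).toLinearMap ∘
      (fun i => coordField φ i x) = EuclideanSpace.basisFun (Fin n) ℝ := by
    ext1 i; exact mfderiv_coordField hφ hx i
  rw [this]
  exact (EuclideanSpace.basisFun (Fin n) ℝ).orthonormal.linearIndependent

variable [RiemannianBundle (fun x : M => TangentSpace (𝓡 n) x)]

theorem finrank_tangentSpace (x : M) : finrank ℝ (TangentSpace (𝓡 n) x) = n :=
  finrank_euclideanSpace_fin (𝕜 := ℝ) (n := n)

/-- `n` orthonormal tangent vectors form an orthonormal basis. -/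
noncomputable def tangentBasis {x : M} {v : Fin n → TangentSpace (𝓡 n) x} (hv : Orthonormal ℝ v) :
    OrthonormalBasis (Fin n) ℝ (TangentSpace (𝓡 n) x) :=
  OrthonormalBasis.mk hv
    (hv.linearIndependent.span_eq_top_of_card_eq_finrank' (by simp [finrank_tangentSpace])).ge

@[simp]
theorem tangentBasis_apply {x : M} {v : Fin n → TangentSpace (𝓡 n) x} (hv : Orthonormal ℝ v)
    (i : Fin n) : tangentBasis hv i = v i := by
  simp [tangentBasis]

theorem sum_inner_smul {x : M} {v : Fin n → TangentSpace (𝓡 n) x} (hv : Orthonormal ℝ v)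
    (w : TangentSpace (𝓡 n) x) : ∑ i, inner ℝ (v i) w • v i = w := by
  simpa using (tangentBasis hv).sum_repr' w

variable [IsContMDiffRiemannianBundle (𝓡 n) ∞ (EuclideanSpace ℝ (Fin n))
    (fun x : M => TangentSpace (𝓡 n) x)] {e : Fin n → Π x : M, TangentSpace (𝓡 n) x} {U : Set M}
  {m : ℕ∞ω}

theorem contMDiffAt_inner (hX : ContMDiffAt (𝓡 n) (𝓡 n).tangent m (T% X) x)
    (hY : ContMDiffAt (𝓡 n) (𝓡 n).tangent m (T% Y) x) (hm : m ≤ ∞) :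
    ContMDiffAt (𝓡 n) 𝓘(ℝ, ℝ) m (fun y => inner ℝ (X y) (Y y)) x :=
  have : IsContMDiffRiemannianBundle (𝓡 n) m (EuclideanSpace ℝ (Fin n))
    (fun x : M => TangentSpace (𝓡 n) x) := .of_le hm
  ContMDiffAt.inner_bundle (E := fun x : M => TangentSpace (𝓡 n) x) hX hY

theorem IsOrthonormalFrameOn.smoothAt (he : IsOrthonormalFrameOn e U) (hx : x ∈ U) (i : Fin n) :
    SmoothFieldAt (e i) x :=
  (he.smooth i).contMDiffAt (he.isOpen.mem_nhds hx)

theorem IsOrthonormalFrameOn.contMDiffAt_of_inner (he : IsOrthonormalFrameOn e U) (hx : x ∈ U)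
    (hm : m ≤ ∞) (h : ∀ i, ContMDiffAt (𝓡 n) 𝓘(ℝ, ℝ) m (fun y => inner ℝ (e i y) (X y)) x) :
    ContMDiffAt (𝓡 n) (𝓡 n).tangent m (T% X) x := by
  have h1 : ContMDiffAt (𝓡 n) (𝓡 n).tangent m
      (T% (fun y => ∑ i, inner ℝ (e i y) (X y) • e i y)) x :=
    .sum_section fun i _ => (h i).smul_section ((he.smoothAt hx i).of_le hm)
  refine h1.congr_of_eventuallyEq ?_
  filter_upwards [he.isOpen.mem_nhds hx] with y hy
  rw [sum_inner_smul (he.orthonormal y hy)]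

theorem contMDiffAt_gramSchmidt {b : Fin n → Π x : M, TangentSpace (𝓡 n) x}
    (hb : ∀ i, ContMDiffAt (𝓡 n) (𝓡 n).tangent ∞ (T% (b i)) x)
    (hli : LinearIndependent ℝ fun i => b i x) (i : Fin n) :
    ContMDiffAt (𝓡 n) (𝓡 n).tangent ∞
      (T% (fun y => InnerProductSpace.gramSchmidt ℝ (fun j => b j y) i)) x := by
  induction i using WellFoundedLT.induction with
  | ind i ih =>
  have h1 : ContMDiffAt (𝓡 n) (𝓡 n).tangent ∞ (T% (fun y => b i y - ∑ j ∈ Finset.Iio i,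
      (inner ℝ (InnerProductSpace.gramSchmidt ℝ (fun j => b j y) j) (b i y) /
        (inner ℝ (InnerProductSpace.gramSchmidt ℝ (fun j => b j y) j)
          (InnerProductSpace.gramSchmidt ℝ (fun j => b j y) j))) •
        InnerProductSpace.gramSchmidt ℝ (fun j => b j y) j)) x := by
    refine ContMDiffAt.sub_section (hb i) (.sum_section fun j hj => ?_)
    have hj' := ih j (by simpa using hj)
    refine ContMDiffAt.smul_section (ContMDiffAt.div₀ (contMDiffAt_inner hj' (hb i) le_rfl)
      (contMDiffAt_inner hj' hj' le_rfl) ?_) hj'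
    simpa using InnerProductSpace.gramSchmidt_ne_zero j hli
  refine h1.congr_of_eventuallyEq (.of_forall fun y => ?_)
  refine congrArg (TotalSpace.mk' (EuclideanSpace ℝ (Fin n)) y) ?_
  rw [eq_sub_iff_add_eq]
  refine Eq.trans ?_ (InnerProductSpace.gramSchmidt_def'' ℝ (fun j => b j y) i).symm
  simp

/-- Local orthonormal frames exist: orthonormalize the coordinate fields of a chart. -/
theorem exists_isOrthonormalFrameOn (x : M) :
    ∃ (e : Fin n → Π x : M, TangentSpace (𝓡 n) x) (U : Set M),
      IsOrthonormalFrameOn e U ∧ x ∈ U := by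
  have hφ := IsManifold.chart_mem_maximalAtlas (I := 𝓡 n) (n := ∞) x
  refine ⟨fun i y => InnerProductSpace.gramSchmidtNormed ℝ
    (fun j => coordField (chartAt (EuclideanSpace ℝ (Fin n)) x) j y) i,
    (chartAt (EuclideanSpace ℝ (Fin n)) x).source, ⟨(chartAt _ x).open_source, fun i y hy => ?_,
      fun y hy => InnerProductSpace.gramSchmidtNormed_orthonormal
        (linearIndependent_coordField hφ hy)⟩, mem_chart_source _ x⟩
  have hli := linearIndependent_coordField hφ hy
  have h1 := contMDiffAt_gramSchmidt (fun i => smoothFieldAt_coordField hφ hy i) hli i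
  have h2 := contMDiffAt_inner h1 h1 le_rfl
  have h0 : inner ℝ
      (InnerProductSpace.gramSchmidt ℝ
        (fun j => coordField (chartAt (EuclideanSpace ℝ (Fin n)) x) j y) i)
      (InnerProductSpace.gramSchmidt ℝ
        (fun j => coordField (chartAt (EuclideanSpace ℝ (Fin n)) x) j y) i) ≠ 0 := by
    simpa using InnerProductSpace.gramSchmidt_ne_zero i hli
  have h3 := ((Real.contDiffAt_sqrt h0 (n := ∞)).contMDiffAt.comp y h2).inv₀
    (by simpa using InnerProductSpace.gramSchmidt_ne_zero i hli)
  refine ((h3.smul_section h1).congr_of_eventuallyEq (.of_forall fun z => ?_)).contMDiffWithinAt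
  simp [InnerProductSpace.gramSchmidtNormed]

end Fields

/-! ### Vector fields and the Levi-Civita connection -/

section LeviCivita

variable {n : ℕ} {M : Type*} [TopologicalSpace M] [ChartedSpace (EuclideanSpace ℝ (Fin n)) M]
  [IsManifold (𝓡 n) ∞ M] {X Y Z W : Π x : M, TangentSpace (𝓡 n) x} {x : M}

theorem isManifold_minSmoothness_two : IsManifold (𝓡 n) (minSmoothness ℝ 2) M := by
  simp only [minSmoothness_of_isRCLikeNormedField]
  exact IsManifold.of_le (n := ∞) (WithTop.coe_le_coe.2 le_top : ((2 : ℕ∞) : ℕ∞ω) ≤ ∞)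

theorem isManifold_minSmoothness_three : IsManifold (𝓡 n) (minSmoothness ℝ 3) M := by
  simp only [minSmoothness_of_isRCLikeNormedField]
  exact IsManifold.of_le (n := ∞) (WithTop.coe_le_coe.2 le_top : ((3 : ℕ∞) : ℕ∞ω) ≤ ∞)

attribute [local instance] isManifold_minSmoothness_two isManifold_minSmoothness_three

theorem SmoothFieldAt.mlieBracket (hX : SmoothFieldAt X x) (hY : SmoothFieldAt Y x) :
    SmoothFieldAt (mlieBracket (𝓡 n) X Y) x :=
  have : IsManifold (𝓡 n) ((⊤ : ℕ∞) + 1) M := by simpa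
  ContMDiffAt.mlieBracket_vectorField (m := ⊤) (n := ⊤) hX hY (by simp)

/-- The Lie bracket acts on functions as the commutator. -/
theorem mvfderiv_mlieBracket_real {f : M → ℝ} (hf : ContMDiffAt (𝓡 n) 𝓘(ℝ, ℝ) ∞ f x)
    (hX : SmoothFieldAt X x)
    (hY : SmoothFieldAt Y x) :
    mvfderiv (𝓡 n) f x (mlieBracket (𝓡 n) X Y x)
      = mvfderiv (𝓡 n) (fun y => mvfderiv (𝓡 n) f y (Y y)) x (X x)
        - mvfderiv (𝓡 n) (fun y => mvfderiv (𝓡 n) f y (X y)) x (Y x) := by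
  -- In dimension zero there is nothing to prove; otherwise the identity is the coefficient of a
  -- nonvanishing field `Z` in the Jacobi identity for `X`, `Y`, `f • Z`.
  rcases Nat.eq_zero_or_pos n with rfl | hn
  · have : Subsingleton (TangentSpace (𝓡 0) x) :=
      inferInstanceAs (Subsingleton (EuclideanSpace ℝ (Fin 0)))
    rw [Subsingleton.elim (mlieBracket (𝓡 0) X Y x) 0, Subsingleton.elim (X x) 0,
      Subsingleton.elim (Y x) 0]
    simp
  have hφ := IsManifold.chart_mem_maximalAtlas (I := 𝓡 n) (n := ∞) x
  have hx : x ∈ (chartAt (EuclideanSpace ℝ (Fin n)) x).source := mem_chart_source _ x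
  set Z := coordField (chartAt (EuclideanSpace ℝ (Fin n)) x) ⟨0, hn⟩ with hZdef
  have hZ : SmoothFieldAt Z x := smoothFieldAt_coordField hφ hx _
  have hZ0 : Z x ≠ 0 := (linearIndependent_coordField hφ hx).ne_zero _
  have key {A : Π x : M, TangentSpace (𝓡 n) x} :
      mlieBracket (𝓡 n) A (f • Z) =ᶠ[𝓝 x]
        (fun y => mvfderiv (𝓡 n) f y (A y)) • Z + f • mlieBracket (𝓡 n) A Z := by
    filter_upwards [eventually_mdifferentiableAt hf, hZ.eventually_diff] with y h1 h2
    rw [mlieBracket_smul_right h1 h2]; rfl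
  have hd {A : Π x : M, TangentSpace (𝓡 n) x} (hA : SmoothFieldAt A x) :
      MDifferentiableAt (𝓡 n) 𝓘(ℝ, ℝ) (fun y => mvfderiv (𝓡 n) f y (A y)) x :=
    (contMDiffAt_mvfderiv_apply le_rfl hf hA).mdifferentiableAt (by simp)
  have expand {A B : Π x : M, TangentSpace (𝓡 n) x} (hA : SmoothFieldAt A x)
      (hB : SmoothFieldAt B x) :
      mlieBracket (𝓡 n) A (mlieBracket (𝓡 n) B (f • Z)) x =
        mvfderiv (𝓡 n) (fun y => mvfderiv (𝓡 n) f y (B y)) x (A x) • Z x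
        + mvfderiv (𝓡 n) f x (B x) • mlieBracket (𝓡 n) A Z x
        + (mvfderiv (𝓡 n) f x (A x) • mlieBracket (𝓡 n) B Z x
        + f x • mlieBracket (𝓡 n) A (mlieBracket (𝓡 n) B Z) x) := by
    have hBZ := (hB.mlieBracket hZ).diff
    have hs1 : DiffFieldAt ((fun y => mvfderiv (𝓡 n) f y (B y)) • Z) x :=
      (hd hB).smul_section hZ.diff
    have hs2 : DiffFieldAt (f • mlieBracket (𝓡 n) B Z) x :=
      (hf.mdifferentiableAt (by simp)).smul_section hBZ
    rw [Filter.EventuallyEq.mlieBracket_vectorField_eq (Filter.EventuallyEq.refl _ A)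
      (key (A := B)), mlieBracket_add_right hs1 hs2, mlieBracket_smul_right (hd hB) hZ.diff,
      mlieBracket_smul_right (hf.mdifferentiableAt (by simp)) hBZ]
  have hfZ : SmoothFieldAt (f • Z) x := hf.smul_section hZ
  have h2 : (minSmoothness ℝ 2 : ℕ∞ω) ≤ ∞ := by
    rw [minSmoothness_of_isRCLikeNormedField]
    exact (WithTop.coe_le_coe.2 le_top : ((2 : ℕ∞) : ℕ∞ω) ≤ ∞)
  have J1 := leibniz_identity_mlieBracket_apply (hX.of_le h2) (hY.of_le h2) (hfZ.of_le h2)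
  have J2 := leibniz_identity_mlieBracket_apply (hX.of_le h2) (hY.of_le h2) (hZ.of_le h2)
  rw [expand hX hY, expand hY hX, mlieBracket_smul_right (hf.mdifferentiableAt (by simp)) hZ.diff,
    J2] at J1
  have J3 : (mvfderiv (𝓡 n) f x (mlieBracket (𝓡 n) X Y x)
      - (mvfderiv (𝓡 n) (fun y => mvfderiv (𝓡 n) f y (Y y)) x (X x)
        - mvfderiv (𝓡 n) (fun y => mvfderiv (𝓡 n) f y (X y)) x (Y x))) • Z x = 0 := by
    rw [← sub_eq_zero] at J1
    rw [← neg_eq_zero, ← J1]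
    module
  exact sub_eq_zero.1 ((smul_eq_zero.1 J3).resolve_right hZ0)

variable [RiemannianBundle (fun x : M => TangentSpace (𝓡 n) x)]
  [IsContMDiffRiemannianBundle (𝓡 n) ∞ (EuclideanSpace ℝ (Fin n))
    (fun x : M => TangentSpace (𝓡 n) x)] {e : Fin n → Π x : M, TangentSpace (𝓡 n) x} {U : Set M}

theorem inner_leviCivita (hY : DiffFieldAt Y x) (hX : DiffFieldAt X x)
    (hZ : DiffFieldAt Z x) :
    inner ℝ (leviCivita Y x (X x)) (Z x) = koszul Y X Z x :=
  inner_leviCivitaAt hY hX hZ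

theorem contMDiffAt_koszul (hY : SmoothFieldAt Y x) (hX : SmoothFieldAt X x)
    (hZ : SmoothFieldAt Z x) : ContMDiffAt (𝓡 n) 𝓘(ℝ, ℝ) ∞ (koszul Y X Z) x := by
  have i1 {A B : Π x : M, TangentSpace (𝓡 n) x} (hA : SmoothFieldAt A x)
    (hB : SmoothFieldAt B x) := contMDiffAt_inner hA hB le_rfl
  have i2 {A B C : Π x : M, TangentSpace (𝓡 n) x} (hA : SmoothFieldAt A x)
    (hB : SmoothFieldAt B x) (hC : SmoothFieldAt C x) :=
    contMDiffAt_mvfderiv_apply le_rfl (i1 hA hB) hC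
  have i3 {A B C : Π x : M, TangentSpace (𝓡 n) x} (hA : SmoothFieldAt A x)
    (hB : SmoothFieldAt B x) (hC : SmoothFieldAt C x) := i1 (hA.mlieBracket hB) hC
  exact contMDiffAt_const.mul ((((((i2 hY hZ hX).add (i2 hX hZ hY)).sub (i2 hX hY hZ)).add
    (i3 hX hY hZ)).sub (i3 hX hZ hY)).sub (i3 hY hZ hX))

theorem SmoothFieldAt.nabla (hY : SmoothFieldAt Y x) (hX : SmoothFieldAt X x) :
    SmoothFieldAt (fun y => leviCivita Y y (X y)) x := by
  obtain ⟨e, U, he, hx⟩ := exists_isOrthonormalFrameOn (n := n) x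
  refine he.contMDiffAt_of_inner hx le_rfl fun i => ?_
  have h0 := contMDiffAt_koszul hY hX (he.smoothAt hx i)
  refine h0.congr_of_eventuallyEq ?_
  filter_upwards [hY.eventually_diff, hX.eventually_diff,
    (he.smoothAt hx i).eventually_diff] with y h1 h2 h3
  rw [real_inner_comm, inner_leviCivita h1 h2 h3]

theorem leviCivita_congr (hX : DiffFieldAt X x) (h : ∀ᶠ y in 𝓝 x, X y = Y y) :
    leviCivita X x = leviCivita Y x := by
  have hY : DiffFieldAt Y x := hX.congr_of_eventuallyEq (by
    filter_upwards [h] with y hy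
    rw [hy])
  exact (leviCivita (I := 𝓡 n) (M := M)).isCovariantDerivativeOnUniv.congr_of_eventuallyEq hX hY
    Filter.univ_mem h

theorem leviCivita_add (hX : DiffFieldAt X x) (hY : DiffFieldAt Y x) :
    leviCivita (X + Y) x = leviCivita X x + leviCivita Y x :=
  (leviCivita (I := 𝓡 n) (M := M)).isCovariantDerivativeOnUniv.add hX hY

theorem leviCivita_smul {f : M → ℝ} (hX : DiffFieldAt X x)
    (hf : MDifferentiableAt (𝓡 n) 𝓘(ℝ, ℝ) f x) (v : TangentSpace (𝓡 n) x) :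
    leviCivita (fun y => f y • X y) x v = f x • leviCivita X x v + mvfderiv (𝓡 n) f x v • X x := by
  have := (leviCivita (I := 𝓡 n) (M := M)).isCovariantDerivativeOnUniv.leibniz hX hf
  exact congr($this v)

theorem leviCivita_sum {ι : Type*} (s : Finset ι) {F : ι → Π x : M, TangentSpace (𝓡 n) x}
    (hF : ∀ i, DiffFieldAt (F i) x) :
    leviCivita (fun y => ∑ i ∈ s, F i y) x = ∑ i ∈ s, leviCivita (F i) x := by
  classical
  induction s using Finset.induction_on with
  | empty =>
    simp only [Finset.sum_empty]
    exact congr($((leviCivita (I := 𝓡 n) (M := M)).zero) x)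
  | insert i s hi ih =>
    simp only [Finset.sum_insert hi]
    rw [← ih]
    exact leviCivita_add (hF i) (.sum_section fun i _ => hF i)

theorem mlieBracket_eq_leviCivita (hX : DiffFieldAt X x) (hY : DiffFieldAt Y x) :
    mlieBracket (𝓡 n) X Y x = leviCivita Y x (X x) - leviCivita X x (Y x) :=
  ((leviCivita (I := 𝓡 n) (M := M)).torsion_eq_zero_iff.1 torsion_leviCivita hX hY).symm

theorem mvfderiv_inner (hX : DiffFieldAt X x) (hY : DiffFieldAt Y x) (v : TangentSpace (𝓡 n) x) :
    mvfderiv (𝓡 n) (fun y => inner ℝ (X y) (Y y)) x v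
      = inner ℝ (leviCivita X x v) (Y x) + inner ℝ (X x) (leviCivita Y x v) := by
  have hV : DiffFieldAt (FiberBundle.extend (EuclideanSpace ℝ (Fin n)) v) x :=
    FiberBundle.mdifferentiableAt_extend (𝓡 n) _ v
  simpa using mvfderiv_inner_leviCivita hV hX hY

theorem mvfderiv_comp_chart {φ : OpenPartialHomeomorph M (EuclideanSpace ℝ (Fin n))}
    (hφ : φ ∈ IsManifold.maximalAtlas (𝓡 n) ∞ M) (hx : x ∈ φ.source)
    {F : Type*} [NormedAddCommGroup F] [NormedSpace ℝ F] {g : EuclideanSpace ℝ (Fin n) → F}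
    (hg : DifferentiableAt ℝ g (φ x)) (v : TangentSpace (𝓡 n) x) :
    mvfderiv (𝓡 n) (fun y => g (φ y)) x v
      = fderiv ℝ g (φ x) (mfderiv (𝓡 n) 𝓘(ℝ, EuclideanSpace ℝ (Fin n)) φ x v) := by
  have h1 := mfderiv_comp_apply (I := 𝓡 n) (I' := 𝓘(ℝ, EuclideanSpace ℝ (Fin n)))
    (I'' := 𝓘(ℝ, F)) (f := φ) (g := g) x hg.mdifferentiableAt
    ((chart_mdifferentiable hφ).mdifferentiableAt hx) v
  rw [mfderiv_eq_fderiv] at h1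
  exact h1

/-- A function which is smooth near `x` with prescribed value and differential at `x`. -/
theorem exists_smooth_jet (x : M) (a : ℝ) (ξ : TangentSpace (𝓡 n) x →L[ℝ] ℝ) :
    ∃ f : M → ℝ, ContMDiffAt (𝓡 n) 𝓘(ℝ, ℝ) ∞ f x ∧ f x = a ∧ mvfderiv (𝓡 n) f x = ξ := by
  have hφ := IsManifold.chart_mem_maximalAtlas (I := 𝓡 n) (n := ∞) x
  set φ := chartAt (EuclideanSpace ℝ (Fin n)) x
  have hx : x ∈ φ.source := mem_chart_source _ x
  have hφs : ContMDiffAt (𝓡 n) 𝓘(ℝ, EuclideanSpace ℝ (Fin n)) ∞ φ x :=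
    contMDiffAt_of_mem_maximalAtlas hφ hx
  let L : EuclideanSpace ℝ (Fin n) →L[ℝ] ℝ :=
    ξ.comp (mfderiv (𝓡 n) 𝓘(ℝ, EuclideanSpace ℝ (Fin n)) φ x).inverse
  have hL : ContDiffAt ℝ ∞ (fun z => a + L (z - φ x)) (φ x) := by fun_prop
  refine ⟨fun y => a + L (φ y - φ x), hL.contMDiffAt.comp x hφs, by simp, ?_⟩
  ext v
  have hd : HasFDerivAt (fun z => a + L (z - φ x)) L (φ x) :=
    (L.hasFDerivAt.comp (φ x) (hasFDerivAt_sub_const (φ x))).const_add a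
  rw [mvfderiv_comp_chart hφ hx hd.differentiableAt, hd.fderiv]
  exact congrArg ξ ((isInvertible_mfderiv_chart hφ hx).inverse_apply_self v)

/-- Every tangent vector extends to a smooth field which is parallel to first order at `x`. -/
theorem exists_parallel_extension (v : TangentSpace (𝓡 n) x) :
    ∃ X : Π x : M, TangentSpace (𝓡 n) x, SmoothFieldAt X x ∧ X x = v ∧ leviCivita X x = 0 := by
  obtain ⟨e, U, he, hx⟩ := exists_isOrthonormalFrameOn (n := n) x
  -- The field is `∑ f_i e_i`, where the differentials of the `f_i` at `x` cancel the connection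
  -- matrix of the frame.
  choose f hfs hfx hfd using fun i => exists_smooth_jet x (inner ℝ (e i x) v)
    (-∑ j, inner ℝ (e j x) v • (innerSL ℝ (e i x)).comp (leviCivita (e j) x))
  have h1 (i : Fin n) : SmoothFieldAt (fun y => f i y • e i y) x :=
    (hfs i).smul_section (he.smoothAt hx i)
  refine ⟨fun y => ∑ i, f i y • e i y, .sum_section fun i _ => h1 i, ?_, ?_⟩
  · simp only [hfx]
    exact sum_inner_smul (he.orthonormal x hx) v
  · ext w
    rw [leviCivita_sum _ fun i => (h1 i).diff]
    simp only [sum_apply, leviCivita_smul (he.smoothAt hx _).diff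
      ((hfs _).mdifferentiableAt (by simp)), hfx, hfd, Finset.sum_add_distrib]
    have h2 : ∑ i, inner ℝ (e i x) v • leviCivita (e i) x w
        = ∑ j, (∑ i, inner ℝ (e i x) v * inner ℝ (e j x) (leviCivita (e i) x w)) • e j x := by
      rw [← sum_inner_smul (he.orthonormal x hx) (∑ i, inner ℝ (e i x) v • leviCivita (e i) x w)]
      simp [inner_sum, inner_smul_right]
    rw [h2, ← Finset.sum_add_distrib]
    refine Finset.sum_eq_zero fun j _ => ?_
    simp

end LeviCivita

/-! ### Symmetries of the curvature tensor -/

section Curvature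

variable {n : ℕ} {M : Type*} [TopologicalSpace M] [ChartedSpace (EuclideanSpace ℝ (Fin n)) M]
  [IsManifold (𝓡 n) ∞ M] [RiemannianBundle (fun x : M => TangentSpace (𝓡 n) x)]
  [IsContMDiffRiemannianBundle (𝓡 n) ∞ (EuclideanSpace ℝ (Fin n))
    (fun x : M => TangentSpace (𝓡 n) x)]
  {X Y Z W : Π x : M, TangentSpace (𝓡 n) x} {x : M}

theorem mvfderiv_congr {F : Type*} [NormedAddCommGroup F] [NormedSpace ℝ F] {f g : M → F}
    (h : f =ᶠ[𝓝 x] g) : mvfderiv (𝓡 n) f x = mvfderiv (𝓡 n) g x := by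
  have h1 := h.mfderiv_eq (I := 𝓡 n) (I' := 𝓘(ℝ, F))
  have h2 := h.eq_of_nhds
  ext v
  exact congr($h1 v)

theorem curvature_swap : curvature Y X Z x = -curvature X Y Z x := by
  rw [curvature, curvature, mlieBracket_swap_apply (V := Y), map_neg]
  abel

theorem curvature_congr (hX : SmoothFieldAt X x) (hY : SmoothFieldAt Y x) (hZ : SmoothFieldAt Z x)
    (h : ∀ᶠ y in 𝓝 x, Z y = W y) : curvature X Y Z x = curvature X Y W x := by
  have h1 : ∀ᶠ y in 𝓝 x, leviCivita Z y = leviCivita W y := by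
    filter_upwards [h.eventually_nhds, hZ.eventually_diff] with y hy hZy
    exact leviCivita_congr hZy hy
  rw [curvature, curvature, h1.self_of_nhds,
    leviCivita_congr (hZ.nabla hY).diff (h1.mono fun y hy => by rw [hy]),
    leviCivita_congr (hZ.nabla hX).diff (h1.mono fun y hy => by rw [hy])]

theorem curvature_add (hX : SmoothFieldAt X x) (hY : SmoothFieldAt Y x) (hZ : SmoothFieldAt Z x)
    (hW : SmoothFieldAt W x) :
    curvature X Y (Z + W) x = curvature X Y Z x + curvature X Y W x := by
  have key {A B : Π x : M, TangentSpace (𝓡 n) x} (hA : SmoothFieldAt A x)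
      (hB : SmoothFieldAt B x) :
      leviCivita (fun y => leviCivita (Z + W) y (A y)) x (B x) =
        leviCivita (fun y => leviCivita Z y (A y)) x (B x)
        + leviCivita (fun y => leviCivita W y (A y)) x (B x) := by
    rw [← add_apply, ← leviCivita_add (hZ.nabla hA).diff (hW.nabla hA).diff]
    congr 1
    refine leviCivita_congr (SmoothFieldAt.nabla (hZ.add_section hW) hA).diff ?_
    filter_upwards [hZ.eventually_diff, hW.eventually_diff] with y h1 h2
    rw [leviCivita_add h1 h2]; rfl
  rw [curvature, curvature, curvature, key hX hY, key hY hX, leviCivita_add hZ.diff hW.diff,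
    add_apply]
  abel

theorem curvature_smul {f : M → ℝ} (hf : ContMDiffAt (𝓡 n) 𝓘(ℝ, ℝ) ∞ f x)
    (hX : SmoothFieldAt X x) (hY : SmoothFieldAt Y x) (hZ : SmoothFieldAt Z x) :
    curvature X Y (fun y => f y • Z y) x = f x • curvature X Y Z x := by
  have hfd := hf.mdifferentiableAt (n := ∞) (by simp)
  have key {A B : Π x : M, TangentSpace (𝓡 n) x} (hA : SmoothFieldAt A x)
      (hB : SmoothFieldAt B x) :
      leviCivita (fun y => leviCivita (fun y => f y • Z y) y (A y)) x (B x) =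
        f x • leviCivita (fun y => leviCivita Z y (A y)) x (B x)
        + mvfderiv (𝓡 n) f x (B x) • leviCivita Z x (A x)
        + (mvfderiv (𝓡 n) f x (A x) • leviCivita Z x (B x)
        + mvfderiv (𝓡 n) (fun y => mvfderiv (𝓡 n) f y (A y)) x (B x) • Z x) := by
    have hfA := contMDiffAt_mvfderiv_apply le_rfl hf hA
    have s1 : SmoothFieldAt (fun y => f y • leviCivita Z y (A y)) x := hf.smul_section (hZ.nabla hA)
    have s2 : SmoothFieldAt (fun y => mvfderiv (𝓡 n) f y (A y) • Z y) x := hfA.smul_section hZ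
    have h1 : leviCivita (fun y => leviCivita (fun y => f y • Z y) y (A y)) x
        = leviCivita ((fun y => f y • leviCivita Z y (A y))
          + fun y => mvfderiv (𝓡 n) f y (A y) • Z y) x := by
      refine leviCivita_congr (SmoothFieldAt.nabla (hf.smul_section hZ) hA).diff ?_
      filter_upwards [hZ.eventually_diff, eventually_mdifferentiableAt hf] with y h1 h2
      rw [leviCivita_smul h1 h2]; rfl
    rw [h1, leviCivita_add s1.diff s2.diff, add_apply, leviCivita_smul (hZ.nabla hA).diff hfd,
      leviCivita_smul hZ.diff (hfA.mdifferentiableAt (by simp))]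
  rw [curvature, curvature, key hX hY, key hY hX, leviCivita_smul hZ.diff hfd,
    mvfderiv_mlieBracket_real hf hX hY]
  module

theorem curvature_sum (hX : SmoothFieldAt X x) (hY : SmoothFieldAt Y x) {ι : Type*}
    (s : Finset ι) {F : ι → Π x : M, TangentSpace (𝓡 n) x} (hF : ∀ i, SmoothFieldAt (F i) x) :
    curvature X Y (fun y => ∑ i ∈ s, F i y) x = ∑ i ∈ s, curvature X Y (F i) x := by
  classical
  induction s using Finset.induction_on with
  | empty =>
    have h := curvature_smul (f := fun _ : M => (0 : ℝ)) contMDiffAt_const hX hY hX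
    simpa using h
  | insert i s hi ih =>
    simp only [Finset.sum_insert hi]
    rw [← ih]
    exact curvature_add hX hY (hF i) (.sum_section fun i _ => hF i)

/-- The curvature is tensorial in its last argument: it is determined by its values on a frame. -/
theorem IsOrthonormalFrameOn.curvature_eq {e : Fin n → Π x : M, TangentSpace (𝓡 n) x} {U : Set M}
    (he : IsOrthonormalFrameOn e U) (hx : x ∈ U)
    (hX : SmoothFieldAt X x) (hY : SmoothFieldAt Y x) (hZ : SmoothFieldAt Z x) :
    curvature X Y Z x = ∑ i, inner ℝ (e i x) (Z x) • curvature X Y (e i) x := by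
  have hf (i) := contMDiffAt_inner (he.smoothAt hx i) hZ le_rfl
  rw [curvature_congr (W := fun y => ∑ i, inner ℝ (e i y) (Z y) • e i y) hX hY hZ,
    curvature_sum (F := fun i y => inner ℝ (e i y) (Z y) • e i y) hX hY _
      fun i => (hf i).smul_section (he.smoothAt hx i)]
  · exact Finset.sum_congr rfl fun i _ => curvature_smul (hf i) hX hY (he.smoothAt hx i)
  · filter_upwards [he.isOpen.mem_nhds hx] with y hy
    rw [sum_inner_smul (he.orthonormal y hy)]

attribute [local instance] isManifold_minSmoothness_three

/-- The first Bianchi identity. -/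
theorem curvature_cyclic (hX : SmoothFieldAt X x) (hY : SmoothFieldAt Y x)
    (hZ : SmoothFieldAt Z x) :
    curvature X Y Z x + curvature Y Z X x + curvature Z X Y x = 0 := by
  have key {A B C : Π x : M, TangentSpace (𝓡 n) x} (hA : SmoothFieldAt A x)
      (hB : SmoothFieldAt B x) (hC : SmoothFieldAt C x) :
      leviCivita (fun y => leviCivita C y (B y)) x (A x)
        - leviCivita (fun y => leviCivita B y (C y)) x (A x)
        - leviCivita A x (mlieBracket (𝓡 n) B C x)
        = mlieBracket (𝓡 n) A (mlieBracket (𝓡 n) B C) x := by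
    have h1 : leviCivita (fun y => leviCivita C y (B y)) x
        = leviCivita (mlieBracket (𝓡 n) B C + fun y => leviCivita B y (C y)) x := by
      refine leviCivita_congr (hC.nabla hB).diff ?_
      filter_upwards [hB.eventually_diff, hC.eventually_diff] with y h1 h2
      rw [Pi.add_apply, mlieBracket_eq_leviCivita h1 h2, sub_add_cancel]
    rw [h1, leviCivita_add (hB.mlieBracket hC).diff (hB.nabla hC).diff,
      mlieBracket_eq_leviCivita hA.diff (hB.mlieBracket hC).diff, add_apply]
    abel
  have h2 : (minSmoothness ℝ 2 : ℕ∞ω) ≤ ∞ := by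
    rw [minSmoothness_of_isRCLikeNormedField]
    exact (WithTop.coe_le_coe.2 le_top : ((2 : ℕ∞) : ℕ∞ω) ≤ ∞)
  have J := leibniz_identity_mlieBracket_apply (hX.of_le h2) (hY.of_le h2) (hZ.of_le h2)
  have J' : mlieBracket (𝓡 n) X (mlieBracket (𝓡 n) Y Z) x
      + mlieBracket (𝓡 n) Y (mlieBracket (𝓡 n) Z X) x
      + mlieBracket (𝓡 n) Z (mlieBracket (𝓡 n) X Y) x = 0 := by
    have e1 : mlieBracket (𝓡 n) Y (mlieBracket (𝓡 n) Z X) x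
        = -mlieBracket (𝓡 n) Y (mlieBracket (𝓡 n) X Z) x := by
      have h1 := mlieBracket_const_smul_right (V := Y) (c := -1) (hX.mlieBracket hZ).diff
      rw [mlieBracket_swap (V := Z), ← neg_one_smul ℝ (mlieBracket (𝓡 n) X Z), h1, neg_one_smul]
    rw [J, e1, mlieBracket_swap_apply (V := Z)]
    abel
  rw [← J', ← key hX hY hZ, ← key hY hZ hX, ← key hZ hX hY, curvature, curvature, curvature]
  abel

/-- The curvature endomorphisms are skew-symmetric. -/
theorem inner_curvature_skew (hX : SmoothFieldAt X x) (hY : SmoothFieldAt Y x)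
    (hZ : SmoothFieldAt Z x) (hW : SmoothFieldAt W x) :
    inner ℝ (curvature X Y Z x) (W x) = -inner ℝ (curvature X Y W x) (Z x) := by
  have key {A B : Π x : M, TangentSpace (𝓡 n) x} (hA : SmoothFieldAt A x)
      (hB : SmoothFieldAt B x) :
      mvfderiv (𝓡 n) (fun y => mvfderiv (𝓡 n) (fun y => inner ℝ (Z y) (W y)) y (B y)) x (A x)
        = inner ℝ (leviCivita (fun y => leviCivita Z y (B y)) x (A x)) (W x)
          + inner ℝ (leviCivita Z x (B x)) (leviCivita W x (A x))
          + (inner ℝ (leviCivita Z x (A x)) (leviCivita W x (B x))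
          + inner ℝ (Z x) (leviCivita (fun y => leviCivita W y (B y)) x (A x))) := by
    have h1 : (fun y => mvfderiv (𝓡 n) (fun y => inner ℝ (Z y) (W y)) y (B y)) =ᶠ[𝓝 x]
        fun y => inner ℝ (leviCivita Z y (B y)) (W y) + inner ℝ (Z y) (leviCivita W y (B y)) := by
      filter_upwards [hZ.eventually_diff, hW.eventually_diff] with y h1 h2
      exact mvfderiv_inner h1 h2 _
    rw [mvfderiv_congr h1, mvfderiv_fun_add
      ((contMDiffAt_inner (hZ.nabla hB) hW le_rfl).mdifferentiableAt (by simp))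
      ((contMDiffAt_inner hZ (hW.nabla hB) le_rfl).mdifferentiableAt (by simp)), add_apply,
      mvfderiv_inner (hZ.nabla hB).diff hW.diff, mvfderiv_inner hZ.diff (hW.nabla hB).diff]
  have h := mvfderiv_mlieBracket_real (contMDiffAt_inner hZ hW le_rfl) hX hY
  rw [key hX hY, key hY hX, mvfderiv_inner hZ.diff hW.diff] at h
  rw [curvature, curvature, inner_sub_left, inner_sub_left, inner_sub_left, inner_sub_left]
  simp only [real_inner_comm] at h ⊢
  linarith

/-- The pair symmetry of the curvature tensor. -/
theorem inner_curvature_pair (hX : SmoothFieldAt X x) (hY : SmoothFieldAt Y x)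
    (hZ : SmoothFieldAt Z x) (hW : SmoothFieldAt W x) :
    inner ℝ (curvature X Y Z x) (W x) = inner ℝ (curvature Z W X x) (Y x) := by
  have sk {A B C D : Π x : M, TangentSpace (𝓡 n) x} (hA : SmoothFieldAt A x)
    (hB : SmoothFieldAt B x) (hC : SmoothFieldAt C x) (hD : SmoothFieldAt D x) :=
    inner_curvature_skew hA hB hC hD
  have sw (A B C D : Π x : M, TangentSpace (𝓡 n) x) :
      inner ℝ (curvature A B C x) (D x) = -inner ℝ (curvature B A C x) (D x) := by
    rw [curvature_swap, inner_neg_left]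
  have bi {A B C D : Π x : M, TangentSpace (𝓡 n) x} (hA : SmoothFieldAt A x)
      (hB : SmoothFieldAt B x) (hC : SmoothFieldAt C x) (hD : SmoothFieldAt D x) :
      inner ℝ (curvature A B C x) (D x) + inner ℝ (curvature B C A x) (D x)
        + inner ℝ (curvature C A B x) (D x) = 0 := by
    rw [← inner_add_left, ← inner_add_left, curvature_cyclic hA hB hC, inner_zero_left]
  linarith [bi hX hY hZ hW, bi hY hZ hW hX, bi hZ hW hX hY, bi hW hX hY hZ,
    sk hX hY hZ hW, sk hY hZ hX hW, sk hZ hX hY hW, sk hZ hW hY hX, sk hW hX hZ hY,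
    sk hY hW hZ hX, sk hX hW hY hZ, sw Z X Y W, sw W X Y Z, sw Y W Z X, sw X Z Y W, sw W Y Z X,
    sk hX hZ hY hW, sk hW hY hZ hX]

end Curvature

/-! ### Exterior algebra on a fibre -/

section FormInstances

variable {n : ℕ} {M : Type*} [TopologicalSpace M] [ChartedSpace (EuclideanSpace ℝ (Fin n)) M]

-- The algebraic structures of `Form n x` are recorded as local instances, so that instance search
-- need not unfold the product of spaces of alternating maps.

noncomputable abbrev formAddCommGroup (x : M) : AddCommGroup (Form n x) := inferInstance

noncomputable abbrev formAddCommMonoid (x : M) : AddCommMonoid (Form n x) :=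
  (formAddCommGroup x).toAddCommMonoid

attribute [local instance] formAddCommGroup

noncomputable abbrev formModuleReal (x : M) : Module ℝ (Form n x) := inferInstance

noncomputable abbrev formModuleComplex (x : M) : Module ℂ (Form n x) := inferInstance

end FormInstances

attribute [local instance] formAddCommGroup formAddCommMonoid formModuleReal formModuleComplex

section Fibre

variable {n : ℕ} {M : Type*} [TopologicalSpace M] [ChartedSpace (EuclideanSpace ℝ (Fin n)) M]
  [RiemannianBundle (fun x : M => TangentSpace (𝓡 n) x)] {x : M}

theorem form_ext {α β : Form n x} (h : ∀ k v, α k v = β k v) : α = β :=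
  funext fun k => ContinuousAlternatingMap.ext (h k)

theorem form_add_apply (α β : Form n x) (k : ℕ) (v : Fin k → TangentSpace (𝓡 n) x) :
    (α + β) k v = α k v + β k v := rfl

theorem form_sub_apply (α β : Form n x) (k : ℕ) (v : Fin k → TangentSpace (𝓡 n) x) :
    (α - β) k v = α k v - β k v := rfl

theorem form_neg_apply (α : Form n x) (k : ℕ) (v : Fin k → TangentSpace (𝓡 n) x) :
    (-α) k v = -α k v := rfl

theorem form_smul_apply (a : ℝ) (α : Form n x) (k : ℕ) (v : Fin k → TangentSpace (𝓡 n) x) :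
    (a • α) k v = a • α k v := rfl

theorem form_csmul_apply (a : ℂ) (α : Form n x) (k : ℕ) (v : Fin k → TangentSpace (𝓡 n) x) :
    (a • α) k v = a * α k v := rfl

theorem form_sum_apply {ι : Type*} (s : Finset ι) (α : ι → Form n x) (k : ℕ)
    (v : Fin k → TangentSpace (𝓡 n) x) : (∑ i ∈ s, α i) k v = ∑ i ∈ s, α i k v := by
  rw [Finset.sum_apply, ContinuousAlternatingMap.sum_apply]

theorem wedge_apply_zero (ξ : TangentSpace (𝓡 n) x →L[ℝ] ℝ) (α : Form n x) : wedge ξ α 0 = 0 := rfl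

theorem wedge_apply_succ (ξ : TangentSpace (𝓡 n) x →L[ℝ] ℝ) (α : Form n x) (k : ℕ)
    (v : Fin (k + 1) → TangentSpace (𝓡 n) x) :
    wedge ξ α (k + 1) v = ∑ i : Fin (k + 1), (-1 : ℝ) ^ (i : ℕ) • ξ (v i) •
      α k (i.removeNth v) := by
  have : wedge ξ α (k + 1) = .alternatizeUncurryFin (ξ.smulRight (α k)) := rfl
  rw [this, ContinuousAlternatingMap.alternatizeUncurryFin_apply]
  simp

theorem contract_apply (u : TangentSpace (𝓡 n) x) (α : Form n x) (k : ℕ)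
    (v : Fin k → TangentSpace (𝓡 n) x) :
    contract u α k v = α (k + 1) (Fin.cons u v) := rfl

theorem wedge_contract_apply (ξ : TangentSpace (𝓡 n) x →L[ℝ] ℝ) (u : TangentSpace (𝓡 n) x)
    (α : Form n x) (k : ℕ) (v : Fin k → TangentSpace (𝓡 n) x) :
    wedge ξ (contract u α) k v = ∑ a, ξ (v a) • α k (Function.update v a u) := by
  cases k with
  | zero => simp [wedge_apply_zero]
  | succ k =>
    rw [wedge_apply_succ]
    refine Finset.sum_congr rfl fun i _ => ?_
    have h := (α (k + 1)).map_insertNth i u (i.removeNth v)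
    rw [Fin.insertNth_removeNth] at h
    rw [h, smul_comm, contract_apply]
    rcases Nat.even_or_odd (i : ℕ) with h1 | h1 <;>
      simp only [h1.neg_one_pow, one_smul, neg_one_smul] <;> rfl

theorem contract_wedge (ξ : TangentSpace (𝓡 n) x →L[ℝ] ℝ) (u : TangentSpace (𝓡 n) x)
    (α : Form n x) : contract u (wedge ξ α) = ξ u • α - wedge ξ (contract u α) := by
  refine form_ext fun k v => ?_
  rw [contract_apply, wedge_apply_succ, Fin.sum_univ_succ, form_sub_apply, form_smul_apply]
  cases k with
  | zero => simp [wedge_apply_zero]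
  | succ k =>
    rw [wedge_apply_succ, sub_eq_add_neg, ← Finset.sum_neg_distrib]
    congr 1
    · simp
    · refine Finset.sum_congr rfl fun i _ => ?_
      have h : i.succ.removeNth (α := fun _ => TangentSpace (𝓡 n) x) (Fin.cons u v)
          = Fin.cons u (i.removeNth v) := by
        refine funext fun j => ?_
        refine Fin.cases ?_ (fun j => ?_) j <;> simp [Fin.removeNth]
      rw [h, contract_apply, Fin.cons_succ, Fin.val_succ, pow_succ]
      simp

theorem contract_contract (u w : TangentSpace (𝓡 n) x) (α : Form n x) :
    contract u (contract w α) = -contract w (contract u α) := by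
  refine form_ext fun k v => ?_
  rw [form_neg_apply, contract_apply, contract_apply, contract_apply, contract_apply]
  have h := (α (k + 2)).toAlternatingMap.map_swap (Fin.cons u (Fin.cons w v))
    (show (0 : Fin (k + 2)) ≠ 1 by simp)
  have h1 : ((Fin.cons u (Fin.cons w v) : Fin (k + 2) → TangentSpace (𝓡 n) x) ∘
      Equiv.swap 0 1) = Fin.cons w (Fin.cons u v) := by
    refine funext fun j => ?_
    refine Fin.cases (by simp) (fun j => ?_) j
    refine Fin.cases (by simp) (fun j => ?_) j
    rw [Function.comp_apply, Equiv.swap_apply_of_ne_of_ne (by simp) (by simp [Fin.ext_iff])]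
    simp
  rw [h1] at h
  exact h

theorem wedge_wedge (ξ ζ : TangentSpace (𝓡 n) x →L[ℝ] ℝ) (α : Form n x) :
    wedge ξ (wedge ζ α) = -wedge ζ (wedge ξ α) := by
  rw [eq_neg_iff_add_eq_zero]
  refine funext fun k => ?_
  induction k generalizing α with
  | zero => simp [wedge_apply_zero]
  | succ k ih =>
    ext v
    have h1 : contract (v 0) (wedge ξ (wedge ζ α) + wedge ζ (wedge ξ α))
        = wedge ξ (wedge ζ (contract (v 0) α)) + wedge ζ (wedge ξ (contract (v 0) α)) := by
      simp only [map_add, contract_wedge, map_sub, LinearMap.map_smul_of_tower]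
      abel
    have h2 := congr($h1 k (Fin.tail v))
    rw [ih, contract_apply] at h2
    simpa using h2

end Fibre

/-! ### The Clifford relations -/

section Clifford

variable {n : ℕ} {M : Type*} [TopologicalSpace M] [ChartedSpace (EuclideanSpace ℝ (Fin n)) M]
  [RiemannianBundle (fun x : M => TangentSpace (𝓡 n) x)] {x : M}

theorem map_real_smul (A : Module.End ℂ (Form n x)) (r : ℝ) (α : Form n x) :
    A (r • α) = r • A α := A.map_smul_of_tower r α

theorem cliff_apply (u : TangentSpace (𝓡 n) x) (α : Form n x) :
    cliff u α = wedge (innerSL ℝ u) α - contract u α := rfl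

theorem cliffHat_apply (u : TangentSpace (𝓡 n) x) (α : Form n x) :
    cliffHat u α = wedge (innerSL ℝ u) α + contract u α := rfl

theorem contract_wedge_inner (u w : TangentSpace (𝓡 n) x) (α : Form n x) :
    contract u (wedge (innerSL ℝ w) α) = inner ℝ u w • α - wedge (innerSL ℝ w) (contract u α) := by
  rw [contract_wedge, innerSL_apply_apply, real_inner_comm]

theorem cliff_cliff (u w : TangentSpace (𝓡 n) x) (α : Form n x) :
    cliff u (cliff w α) = -cliff w (cliff u α) - (2 * inner ℝ u w : ℝ) • α := by
  simp only [cliff_apply, map_sub, contract_wedge_inner]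
  rw [contract_contract u w, wedge_wedge (innerSL ℝ u) (innerSL ℝ w), real_inner_comm u w]
  module

theorem cliffHat_cliffHat (u w : TangentSpace (𝓡 n) x) (α : Form n x) :
    cliffHat u (cliffHat w α) = -cliffHat w (cliffHat u α) + (2 * inner ℝ u w : ℝ) • α := by
  simp only [cliffHat_apply, map_add, contract_wedge_inner]
  rw [contract_contract u w, wedge_wedge (innerSL ℝ u) (innerSL ℝ w), real_inner_comm u w]
  module

theorem cliff_cliffHat (u w : TangentSpace (𝓡 n) x) (α : Form n x) :
    cliff u (cliffHat w α) = -cliffHat w (cliff u α) := by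
  simp only [cliff_apply, cliffHat_apply, map_add, map_sub, contract_wedge_inner]
  rw [contract_contract u w, wedge_wedge (innerSL ℝ u) (innerSL ℝ w), real_inner_comm u w]
  module

theorem wedge_add (ξ ζ : TangentSpace (𝓡 n) x →L[ℝ] ℝ) (α : Form n x) :
    wedge (ξ + ζ) α = wedge ξ α + wedge ζ α := by
  refine form_ext fun k v => ?_
  cases k with
  | zero => simp [wedge_apply_zero]
  | succ k =>
    simp only [form_add_apply, wedge_apply_succ, add_apply, add_smul, smul_add,
      Finset.sum_add_distrib]

theorem wedge_smul (a : ℝ) (ξ : TangentSpace (𝓡 n) x →L[ℝ] ℝ) (α : Form n x) :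
    wedge (a • ξ) α = a • wedge ξ α := by
  refine form_ext fun k v => ?_
  cases k with
  | zero => simp [wedge_apply_zero]
  | succ k =>
    simp only [form_smul_apply, wedge_apply_succ, smul_apply, Finset.smul_sum]
    refine Finset.sum_congr rfl fun i _ => ?_
    rw [smul_comm a, smul_assoc]

theorem contract_add (u w : TangentSpace (𝓡 n) x) (α : Form n x) :
    contract (u + w) α = contract u α + contract w α :=
  funext fun k => map_add (α (k + 1)).curryLeft u w

theorem contract_smul (a : ℝ) (u : TangentSpace (𝓡 n) x) (α : Form n x) :
    contract (a • u) α = a • contract u α :=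
  funext fun k => map_smul (α (k + 1)).curryLeft a u

theorem cliff_add (u w : TangentSpace (𝓡 n) x) (α : Form n x) :
    cliff (u + w) α = cliff u α + cliff w α := by
  simp only [cliff_apply, map_add, wedge_add, contract_add]; abel

theorem cliff_smul (a : ℝ) (u : TangentSpace (𝓡 n) x) (α : Form n x) :
    cliff (a • u) α = a • cliff u α := by
  simp only [cliff_apply, map_smul, wedge_smul, contract_smul]; rw [smul_sub]

theorem cliffHat_add (u w : TangentSpace (𝓡 n) x) (α : Form n x) :
    cliffHat (u + w) α = cliffHat u α + cliffHat w α := by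
  simp only [cliffHat_apply, map_add, wedge_add, contract_add]; abel

theorem cliffHat_smul (a : ℝ) (u : TangentSpace (𝓡 n) x) (α : Form n x) :
    cliffHat (a • u) α = a • cliffHat u α := by
  simp only [cliffHat_apply, map_smul, wedge_smul, contract_smul]; rw [smul_add]

theorem contract_zero (α : Form n x) : contract (0 : TangentSpace (𝓡 n) x) α = 0 :=
  form_ext fun k _ => (α (k + 1)).map_coord_zero 0 rfl

theorem contract_sum {ι : Type*} (s : Finset ι) (u : ι → TangentSpace (𝓡 n) x) (α : Form n x) :
    contract (∑ i ∈ s, u i) α = ∑ i ∈ s, contract (u i) α := by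
  refine form_ext fun k w => ?_
  rw [form_sum_apply]
  have h : contract (∑ i ∈ s, u i) α k = (α (k + 1)).curryLeft (∑ i ∈ s, u i) := rfl
  rw [h, map_sum, ContinuousAlternatingMap.sum_apply]
  rfl

theorem cliff_sum_smul {ι : Type*} (s : Finset ι) (r : ι → ℝ) (u : ι → TangentSpace (𝓡 n) x)
    (α : Form n x) : cliff (∑ i ∈ s, r i • u i) α = ∑ i ∈ s, r i • cliff (u i) α := by
  let L : TangentSpace (𝓡 n) x →ₗ[ℝ] Form n x :=
    { toFun := fun u => cliff u α
      map_add' := fun u w => cliff_add u w α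
      map_smul' := fun a u => cliff_smul a u α }
  have h := map_sum L (fun i => r i • u i) s
  simp only [map_smul] at h
  exact h

theorem cliffHat_sum_smul {ι : Type*} (s : Finset ι) (r : ι → ℝ) (u : ι → TangentSpace (𝓡 n) x)
    (α : Form n x) : cliffHat (∑ i ∈ s, r i • u i) α = ∑ i ∈ s, r i • cliffHat (u i) α := by
  let L : TangentSpace (𝓡 n) x →ₗ[ℝ] Form n x :=
    { toFun := fun u => cliffHat u α
      map_add' := fun u w => cliffHat_add u w α
      map_smul' := fun a u => cliffHat_smul a u α }
  have h := map_sum L (fun i => r i • u i) s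
  simp only [map_smul] at h
  exact h

end Clifford

/-! ### Regularity of differential forms -/

section SmoothForms

theorem contDiffAt_of_apply_basisFun {n k : ℕ} {G : Type*} [NormedAddCommGroup G]
    [NormedSpace ℝ G] {f : G → EuclideanSpace ℝ (Fin n) [⋀^Fin k]→L[ℝ] ℂ} {z : G} {m : ℕ∞ω}
    (h : ∀ I : Fin k → Fin n,
      ContDiffAt ℝ m (fun z => f z fun i => EuclideanSpace.basisFun (Fin n) ℝ (I i)) z) :
    ContDiffAt ℝ m f z := by
  let L : (EuclideanSpace ℝ (Fin n) [⋀^Fin k]→L[ℝ] ℂ) →ₗ[ℝ] ((Fin k → Fin n) → ℂ) :=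
    LinearMap.pi fun I => (ContinuousAlternatingMap.apply ℝ (EuclideanSpace ℝ (Fin n)) ℂ
      fun i => EuclideanSpace.basisFun (Fin n) ℝ (I i)).toLinearMap
  have hL : LinearMap.ker L = ⊥ := by
    rw [LinearMap.ker_eq_bot]
    intro α β hαβ
    apply ContinuousAlternatingMap.toAlternatingMap_injective
    refine Basis.ext_alternating (EuclideanSpace.basisFun (Fin n) ℝ).toBasis fun v _ => ?_
    have := congrFun hαβ v
    simpa [L] using this
  obtain ⟨g, hg⟩ := L.exists_leftInverse_of_injective hL
  have h1 : f = fun z => LinearMap.toContinuousLinearMap g (L (f z)) :=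
    funext fun z => congr($hg.symm (f z))
  rw [h1]
  exact (LinearMap.toContinuousLinearMap g).contDiff.contDiffAt.comp z (contDiffAt_pi.2 h)

variable {n : ℕ} {M : Type*} [TopologicalSpace M] [ChartedSpace (EuclideanSpace ℝ (Fin n)) M]
  [IsManifold (𝓡 n) ∞ M] {η θ : Π x : M, Form n x}
  {φ : OpenPartialHomeomorph M (EuclideanSpace ℝ (Fin n))} {x : M} {m : ℕ∞ω}

theorem contMDiffAt_real_smul {f : M → ℝ} {g : M → ℂ} (hf : ContMDiffAt (𝓡 n) 𝓘(ℝ, ℝ) m f x)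
    (hg : ContMDiffAt (𝓡 n) 𝓘(ℝ, ℂ) m g x) :
    ContMDiffAt (𝓡 n) 𝓘(ℝ, ℂ) m (fun y => f y • g y) x :=
  hf.smul hg

/-- The coordinate representation of a form at `φ x`, transported back to `T_x M`. -/
theorem inChart_mfderiv_apply (hφ : φ ∈ IsManifold.maximalAtlas (𝓡 n) ∞ M) (hx : x ∈ φ.source)
    (η : Π x : M, Form n x) (k : ℕ) (w : Fin k → TangentSpace (𝓡 n) x) :
    inChart φ η k (φ x)
      (fun a => mfderiv (𝓡 n) 𝓘(ℝ, EuclideanSpace ℝ (Fin n)) φ x (w a)) = η x k w := by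
  have key : ∀ p, p = x → ∀ w : Fin k → EuclideanSpace ℝ (Fin n),
      η p k (w : Fin k → TangentSpace (𝓡 n) p) = η x k (w : Fin k → TangentSpace (𝓡 n) x) := by
    rintro p rfl w; rfl
  have h := key _ (φ.left_inv hx) fun a =>
    mfderiv 𝓘(ℝ, EuclideanSpace ℝ (Fin n)) (𝓡 n) φ.symm (φ x)
      (mfderiv (𝓡 n) 𝓘(ℝ, EuclideanSpace ℝ (Fin n)) φ x (w a))
  refine h.trans (congrArg (η x k) (funext fun a => ?_))
  exact congr($((chart_mdifferentiable hφ).symm_comp_deriv hx) (w a))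

theorem inChart_basisFun_apply (hφ : φ ∈ IsManifold.maximalAtlas (𝓡 n) ∞ M) (hx : x ∈ φ.source)
    (η : Π x : M, Form n x) (k : ℕ) (I : Fin k → Fin n) :
    inChart φ η k (φ x) (fun a => EuclideanSpace.basisFun (Fin n) ℝ (I a))
      = η x k fun a => coordField φ (I a) x := by
  rw [← inChart_mfderiv_apply hφ hx]
  simp only [mfderiv_coordField hφ hx]

/-- A form `η` is `C^m` at `x` if its values on families of smooth fields are `C^m` at `x`. For
`m = ∞` this is smoothness of its components in a chart, see `isSmoothFormAt_iff`. -/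
def IsCDiffFormAt (m : ℕ∞ω) (η : Π x : M, Form n x) (x : M) : Prop :=
  ∀ (k : ℕ) (X : Fin k → Π x : M, TangentSpace (𝓡 n) x),
    (∀ i, ContMDiffAt (𝓡 n) (𝓡 n).tangent ∞ (T% (X i)) x) →
      ContMDiffAt (𝓡 n) 𝓘(ℝ, ℂ) m (fun y => η y k fun i => X i y) x

theorem IsCDiffFormAt.of_le {m' : ℕ∞ω} (h : IsCDiffFormAt m η x) (hm : m' ≤ m) :
    IsCDiffFormAt m' η x := fun k X hX => (h k X hX).of_le hm

theorem IsCDiffFormAt.contDiffAt_inChart (h : IsCDiffFormAt m η x) (hm : m ≤ ∞)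
    (hφ : φ ∈ IsManifold.maximalAtlas (𝓡 n) ∞ M) (hx : x ∈ φ.source) (k : ℕ) :
    ContDiffAt ℝ m (inChart φ η k) (φ x) := by
  refine contDiffAt_of_apply_basisFun fun I => ?_
  have h1 := h k (fun a => coordField φ (I a)) fun a => smoothFieldAt_coordField hφ hx (I a)
  have h2 : ContMDiffAt 𝓘(ℝ, EuclideanSpace ℝ (Fin n)) (𝓡 n) m φ.symm (φ x) :=
    (contMDiffAt_symm_of_mem_maximalAtlas hφ (φ.map_source hx)).of_le hm
  have h3 := ContMDiffAt.comp_of_eq h1 h2 (φ.left_inv hx)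
  refine (contMDiffAt_iff_contDiffAt.1 h3).congr_of_eventuallyEq ?_
  filter_upwards [φ.open_target.mem_nhds (φ.map_source hx)] with z hz
  have := inChart_basisFun_apply hφ (φ.map_target hz) η k I
  rwa [φ.right_inv hz] at this

theorem contMDiffAt_coordCovector_apply {X : Π x : M, TangentSpace (𝓡 n) x}
    (hm : m ≤ ∞) (hφ : φ ∈ IsManifold.maximalAtlas (𝓡 n) ∞ M) (hx : x ∈ φ.source) (j : Fin n)
    (hX : ContMDiffAt (𝓡 n) (𝓡 n).tangent m (T% X) x) :
    ContMDiffAt (𝓡 n) 𝓘(ℝ, ℝ) m (fun y => coordCovector φ j y (X y)) x := by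
  have h1 := contMDiffAt_mvfderiv_apply hm (contMDiffAt_of_mem_maximalAtlas hφ hx) hX
  exact (EuclideanSpace.proj (𝕜 := ℝ) j).contDiff.contMDiff.contMDiffAt.comp x h1

theorem form_apply_eq_sum (hφ : φ ∈ IsManifold.maximalAtlas (𝓡 n) ∞ M) (hx : x ∈ φ.source)
    (k : ℕ) (w : Fin k → TangentSpace (𝓡 n) x) :
    η x k w = ∑ I : Fin k → Fin n, (∏ a, coordCovector φ (I a) x (w a)) •
      η x k fun a => coordField φ (I a) x := by
  conv_lhs => rw [← funext fun a => sum_coord_smul_coordField hφ hx (w a)]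
  have := (η x k).toMultilinearMap.map_sum
    (fun (a : Fin k) (j : Fin n) => coordCovector φ j x (w a) • coordField φ j x)
  refine this.trans (Finset.sum_congr rfl fun I _ => ?_)
  exact (η x k).toMultilinearMap.map_smul_univ _ _

/-- Smooth components in one chart around `x` suffice, since the coordinate covectors are smooth. -/
theorem isCDiffFormAt_of_inChart (hm : m ≤ ∞) (hφ : φ ∈ IsManifold.maximalAtlas (𝓡 n) ∞ M)
    (hx : x ∈ φ.source) (h : ∀ k, ContDiffAt ℝ m (inChart φ η k) (φ x)) : IsCDiffFormAt m η x := by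
  intro k X hX
  have hφs : ContMDiffAt (𝓡 n) 𝓘(ℝ, EuclideanSpace ℝ (Fin n)) m φ x :=
    (contMDiffAt_of_mem_maximalAtlas hφ hx).of_le hm
  have h1 : ContMDiffAt (𝓡 n) 𝓘(ℝ, ℂ) m (fun y => ∑ I : Fin k → Fin n,
      (∏ a, coordCovector φ (I a) y (X a y)) •
        inChart φ η k (φ y) (fun a => EuclideanSpace.basisFun (Fin n) ℝ (I a))) x := by
    refine contMDiffAt_finsetSum fun I _ => contMDiffAt_real_smul ?_ ?_
    · exact contMDiffAt_finsetProd fun a _ =>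
        contMDiffAt_coordCovector_apply hm hφ hx _ ((hX a).of_le hm)
    · have h2 := (ContinuousAlternatingMap.apply ℝ (EuclideanSpace ℝ (Fin n)) ℂ
        fun a => EuclideanSpace.basisFun (Fin n) ℝ (I a)).contDiff.contDiffAt.comp _ (h k)
      exact h2.contMDiffAt.comp x hφs
  refine h1.congr_of_eventuallyEq ?_
  filter_upwards [φ.open_source.mem_nhds hx] with y hy
  rw [form_apply_eq_sum hφ hy]
  simp only [inChart_basisFun_apply hφ hy]

theorem isSmoothFormAt_iff : IsSmoothFormAt η x ↔ IsCDiffFormAt ∞ η x :=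
  ⟨isCDiffFormAt_of_inChart le_rfl (IsManifold.chart_mem_maximalAtlas x) (mem_chart_source _ x),
    fun h => h.contDiffAt_inChart le_rfl (IsManifold.chart_mem_maximalAtlas x)
      (mem_chart_source _ x)⟩

theorem isSmoothForm_iff : IsSmoothForm η ↔ ∀ x, IsCDiffFormAt ∞ η x := by
  refine ⟨fun h x => isSmoothFormAt_iff.1 fun k => ?_, fun h φ hφ k z hz => ?_⟩
  · have h1 := IsManifold.chart_mem_maximalAtlas (I := 𝓡 n) (n := ∞) x
    exact (h _ h1 k).contDiffAt ((chartAt _ x).open_target.mem_nhds (mem_chart_target _ x))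
  · have := (h (φ.symm z)).contDiffAt_inChart le_rfl hφ (φ.map_target hz) k
    rw [φ.right_inv hz] at this
    exact this.contDiffWithinAt

theorem IsSmoothForm.at (h : IsSmoothForm η) (x : M) : IsCDiffFormAt ∞ η x := isSmoothForm_iff.1 h x

/-- Only finitely many degrees matter, since there are no forms of degree above `n`. -/
theorem inChart_eq_zero {k : ℕ} (hk : n < k) : inChart φ η k = 0 := by
  refine funext fun z => ContinuousAlternatingMap.ext fun v => ?_
  refine AlternatingMap.map_linearDependent (inChart φ η k z).toAlternatingMap v fun h => ?_
  have := h.fintype_card_le_finrank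
  simp at this
  omega

/-- A form that is smooth at `x` is `C^1` near `x`. The degrees above `n`, where a common
neighbourhood need not exist a priori, do not matter. -/
theorem IsCDiffFormAt.eventually_one (h : IsCDiffFormAt ∞ η x) :
    ∀ᶠ y in 𝓝 x, IsCDiffFormAt 1 η y := by
  have hφ := IsManifold.chart_mem_maximalAtlas (I := 𝓡 n) (n := ∞) x
  set φ := chartAt (EuclideanSpace ℝ (Fin n)) x
  have hx : x ∈ φ.source := mem_chart_source _ x
  have h1 (k : ℕ) : ∀ᶠ y in 𝓝 x, ContDiffAt ℝ 1 (inChart φ η k) (φ y) := by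
    have h2 := ((h.of_le (show (1 : ℕ∞ω) ≤ ∞ by simp)).contDiffAt_inChart (by simp)
      hφ hx k).eventually (by simp)
    exact (φ.continuousAt hx).eventually h2
  have h2 : ∀ᶠ y in 𝓝 x, ∀ k ∈ Finset.range (n + 1), ContDiffAt ℝ 1 (inChart φ η k) (φ y) :=
    (Finset.eventually_all _).2 fun k _ => h1 k
  filter_upwards [h2, φ.open_source.mem_nhds hx] with y hy hys
  refine isCDiffFormAt_of_inChart (by simp) hφ hys fun k => ?_
  by_cases hk : n < k
  · rw [inChart_eq_zero hk]; exact contDiffAt_const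
  · exact hy k (by simp; omega)

theorem IsCDiffFormAt.congr (h : IsCDiffFormAt m η x) (hθ : ∀ᶠ y in 𝓝 x, θ y = η y) :
    IsCDiffFormAt m θ x := fun k X hX => (h k X hX).congr_of_eventuallyEq <| by
  filter_upwards [hθ] with y hy
  rw [hy]

theorem IsCDiffFormAt.add (h : IsCDiffFormAt m η x) (h' : IsCDiffFormAt m θ x) :
    IsCDiffFormAt m (fun y => η y + θ y) x := fun k X hX => (h k X hX).add (h' k X hX)

theorem IsCDiffFormAt.sub (h : IsCDiffFormAt m η x) (h' : IsCDiffFormAt m θ x) :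
    IsCDiffFormAt m (fun y => η y - θ y) x := fun k X hX => (h k X hX).sub (h' k X hX)

theorem IsCDiffFormAt.csmul {f : M → ℂ} (hf : ContMDiffAt (𝓡 n) 𝓘(ℝ, ℂ) m f x)
    (h : IsCDiffFormAt m η x) : IsCDiffFormAt m (fun y => f y • η y) x := fun k X hX =>
  (contDiff_mul (𝕜 := ℝ) (𝔸 := ℂ)).contMDiff.contMDiffAt.comp x (hf.prodMk_space (h k X hX))

theorem IsCDiffFormAt.smul {f : M → ℝ} (hf : ContMDiffAt (𝓡 n) 𝓘(ℝ, ℝ) m f x)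
    (h : IsCDiffFormAt m η x) : IsCDiffFormAt m (fun y => f y • η y) x := fun k X hX =>
  hf.smul (h k X hX)

theorem isCDiffFormAt_zero : IsCDiffFormAt m (fun _ => 0 : Π x : M, Form n x) x :=
  fun _ _ _ => contMDiffAt_const

theorem IsCDiffFormAt.sum {ι : Type*} (s : Finset ι) {F : ι → Π x : M, Form n x}
    (h : ∀ i, IsCDiffFormAt m (F i) x) : IsCDiffFormAt m (fun y => ∑ i ∈ s, F i y) x := by
  classical
  induction s using Finset.induction_on with
  | empty => simpa using isCDiffFormAt_zero
  | insert i s hi ih =>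
    simp only [Finset.sum_insert hi]
    exact (h i).add ih

end SmoothForms

section SmoothClifford

variable {n : ℕ} {M : Type*} [TopologicalSpace M] [ChartedSpace (EuclideanSpace ℝ (Fin n)) M]
  [IsManifold (𝓡 n) ∞ M] [RiemannianBundle (fun x : M => TangentSpace (𝓡 n) x)]
  [IsContMDiffRiemannianBundle (𝓡 n) ∞ (EuclideanSpace ℝ (Fin n))
    (fun x : M => TangentSpace (𝓡 n) x)]
  {X : Π x : M, TangentSpace (𝓡 n) x} {η : Π x : M, Form n x} {x : M} {m : ℕ∞ω}

theorem IsCDiffFormAt.contract {X : Π x : M, TangentSpace (𝓡 n) x} (h : IsCDiffFormAt m η x)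
    (hX : ContMDiffAt (𝓡 n) (𝓡 n).tangent ∞ (T% X) x) :
    IsCDiffFormAt m (fun y => RiemannianForms.contract (X y) (η y)) x := fun k Y hY => by
  have := h (k + 1) (Fin.cons X Y) (Fin.cases hX hY)
  refine this.congr_of_eventuallyEq (.of_forall fun y => ?_)
  exact congrArg (η y (k + 1)) (funext (Fin.cases rfl fun _ => rfl))

/-- `hξ` says that the covector field `ξ` is `C^m`. -/
theorem IsCDiffFormAt.wedge {ξ : Π x : M, TangentSpace (𝓡 n) x →L[ℝ] ℝ} (h : IsCDiffFormAt m η x)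
    (hξ : ∀ X : Π x : M, TangentSpace (𝓡 n) x, ContMDiffAt (𝓡 n) (𝓡 n).tangent ∞ (T% X) x →
      ContMDiffAt (𝓡 n) 𝓘(ℝ, ℝ) m (fun y => ξ y (X y)) x) :
    IsCDiffFormAt m (fun y => RiemannianForms.wedge (ξ y) (η y)) x := fun k X hX => by
  cases k with
  | zero => exact contMDiffAt_const
  | succ k =>
    simp only [wedge_apply_succ]
    refine contMDiffAt_finsetSum fun i _ => contMDiffAt_real_smul contMDiffAt_const ?_
    exact contMDiffAt_real_smul (hξ _ (hX i)) (h k (fun j => X (i.succAbove j)) fun j => hX _)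

theorem IsCDiffFormAt.wedge_inner (h : IsCDiffFormAt m η x) (hm : m ≤ ∞)
    (hX : SmoothFieldAt X x) :
    IsCDiffFormAt m (fun y => RiemannianForms.wedge (innerSL ℝ (X y)) (η y)) x :=
  IsCDiffFormAt.wedge h fun _ hY => (contMDiffAt_inner hX hY le_rfl).of_le hm

theorem IsCDiffFormAt.cliff (h : IsCDiffFormAt m η x) (hm : m ≤ ∞)
    (hX : SmoothFieldAt X x) :
    IsCDiffFormAt m (fun y => RiemannianForms.cliff (X y) (η y)) x :=
  (h.wedge_inner hm hX).sub (IsCDiffFormAt.contract h hX)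

theorem IsCDiffFormAt.cliffHat (h : IsCDiffFormAt m η x) (hm : m ≤ ∞)
    (hX : SmoothFieldAt X x) :
    IsCDiffFormAt m (fun y => RiemannianForms.cliffHat (X y) (η y)) x :=
  (h.wedge_inner hm hX).add (IsCDiffFormAt.contract h hX)

end SmoothClifford

/-! ### The induced connection on forms -/

section FormNabla

variable {n : ℕ} {M : Type*} [TopologicalSpace M] [ChartedSpace (EuclideanSpace ℝ (Fin n)) M]
  [IsManifold (𝓡 n) ∞ M] [RiemannianBundle (fun x : M => TangentSpace (𝓡 n) x)]
  [IsContMDiffRiemannianBundle (𝓡 n) ∞ (EuclideanSpace ℝ (Fin n))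
    (fun x : M => TangentSpace (𝓡 n) x)]
  {X Y : Π x : M, TangentSpace (𝓡 n) x} {η θ : Π x : M, Form n x}
  {φ : OpenPartialHomeomorph M (EuclideanSpace ℝ (Fin n))} {x : M}

theorem form_update_sum_smul {k : ℕ} (α : Form n x) (w : Fin k → TangentSpace (𝓡 n) x) (a : Fin k)
    {ι : Type*} [Fintype ι] (r : ι → ℝ) (u : ι → TangentSpace (𝓡 n) x) :
    α k (Function.update w a (∑ j, r j • u j)) = ∑ j, r j • α k (Function.update w a (u j)) := by
  have h := map_sum ((α k).toContinuousLinearMap w a) (fun j => r j • u j) Finset.univ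
  simp only [map_smul] at h
  exact h

/-- The covariant derivative in coordinates, with the Christoffel terms and the derivatives of the
components separated. -/
theorem leviCivita_eq_sum_coordField (hφ : φ ∈ IsManifold.maximalAtlas (𝓡 n) ∞ M)
    (hx : x ∈ φ.source) (hX : ContMDiffAt (𝓡 n) (𝓡 n).tangent 1 (T% X) x)
    (v : TangentSpace (𝓡 n) x) :
    leviCivita X x v = ∑ j, coordCovector φ j x (X x) • leviCivita (coordField φ j) x v
      + ∑ j, mvfderiv (𝓡 n) (fun y => coordCovector φ j y (X y)) x v • coordField φ j x := by
  have h1 (j : Fin n) : MDifferentiableAt (𝓡 n) 𝓘(ℝ, ℝ) (fun y => coordCovector φ j y (X y)) x :=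
    (contMDiffAt_coordCovector_apply (by simp) hφ hx j hX).mdifferentiableAt (by simp)
  have h2 (j : Fin n) : DiffFieldAt (coordField φ j) x :=
    (smoothFieldAt_coordField hφ hx j).diff
  rw [leviCivita_congr (Y := fun y => ∑ j, coordCovector φ j y (X y) • coordField φ j y)
    (hX.mdifferentiableAt (by simp)),
    leviCivita_sum _ (F := fun j y => coordCovector φ j y (X y) • coordField φ j y)
      fun j => (h1 j).smul_section (h2 j),
    ← Finset.sum_add_distrib]
  · simp only [sum_apply]
    exact Finset.sum_congr rfl fun j _ => leviCivita_smul (h2 j) (h1 j) v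
  · filter_upwards [φ.open_source.mem_nhds hx] with y hy
    rw [sum_coord_smul_coordField hφ hy]

/-- The derivative of the function `η(X_1, …, X_k)`, in coordinates. -/
theorem mvfderiv_form_apply_chart (hη : IsCDiffFormAt 1 η x)
    (hφ : φ ∈ IsManifold.maximalAtlas (𝓡 n) ∞ M) (hx : x ∈ φ.source) (k : ℕ)
    {X : Fin k → Π x : M, TangentSpace (𝓡 n) x}
    (hX : ∀ a, ContMDiffAt (𝓡 n) (𝓡 n).tangent 1 (T% (X a)) x) (v : TangentSpace (𝓡 n) x) :
    mvfderiv (𝓡 n) (fun y => η y k fun a => X a y) x v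
      = fderiv ℝ (inChart φ η k) (φ x) (mfderiv (𝓡 n) 𝓘(ℝ, EuclideanSpace ℝ (Fin n)) φ x v)
          (fun a => mfderiv (𝓡 n) 𝓘(ℝ, EuclideanSpace ℝ (Fin n)) φ x (X a x))
        + ∑ a, η x k (Function.update (fun a => X a x) a
          (∑ j, mvfderiv (𝓡 n) (fun y => coordCovector φ j y (X a y)) x v • coordField φ j x)) := by
  have h1 (a : Fin k) (j : Fin n) :
      MDifferentiableAt (𝓡 n) 𝓘(ℝ, ℝ) (fun y => coordCovector φ j y (X a y)) x :=
    (contMDiffAt_coordCovector_apply (by simp) hφ hx j (hX a)).mdifferentiableAt (by simp)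
  have hs : ContMDiffAt 𝓘(ℝ, EuclideanSpace ℝ (Fin n)) (𝓡 n) ∞ φ.symm (φ x) :=
    contMDiffAt_symm_of_mem_maximalAtlas hφ (φ.map_source hx)
  -- `c a j` are the components of `X a` in the chart, and `g a` is the vector field they form
  -- there.
  let c (a : Fin k) (j : Fin n) (z : EuclideanSpace ℝ (Fin n)) : ℝ :=
    coordCovector φ j (φ.symm z) (X a (φ.symm z))
  have hc (a : Fin k) (j : Fin n) : DifferentiableAt ℝ (c a j) (φ x) :=
    mdifferentiableAt_iff_differentiableAt.1 <| MDifferentiableAt.comp_of_eq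
      (hg := h1 a j) (hf := hs.mdifferentiableAt (by simp)) (hy := φ.left_inv hx)
  let g (a : Fin k) (z : EuclideanSpace ℝ (Fin n)) : EuclideanSpace ℝ (Fin n) :=
    ∑ j, c a j z • EuclideanSpace.basisFun (Fin n) ℝ j
  have hg (a : Fin k) : HasFDerivAt (g a)
      (∑ j, (fderiv ℝ (c a j) (φ x)).smulRight (EuclideanSpace.basisFun (Fin n) ℝ j)) (φ x) :=
    HasFDerivAt.fun_sum fun j _ => (hc a j).hasFDerivAt.smul_const _
  have hgy (a : Fin k) {y : M} (hy : y ∈ φ.source) :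
      g a (φ y) = mfderiv (𝓡 n) 𝓘(ℝ, EuclideanSpace ℝ (Fin n)) φ y (X a y) := by
    have h2 := congrArg (mfderiv (𝓡 n) 𝓘(ℝ, EuclideanSpace ℝ (Fin n)) φ y)
      (sum_coord_smul_coordField hφ hy (X a y))
    rw [map_sum] at h2
    simp only [map_smul, mfderiv_coordField hφ hy] at h2
    rw [← h2]
    simp only [g, c]
    -- The equation `φ.symm (φ y) = y` cannot be rewritten directly, as the types depend on the
    -- point.
    have key : ∀ p, p = y → ∀ j, coordCovector φ j p (X a p) = coordCovector φ j y (X a y) := by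
      rintro p rfl j; rfl
    refine Finset.sum_congr rfl fun j _ => ?_
    rw [key _ (φ.left_inv hy)]
    rfl
  have hcv (a : Fin k) (j : Fin n) :
      fderiv ℝ (c a j) (φ x) (mfderiv (𝓡 n) 𝓘(ℝ, EuclideanSpace ℝ (Fin n)) φ x v)
        = mvfderiv (𝓡 n) (fun y => coordCovector φ j y (X a y)) x v := by
    rw [← mvfderiv_comp_chart hφ hx (hc a j) v]
    suffices h : (fun y => c a j (φ y)) =ᶠ[𝓝 x] fun y => coordCovector φ j y (X a y) by
      rw [mvfderiv_congr h]
    filter_upwards [φ.open_source.mem_nhds hx] with y hy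
    have key : ∀ p, p = y → coordCovector φ j p (X a p) = coordCovector φ j y (X a y) := by
      rintro p rfl; rfl
    exact key _ (φ.left_inv hy)
  have hF := (hη.contDiffAt_inChart (by simp) hφ hx k).differentiableAt (by simp)
  have h3 : (fun y => η y k fun a => X a y) =ᶠ[𝓝 x]
      fun y => (fun z => inChart φ η k z fun a => g a z) (φ y) := by
    filter_upwards [φ.open_source.mem_nhds hx] with y hy
    simp only [hgy _ hy]
    exact (inChart_mfderiv_apply hφ hy η k _).symm
  rw [mvfderiv_congr h3, mvfderiv_comp_chart hφ hx
    (hF.hasFDerivAt.continuousAlternatingMap_apply hg).differentiableAt]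
  refine (fderiv_continuousAlternatingMap_apply_apply hF
    (fun a => (hg a).differentiableAt) _).trans ?_
  congr 1
  · simp only [hgy _ hx]
  · refine Finset.sum_congr rfl fun a _ => ?_
    rw [← inChart_mfderiv_apply hφ hx]
    congr 1
    funext b
    rw [(hg a).fderiv]
    by_cases hb : b = a
    · subst hb
      simp only [Function.update_self, map_sum, map_smul, mfderiv_coordField hφ hx]
      refine (sum_apply _ _ _).trans (Finset.sum_congr rfl fun j _ => ?_)
      exact congrArg (· • EuclideanSpace.basisFun (Fin n) ℝ j) (hcv b j)
    · simp only [Function.update_of_ne hb, hgy _ hx]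
      exact Function.update_of_ne hb _ _

/-- The connection on forms is characterised by the Leibniz rule
`v(η(X_1, …, X_k)) = (∇_v η)(X_1, …, X_k) + ∑ a, η(X_1, …, ∇_v X_a, …, X_k)`. -/
theorem mvfderiv_form_apply (hη : IsCDiffFormAt 1 η x) (k : ℕ)
    {X : Fin k → Π x : M, TangentSpace (𝓡 n) x}
    (hX : ∀ a, ContMDiffAt (𝓡 n) (𝓡 n).tangent 1 (T% (X a)) x) (v : TangentSpace (𝓡 n) x) :
    mvfderiv (𝓡 n) (fun y => η y k fun a => X a y) x v
      = formNabla η x v k (fun a => X a x)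
        + ∑ a, η x k (Function.update (fun a => X a x) a (leviCivita (X a) x v)) := by
  have hφ := IsManifold.chart_mem_maximalAtlas (I := 𝓡 n) (n := ∞) x
  have hx : x ∈ (chartAt (EuclideanSpace ℝ (Fin n)) x).source := mem_chart_source _ x
  rw [mvfderiv_form_apply_chart hη hφ hx k hX, formNabla, form_sub_apply, form_sum_apply]
  simp only [wedge_contract_apply]
  rw [Finset.sum_comm]
  simp only [leviCivita_eq_sum_coordField hφ hx (hX _) v]
  simp only [ContinuousAlternatingMap.map_update_add, form_update_sum_smul,
    Finset.sum_add_distrib]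
  exact (by intros; abel : ∀ A B C : ℂ, A + B = A - C + (C + B)) _ _ _

end FormNabla

section FormNablaRules

variable {n : ℕ} {M : Type*} [TopologicalSpace M] [ChartedSpace (EuclideanSpace ℝ (Fin n)) M]
  [IsManifold (𝓡 n) ∞ M] [RiemannianBundle (fun x : M => TangentSpace (𝓡 n) x)]
  [IsContMDiffRiemannianBundle (𝓡 n) ∞ (EuclideanSpace ℝ (Fin n))
    (fun x : M => TangentSpace (𝓡 n) x)]
  {X Y : Π x : M, TangentSpace (𝓡 n) x} {η θ : Π x : M, Form n x} {x : M}

theorem IsCDiffFormAt.mdifferentiableAt_apply (hη : IsCDiffFormAt 1 η x) {k : ℕ}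
    {X : Fin k → Π x : M, TangentSpace (𝓡 n) x} (hX : ∀ a, SmoothFieldAt (X a) x) :
    MDifferentiableAt (𝓡 n) 𝓘(ℝ, ℂ) (fun y => η y k fun a => X a y) x :=
  (hη k X hX).mdifferentiableAt (by simp)

theorem mvfderiv_real_smul {f : M → ℝ} {g : M → ℂ} (hf : MDifferentiableAt (𝓡 n) 𝓘(ℝ, ℝ) f x)
    (hg : MDifferentiableAt (𝓡 n) 𝓘(ℝ, ℂ) g x) (v : TangentSpace (𝓡 n) x) :
    mvfderiv (𝓡 n) (fun y => f y • g y) x v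
      = f x • mvfderiv (𝓡 n) g x v + mvfderiv (𝓡 n) f x v • g x := by
  have h := mvfderiv_fun_smul hf hg
  rw [h]
  rfl

theorem mvfderiv_complex_mul {f g : M → ℂ} (hf : MDifferentiableAt (𝓡 n) 𝓘(ℝ, ℂ) f x)
    (hg : MDifferentiableAt (𝓡 n) 𝓘(ℝ, ℂ) g x) (v : TangentSpace (𝓡 n) x) :
    mvfderiv (𝓡 n) (fun y => f y * g y) x v
      = f x * mvfderiv (𝓡 n) g x v + mvfderiv (𝓡 n) f x v * g x := by
  have h := (hf.hasMFDerivAt.mul' hg.hasMFDerivAt).mfderiv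
  exact congr($h v)

theorem mvfderiv_fun_sum {ι : Type*} (s : Finset ι) {f : ι → M → ℂ}
    (hf : ∀ i, ContMDiffAt (𝓡 n) 𝓘(ℝ, ℂ) 1 (f i) x) (v : TangentSpace (𝓡 n) x) :
    mvfderiv (𝓡 n) (fun y => ∑ i ∈ s, f i y) x v = ∑ i ∈ s, mvfderiv (𝓡 n) (f i) x v := by
  classical
  induction s using Finset.induction_on with
  | empty =>
    simp only [Finset.sum_empty]
    exact congr($(mvfderiv_const (I := 𝓡 n) (x := x) (0 : ℂ)) v)
  | insert i s hi ih =>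
    simp only [Finset.sum_insert hi, ← ih]
    have h := mvfderiv_fun_add ((hf i).mdifferentiableAt (by simp))
      ((contMDiffAt_finsetSum (t := s) fun i _ => hf i).mdifferentiableAt (by simp))
    exact congr($h v)

theorem exists_parallel_family {k : ℕ} (w : Fin k → TangentSpace (𝓡 n) x) :
    ∃ W : Fin k → Π x : M, TangentSpace (𝓡 n) x, (∀ a, SmoothFieldAt (W a) x) ∧
      (fun a => W a x) = w ∧ ∀ a, leviCivita (W a) x = 0 := by
  choose W h1 h2 h3 using fun a => exists_parallel_extension (w a)
  exact ⟨W, h1, funext h2, h3⟩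

/-- Along fields that are parallel at `x`, the connection differentiates values. -/
theorem formNabla_apply_of_parallel (hη : IsCDiffFormAt 1 η x) {k : ℕ}
    {W : Fin k → Π x : M, TangentSpace (𝓡 n) x} (hW : ∀ a, SmoothFieldAt (W a) x)
    (hW0 : ∀ a, leviCivita (W a) x = 0) (v : TangentSpace (𝓡 n) x) :
    formNabla η x v k (fun a => W a x) = mvfderiv (𝓡 n) (fun y => η y k fun a => W a y) x v := by
  rw [mvfderiv_form_apply hη k (fun a => (hW a).one) v, left_eq_add]
  refine Finset.sum_eq_zero fun a _ => ?_
  rw [hW0 a]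
  exact (η x k).map_coord_zero a (by simp)

theorem formNabla_congr (hη : IsCDiffFormAt 1 η x) (h : ∀ᶠ y in 𝓝 x, θ y = η y) :
    formNabla θ x = formNabla η x := by
  refine funext fun v => form_ext fun k w => ?_
  obtain ⟨W, h1, rfl, h3⟩ := exists_parallel_family w
  rw [formNabla_apply_of_parallel hη h1 h3, formNabla_apply_of_parallel (hη.congr h) h1 h3]
  suffices h' : (fun y => θ y k fun a => W a y) =ᶠ[𝓝 x] fun y => η y k fun a => W a y by
    rw [mvfderiv_congr h']
  filter_upwards [h] with y hy
  rw [hy]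

theorem formNabla_add_dir (hη : IsCDiffFormAt 1 η x) (u v : TangentSpace (𝓡 n) x) :
    formNabla η x (u + v) = formNabla η x u + formNabla η x v := by
  refine form_ext fun k w => ?_
  obtain ⟨W, h1, rfl, h3⟩ := exists_parallel_family w
  simp only [form_add_apply, formNabla_apply_of_parallel hη h1 h3, map_add]

theorem formNabla_smul_dir (hη : IsCDiffFormAt 1 η x) (a : ℝ) (v : TangentSpace (𝓡 n) x) :
    formNabla η x (a • v) = a • formNabla η x v := by
  refine form_ext fun k w => ?_
  obtain ⟨W, h1, rfl, h3⟩ := exists_parallel_family w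
  simp only [form_smul_apply, formNabla_apply_of_parallel hη h1 h3, map_smul]

/-- The map `v ↦ ∇_v η` at `x`, which is linear when `η` is differentiable. -/
noncomputable def formNablaLinear (hη : IsCDiffFormAt 1 η x) :
    TangentSpace (𝓡 n) x →ₗ[ℝ] Form n x where
  toFun v := formNabla η x v
  map_add' := formNabla_add_dir hη
  map_smul' := formNabla_smul_dir hη

theorem formNabla_sum_dir (hη : IsCDiffFormAt 1 η x) {ι : Type*} (s : Finset ι) (r : ι → ℝ)
    (v : ι → TangentSpace (𝓡 n) x) :
    formNabla η x (∑ i ∈ s, r i • v i) = ∑ i ∈ s, r i • formNabla η x (v i) := by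
  have := map_sum (formNablaLinear hη) (fun i => r i • v i) s
  simp only [map_smul] at this
  exact this

theorem formNabla_add (hη : IsCDiffFormAt 1 η x) (hθ : IsCDiffFormAt 1 θ x)
    (v : TangentSpace (𝓡 n) x) :
    formNabla (fun y => η y + θ y) x v = formNabla η x v + formNabla θ x v := by
  refine form_ext fun k w => ?_
  obtain ⟨W, h1, rfl, h3⟩ := exists_parallel_family w
  rw [form_add_apply, formNabla_apply_of_parallel hη h1 h3, formNabla_apply_of_parallel hθ h1 h3,
    formNabla_apply_of_parallel (hη.add hθ) h1 h3]
  have := mvfderiv_fun_add (hη.mdifferentiableAt_apply h1) (hθ.mdifferentiableAt_apply h1)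
  exact congr($this v)

theorem formNabla_csmul {f : M → ℂ} (hf : ContMDiffAt (𝓡 n) 𝓘(ℝ, ℂ) 1 f x)
    (hη : IsCDiffFormAt 1 η x) (v : TangentSpace (𝓡 n) x) :
    formNabla (fun y => f y • η y) x v = f x • formNabla η x v + mvfderiv (𝓡 n) f x v • η x := by
  refine form_ext fun k w => ?_
  obtain ⟨W, h1, rfl, h3⟩ := exists_parallel_family w
  rw [form_add_apply, form_csmul_apply, form_csmul_apply, formNabla_apply_of_parallel hη h1 h3,
    formNabla_apply_of_parallel (IsCDiffFormAt.csmul hf hη) h1 h3]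
  exact mvfderiv_complex_mul (hf.mdifferentiableAt (by simp)) (hη.mdifferentiableAt_apply h1) v

theorem formNabla_smul {f : M → ℝ} (hf : ContMDiffAt (𝓡 n) 𝓘(ℝ, ℝ) 1 f x)
    (hη : IsCDiffFormAt 1 η x) (v : TangentSpace (𝓡 n) x) :
    formNabla (fun y => f y • η y) x v = f x • formNabla η x v + mvfderiv (𝓡 n) f x v • η x := by
  refine form_ext fun k w => ?_
  obtain ⟨W, h1, rfl, h3⟩ := exists_parallel_family w
  rw [form_add_apply, form_smul_apply, form_smul_apply, formNabla_apply_of_parallel hη h1 h3,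
    formNabla_apply_of_parallel (IsCDiffFormAt.smul hf hη) h1 h3]
  exact mvfderiv_real_smul (hf.mdifferentiableAt (by simp)) (hη.mdifferentiableAt_apply h1) v

theorem formNabla_zero (v : TangentSpace (𝓡 n) x) :
    formNabla (fun _ => 0 : Π x : M, Form n x) x v = 0 := by
  refine form_ext fun k w => ?_
  obtain ⟨W, h1, rfl, h3⟩ := exists_parallel_family w
  rw [formNabla_apply_of_parallel isCDiffFormAt_zero h1 h3]
  exact congr($(mvfderiv_const (I := 𝓡 n) (0 : ℂ)) v)

theorem formNabla_sum {ι : Type*} (s : Finset ι) {F : ι → Π x : M, Form n x}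
    (hF : ∀ i, IsCDiffFormAt 1 (F i) x) (v : TangentSpace (𝓡 n) x) :
    formNabla (fun y => ∑ i ∈ s, F i y) x v = ∑ i ∈ s, formNabla (F i) x v := by
  classical
  induction s using Finset.induction_on with
  | empty => simpa using formNabla_zero v
  | insert i s hi ih =>
    simp only [Finset.sum_insert hi, ← ih]
    exact formNabla_add (hF i) (.sum s hF) v

theorem formNabla_contract (hη : IsCDiffFormAt 1 η x) (hX : SmoothFieldAt X x)
    (v : TangentSpace (𝓡 n) x) :
    formNabla (fun y => contract (X y) (η y)) x v
      = contract (leviCivita X x v) (η x) + contract (X x) (formNabla η x v) := by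
  refine form_ext fun k w => ?_
  obtain ⟨W, h1, rfl, h3⟩ := exists_parallel_family w
  rw [formNabla_apply_of_parallel (IsCDiffFormAt.contract hη hX) h1 h3, form_add_apply]
  have h4 : ∀ y, (fun a => (Fin.cons X W : Fin (k + 1) → Π x : M, TangentSpace (𝓡 n) x) a y)
      = Fin.cons (X y) fun a => W a y := fun y => funext (Fin.cases rfl fun _ => rfl)
  have h5 := mvfderiv_form_apply hη (k + 1) (X := Fin.cons X W)
    (Fin.cases hX.one fun a => (h1 a).one) v
  simp only [h4, Fin.sum_univ_succ, Fin.cons_zero, Fin.cons_succ, h3] at h5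
  simp only [contract_apply]
  rw [h5, add_comm, Fin.update_cons_zero, add_assoc]
  congr 1
  rw [add_eq_right]
  refine Finset.sum_eq_zero fun a _ => ?_
  exact (η x (k + 1)).map_coord_zero a.succ (by simp)

theorem formNabla_wedge (hη : IsCDiffFormAt 1 η x) (hX : SmoothFieldAt X x)
    (v : TangentSpace (𝓡 n) x) :
    formNabla (fun y => wedge (innerSL ℝ (X y)) (η y)) x v
      = wedge (innerSL ℝ (leviCivita X x v)) (η x) + wedge (innerSL ℝ (X x)) (formNabla η x v) := by
  refine form_ext fun k w => ?_
  obtain ⟨W, h1, rfl, h3⟩ := exists_parallel_family w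
  rw [formNabla_apply_of_parallel (hη.wedge_inner (by simp) hX) h1 h3, form_add_apply]
  cases k with
  | zero =>
    simp only [wedge_apply_zero]
    refine Eq.trans ?_ (add_zero (0 : ℂ)).symm
    exact congr($(mvfderiv_const (I := 𝓡 n) (x := x) (0 : ℂ)) v)
  | succ k =>
    have h4 (i : Fin (k + 1)) :
        ContMDiffAt (𝓡 n) 𝓘(ℝ, ℝ) 1 (fun y => inner ℝ (X y) (W i y)) x :=
      contMDiffAt_inner hX.one (h1 i).one (by simp)
    have h5 (i : Fin (k + 1)) : ContMDiffAt (𝓡 n) 𝓘(ℝ, ℂ) 1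
        (fun y => η y k (i.removeNth fun a => W a y)) x :=
      hη k (fun j => W (i.succAbove j)) fun j => h1 _
    have h6 (i : Fin (k + 1)) :
        mvfderiv (𝓡 n) (fun y => η y k (i.removeNth fun a => W a y)) x v
          = formNabla η x v k (i.removeNth fun a => W a x) :=
      (formNabla_apply_of_parallel hη (W := fun j => W (i.succAbove j)) (fun j => h1 _)
        (fun j => h3 _) v).symm
    simp only [wedge_apply_succ, ← Finset.sum_add_distrib, innerSL_apply_apply]
    rw [mvfderiv_fun_sum _ fun i => contMDiffAt_real_smul contMDiffAt_const
      (contMDiffAt_real_smul (h4 i) (h5 i))]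
    refine Finset.sum_congr rfl fun i _ => ?_
    rw [mvfderiv_real_smul mdifferentiableAt_const
      ((contMDiffAt_real_smul (h4 i) (h5 i)).mdifferentiableAt (by simp)),
      mvfderiv_real_smul ((h4 i).mdifferentiableAt (by simp)) ((h5 i).mdifferentiableAt (by simp)),
      h6, mvfderiv_inner hX.diff (h1 i).diff, h3 i, mvfderiv_const]
    simp only [zero_apply, inner_zero_right, add_zero, zero_smul, smul_add]
    rw [add_comm]

theorem formNabla_cliff (hη : IsCDiffFormAt 1 η x) (hX : SmoothFieldAt X x)
    (v : TangentSpace (𝓡 n) x) :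
    formNabla (fun y => cliff (X y) (η y)) x v
      = cliff (leviCivita X x v) (η x) + cliff (X x) (formNabla η x v) := by
  have h := formNabla_add ((hη.wedge_inner (by simp) hX))
    (IsCDiffFormAt.smul (f := fun _ => (-1 : ℝ)) contMDiffAt_const
      (IsCDiffFormAt.contract hη hX)) v
  rw [formNabla_smul contMDiffAt_const (IsCDiffFormAt.contract hη hX), formNabla_wedge hη hX,
    formNabla_contract hη hX, mvfderiv_const] at h
  have h2 : (fun y => cliff (X y) (η y)) = fun y =>
      wedge (innerSL ℝ (X y)) (η y) + (-1 : ℝ) • contract (X y) (η y) :=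
    funext fun y => by rw [cliff_apply]; module
  rw [h2, h, cliff_apply, cliff_apply]
  simp only [zero_apply]
  module

theorem formNabla_cliffHat (hη : IsCDiffFormAt 1 η x) (hX : SmoothFieldAt X x)
    (v : TangentSpace (𝓡 n) x) :
    formNabla (fun y => cliffHat (X y) (η y)) x v
      = cliffHat (leviCivita X x v) (η x) + cliffHat (X x) (formNabla η x v) := by
  have := formNabla_add (hη.wedge_inner (by simp) hX) (IsCDiffFormAt.contract hη hX) v
  rw [formNabla_wedge hη hX, formNabla_contract hη hX] at this
  simp only [cliffHat_apply]
  rw [this]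
  abel

theorem IsCDiffFormAt.formNabla (hη : IsCDiffFormAt ∞ η x) (hX : SmoothFieldAt X x) :
    IsCDiffFormAt ∞ (fun y => RiemannianForms.formNabla η y (X y)) x := by
  intro k Y hY
  have h1 : ContMDiffAt (𝓡 n) 𝓘(ℝ, ℂ) ∞ (fun y =>
      mvfderiv (𝓡 n) (fun z => η z k fun a => Y a z) y (X y)
        - ∑ a, η y k (fun b => Function.update Y a (fun z => leviCivita (Y a) z (X z)) b y)) x := by
    refine (contMDiffAt_mvfderiv_apply le_rfl (hη k Y hY) hX).sub
      (contMDiffAt_finsetSum fun a _ => hη k _ fun b => ?_)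
    by_cases hb : b = a
    · subst hb; simpa using SmoothFieldAt.nabla (hY b) hX
    · simpa [hb] using hY b
  refine h1.congr_of_eventuallyEq ?_
  have h2 : ∀ᶠ y in 𝓝 x, ∀ a, ContMDiffAt (𝓡 n) (𝓡 n).tangent 1 (T% (Y a)) y :=
    Filter.eventually_all.2 fun a => ((contMDiffAt_iff_contMDiffAt_nhds (by simp)).1
      (SmoothFieldAt.one (hY a)))
  filter_upwards [hη.eventually_one, h2] with y hy1 hy2
  rw [mvfderiv_form_apply hy1 k hy2, eq_sub_iff_add_eq]
  congr 1
  refine Finset.sum_congr rfl fun a _ => congrArg (η y k) (funext fun b => ?_)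
  by_cases hb : b = a
  · subst hb; simp
  · simp [hb]

theorem isFormConnection_formNabla :
    IsFormConnection (formNabla : (Π x : M, Form n x) → Π x : M, TangentSpace (𝓡 n) x → Form n x)
    where
  add_dir σ x v w hσ := formNabla_add_dir ((isSmoothFormAt_iff.1 hσ).of_le (by simp)) v w
  smul_dir σ x a v hσ := formNabla_smul_dir ((isSmoothFormAt_iff.1 hσ).of_le (by simp)) a v
  add σ τ x v hσ hτ := formNabla_add ((isSmoothFormAt_iff.1 hσ).of_le (by simp))
    ((isSmoothFormAt_iff.1 hτ).of_le (by simp)) v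
  leibniz f σ x v hf hσ := formNabla_csmul (hf.of_le (by simp))
    ((isSmoothFormAt_iff.1 hσ).of_le (by simp)) v
  smooth σ X x hσ hX := isSmoothFormAt_iff.2 ((isSmoothFormAt_iff.1 hσ).formNabla hX)

end FormNablaRules

/-! ### The metric in coordinates -/

section Determinant

theorem contDiff_det {n : ℕ} :
    ContDiff ℝ ∞ fun A : Fin n → Fin n → ℝ => (Matrix.of A).det := by
  simp only [Matrix.det_apply, Matrix.of_apply]
  refine ContDiff.sum fun σ _ => ContDiff.const_smul _ (contDiff_prod fun i _ => ?_)
  exact contDiff_apply_apply ℝ ℝ (σ i) i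

/-- The derivative of the determinant at an invertible matrix. -/
theorem fderiv_det {n : ℕ} {A : Fin n → Fin n → ℝ} (hA : (Matrix.of A).det ≠ 0)
    (B : Fin n → Fin n → ℝ) :
    fderiv ℝ (fun A : Fin n → Fin n → ℝ => (Matrix.of A).det) A B
      = (Matrix.of A).det * ∑ i, ∑ j, (Matrix.of A)⁻¹ i j * B j i := by
  have h1 := (contDiff_det (n := n)).differentiable (by simp) A
  have h2 := h1.hasFDerivAt.hasLineDerivAt B
  have h3 : (fun t : ℝ => (Matrix.of (A + t • B)).det) = fun t : ℝ =>
      (Matrix.of A).det * (1 + ((Matrix.of A)⁻¹ * Matrix.of B).trace * t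
        + (Matrix.det (1 + (Polynomial.X : Polynomial ℝ) •
          ((Matrix.of A)⁻¹ * Matrix.of B).map Polynomial.C)).divX.divX.eval t * t ^ 2) := by
    funext t
    rw [← Matrix.det_one_add_smul, ← Matrix.det_mul, mul_add, mul_one, Matrix.mul_smul,
      ← mul_assoc, Matrix.mul_nonsing_inv _ (isUnit_iff_ne_zero.2 hA), one_mul]
    rfl
  set p := (Matrix.det (1 + (Polynomial.X : Polynomial ℝ) •
          ((Matrix.of A)⁻¹ * Matrix.of B).map Polynomial.C)).divX.divX
  have h4 : HasDerivAt (fun t : ℝ => (Matrix.of A).det *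
      (1 + ((Matrix.of A)⁻¹ * Matrix.of B).trace * t + p.eval t * t ^ 2))
      ((Matrix.of A).det * ((Matrix.of A)⁻¹ * Matrix.of B).trace) 0 := by
    have h5 := ((((hasDerivAt_id (0 : ℝ)).const_mul ((Matrix.of A)⁻¹ * Matrix.of B).trace).const_add
      1).add ((p.hasDerivAt 0).mul (hasDerivAt_pow 2 (0 : ℝ)))).const_mul (Matrix.of A).det
    simpa using h5
  rw [← h3] at h4
  have h6 := HasDerivAt.unique h2 h4
  rw [h6]
  simp [Matrix.trace, Matrix.mul_apply]

end Determinant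

section Cancellation

theorem sum_sum_eq_zero_of_antisymm {A : Type*} [AddCommGroup A] [Module ℝ A] {ι : Type*}
    [Fintype ι] {β : ι → ι → A} (hβ : ∀ i j, β i j = -β j i) : ∑ i, ∑ j, β i j = 0 := by
  have h : ∑ i, ∑ j, β i j = -∑ i, ∑ j, β i j := by
    conv_lhs => rw [Finset.sum_comm]
    simp only [← Finset.sum_neg_distrib]
    exact Finset.sum_congr rfl fun i _ => Finset.sum_congr rfl fun j _ => hβ j i
  have h2 : (2 : ℝ) • ∑ i, ∑ j, β i j = 0 := by
    rw [two_smul]; nth_rw 2 [h]; exact add_neg_cancel _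
  simpa using h2

theorem sum_symm_smul_antisymm {A : Type*} [AddCommGroup A] [Module ℝ A] {ι : Type*} [Fintype ι]
    {S : ι → ι → ℝ} {β : ι → ι → A} (hS : ∀ i j, S i j = S j i) (hβ : ∀ i j, β i j = -β j i) :
    ∑ i, ∑ j, S i j • β i j = 0 :=
  sum_sum_eq_zero_of_antisymm fun i j => by rw [hS, hβ, smul_neg]

end Cancellation

section CoordGrad

variable {n : ℕ} {M : Type*} [TopologicalSpace M] [ChartedSpace (EuclideanSpace ℝ (Fin n)) M]
  [IsManifold (𝓡 n) ∞ M] [RiemannianBundle (fun x : M => TangentSpace (𝓡 n) x)]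
  {φ : OpenPartialHomeomorph M (EuclideanSpace ℝ (Fin n))} {x : M}

/-- The gradient of the `j`-th coordinate function of a chart. -/
noncomputable def coordGrad (φ : OpenPartialHomeomorph M (EuclideanSpace ℝ (Fin n))) (j : Fin n)
    (x : M) : TangentSpace (𝓡 n) x :=
  ∑ l, (gram φ x)⁻¹ l j • coordField φ l x

theorem gram_det_pos (hφ : φ ∈ IsManifold.maximalAtlas (𝓡 n) ∞ M) (hx : x ∈ φ.source) :
    0 < (gram φ x).det :=
  (Matrix.posDef_gram_of_linearIndependent (𝕜 := ℝ) (E := TangentSpace (𝓡 n) x)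
    (linearIndependent_coordField hφ hx)).det_pos

theorem inner_coordGrad_coordField (hφ : φ ∈ IsManifold.maximalAtlas (𝓡 n) ∞ M)
    (hx : x ∈ φ.source) (j l : Fin n) :
    inner ℝ (coordGrad φ j x) (coordField φ l x) = if j = l then 1 else 0 := by
  have h1 : gram φ x * (gram φ x)⁻¹ = 1 :=
    Matrix.mul_nonsing_inv _ (isUnit_iff_ne_zero.2 (gram_det_pos hφ hx).ne')
  have h2 := congrFun (congrFun h1 l) j
  rw [Matrix.mul_apply, Matrix.one_apply] at h2
  rw [coordGrad, sum_inner]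
  simp only [eq_comm (a := j)]
  rw [← h2]
  refine Finset.sum_congr rfl fun i _ => ?_
  rw [inner_smul_left, mul_comm, real_inner_comm]
  rfl

theorem eq_of_inner_coordField_eq (hφ : φ ∈ IsManifold.maximalAtlas (𝓡 n) ∞ M)
    (hx : x ∈ φ.source) {u v : TangentSpace (𝓡 n) x}
    (h : ∀ l, inner ℝ u (coordField φ l x) = inner ℝ v (coordField φ l x)) : u = v := by
  refine ext_inner_right ℝ fun w => ?_
  rw [← sum_coord_smul_coordField hφ hx w, inner_sum, inner_sum]
  simp only [inner_smul_right, h]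

theorem sum_inner_smul_coordGrad (hφ : φ ∈ IsManifold.maximalAtlas (𝓡 n) ∞ M)
    (hx : x ∈ φ.source) (v : TangentSpace (𝓡 n) x) :
    ∑ j, inner ℝ v (coordField φ j x) • coordGrad φ j x = v := by
  refine eq_of_inner_coordField_eq hφ hx fun l => ?_
  simp [sum_inner, inner_smul_left, inner_coordGrad_coordField hφ hx]

theorem innerSL_coordGrad (hφ : φ ∈ IsManifold.maximalAtlas (𝓡 n) ∞ M) (hx : x ∈ φ.source)
    (j : Fin n) : innerSL ℝ (coordGrad φ j x) = coordCovector φ j x := by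
  ext w
  rw [innerSL_apply_apply]
  conv_lhs => rw [← sum_coord_smul_coordField hφ hx w]
  simp [inner_sum, inner_smul_right, inner_coordGrad_coordField hφ hx]

/-- Contracting a bilinear map with the metric in coordinates or in an orthonormal basis gives the
same result. -/
theorem sum_coordField_coordGrad (hφ : φ ∈ IsManifold.maximalAtlas (𝓡 n) ∞ M) (hx : x ∈ φ.source)
    {A : Type*} [AddCommGroup A] [Module ℝ A]
    (B : TangentSpace (𝓡 n) x →ₗ[ℝ] TangentSpace (𝓡 n) x →ₗ[ℝ] A)
    {v : Fin n → TangentSpace (𝓡 n) x} (hv : Orthonormal ℝ v) :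
    ∑ j, B (coordGrad φ j x) (coordField φ j x) = ∑ q, B (v q) (v q) := by
  have h1 (j : Fin n) : B (coordGrad φ j x) (coordField φ j x)
      = ∑ q, inner ℝ (v q) (coordField φ j x) • B (coordGrad φ j x) (v q) := by
    conv_lhs => rw [← sum_inner_smul hv (coordField φ j x)]
    simp
  have h2 (q : Fin n) : B (v q) (v q)
      = ∑ j, inner ℝ (v q) (coordField φ j x) • B (coordGrad φ j x) (v q) := by
    have h := congrArg (fun u => B u (v q)) (sum_inner_smul_coordGrad hφ hx (v q)).symm
    simpa only [map_sum, map_smul, LinearMap.sum_apply, LinearMap.smul_apply] using h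
  simp only [h1, h2]
  exact Finset.sum_comm

end CoordGrad

section CoordGradSmooth

variable {n : ℕ} {M : Type*} [TopologicalSpace M] [ChartedSpace (EuclideanSpace ℝ (Fin n)) M]
  [IsManifold (𝓡 n) ∞ M] [RiemannianBundle (fun x : M => TangentSpace (𝓡 n) x)]
  [IsContMDiffRiemannianBundle (𝓡 n) ∞ (EuclideanSpace ℝ (Fin n))
    (fun x : M => TangentSpace (𝓡 n) x)]
  {φ : OpenPartialHomeomorph M (EuclideanSpace ℝ (Fin n))} {x : M}

theorem smoothFieldAt_coordGrad (hφ : φ ∈ IsManifold.maximalAtlas (𝓡 n) ∞ M) (hx : x ∈ φ.source)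
    (j : Fin n) : SmoothFieldAt (coordGrad φ j) x := by
  obtain ⟨e, U, he, hxU⟩ := exists_isOrthonormalFrameOn (n := n) x
  refine he.contMDiffAt_of_inner hxU le_rfl fun i => ?_
  refine (contMDiffAt_coordCovector_apply le_rfl hφ hx j
    (he.smoothAt hxU i)).congr_of_eventuallyEq ?_
  filter_upwards [φ.open_source.mem_nhds hx] with y hy
  rw [← innerSL_coordGrad hφ hy, innerSL_apply_apply, real_inner_comm]

/-- The connection is torsion free, so the covariant derivatives of coordinate fields commute. -/
theorem leviCivita_coordField_comm (hφ : φ ∈ IsManifold.maximalAtlas (𝓡 n) ∞ M)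
    (hx : x ∈ φ.source) (i j : Fin n) :
    leviCivita (coordField φ j) x (coordField φ i x)
      = leviCivita (coordField φ i) x (coordField φ j x) := by
  have h := mlieBracket_eq_leviCivita (smoothFieldAt_coordField hφ hx i).diff
    (smoothFieldAt_coordField hφ hx j).diff
  have h0 : mlieBracket (𝓡 n) (coordField φ i) (coordField φ j) x = 0 := by
    rw [← sum_coord_smul_coordField hφ hx (mlieBracket (𝓡 n) (coordField φ i) (coordField φ j) x)]
    refine Finset.sum_eq_zero fun k _ => ?_
    have h1 {y : M} (hy : y ∈ φ.source) (w : TangentSpace (𝓡 n) y) :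
        mvfderiv (𝓡 n) (fun y => EuclideanSpace.proj (𝕜 := ℝ) k (φ y)) y w
          = coordCovector φ k y w := by
      rw [mvfderiv_comp_chart hφ hy (EuclideanSpace.proj (𝕜 := ℝ) k).differentiableAt,
        ContinuousLinearMap.fderiv]
      rfl
    have h2 (i : Fin n) : (fun y => mvfderiv (𝓡 n) (fun y => EuclideanSpace.proj (𝕜 := ℝ) k (φ y)) y
        (coordField φ i y)) =ᶠ[𝓝 x] fun _ => EuclideanSpace.basisFun (Fin n) ℝ i k := by
      filter_upwards [φ.open_source.mem_nhds hx] with y hy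
      rw [h1 hy]
      exact congrArg (EuclideanSpace.proj (𝕜 := ℝ) k) (mfderiv_coordField hφ hy i)
    have h3 : ContMDiffAt (𝓡 n) 𝓘(ℝ, ℝ) ∞ (fun y => EuclideanSpace.proj (𝕜 := ℝ) k (φ y)) x :=
      (EuclideanSpace.proj (𝕜 := ℝ) k).contDiff.contMDiff.contMDiffAt.comp x
        (contMDiffAt_of_mem_maximalAtlas hφ hx)
    rw [← h1 hx, mvfderiv_mlieBracket_real h3 (smoothFieldAt_coordField hφ hx i)
      (smoothFieldAt_coordField hφ hx j), mvfderiv_congr (h2 i), mvfderiv_congr (h2 j),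
      mvfderiv_const, mvfderiv_const]
    simp
  rw [h0] at h
  exact (sub_eq_zero.1 h.symm)

theorem inner_leviCivita_coordGrad (hφ : φ ∈ IsManifold.maximalAtlas (𝓡 n) ∞ M)
    (hx : x ∈ φ.source) (j l : Fin n) (v : TangentSpace (𝓡 n) x) :
    inner ℝ (leviCivita (coordGrad φ j) x v) (coordField φ l x)
      = -inner ℝ (coordGrad φ j x) (leviCivita (coordField φ l) x v) := by
  have h := mvfderiv_inner (smoothFieldAt_coordGrad hφ hx j).diff
    (smoothFieldAt_coordField hφ hx l).diff v
  have h1 : (fun y => inner ℝ (coordGrad φ j y) (coordField φ l y)) =ᶠ[𝓝 x]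
      fun _ => if j = l then (1 : ℝ) else 0 := by
    filter_upwards [φ.open_source.mem_nhds hx] with y hy
    exact inner_coordGrad_coordField hφ hy j l
  rw [mvfderiv_congr h1, mvfderiv_const] at h
  have h2 : (0 : ℝ) = _ := h
  linarith

theorem mvfderiv_comp_real {P : Type*} [NormedAddCommGroup P] [NormedSpace ℝ P] {F : Type*}
    [NormedAddCommGroup F] [NormedSpace ℝ F] {A : M → P} {d : P → F}
    (hd : DifferentiableAt ℝ d (A x)) (hA : MDifferentiableAt (𝓡 n) 𝓘(ℝ, P) A x)
    (v : TangentSpace (𝓡 n) x) :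
    mvfderiv (𝓡 n) (fun y => d (A y)) x v = fderiv ℝ d (A x) (mvfderiv (𝓡 n) A x v) := by
  have h1 := mfderiv_comp_apply (I := 𝓡 n) (I' := 𝓘(ℝ, P))
    (I'' := 𝓘(ℝ, F)) (f := A) (g := d) x hd.mdifferentiableAt hA v
  rw [mfderiv_eq_fderiv] at h1
  exact h1

theorem contMDiffAt_gram (hφ : φ ∈ IsManifold.maximalAtlas (𝓡 n) ∞ M) (hx : x ∈ φ.source) :
    ContMDiffAt (𝓡 n) 𝓘(ℝ, Fin n → Fin n → ℝ) ∞ (fun y i j => gram φ y i j) x :=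
  contMDiffAt_pi_space.2 fun i => contMDiffAt_pi_space.2 fun j =>
    contMDiffAt_inner (smoothFieldAt_coordField hφ hx i) (smoothFieldAt_coordField hφ hx j) le_rfl

theorem contMDiffAt_sqrt_det_gram (hφ : φ ∈ IsManifold.maximalAtlas (𝓡 n) ∞ M)
    (hx : x ∈ φ.source) : ContMDiffAt (𝓡 n) 𝓘(ℝ, ℝ) ∞ (fun y => √(gram φ y).det) x := by
  have h1 : ContMDiffAt (𝓡 n) 𝓘(ℝ, ℝ) ∞ (fun y => (gram φ y).det) x :=
    (contDiff_det (n := n)).contMDiff.contMDiffAt.comp x (contMDiffAt_gram hφ hx)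
  exact ((Real.contDiffAt_sqrt (gram_det_pos hφ hx).ne').contMDiffAt).comp x h1

/-- The logarithmic derivative of `√(det g)` is a trace of the connection. -/
theorem mvfderiv_sqrt_det_gram (hφ : φ ∈ IsManifold.maximalAtlas (𝓡 n) ∞ M)
    (hx : x ∈ φ.source) (v : TangentSpace (𝓡 n) x) :
    mvfderiv (𝓡 n) (fun y => √(gram φ y).det) x v
      = √(gram φ x).det * ∑ i, inner ℝ (coordGrad φ i x) (leviCivita (coordField φ i) x v) := by
  have hpos := gram_det_pos hφ hx
  have h1 : ContMDiffAt (𝓡 n) 𝓘(ℝ, ℝ) ∞ (fun y => (gram φ y).det) x :=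
    (contDiff_det (n := n)).contMDiff.contMDiffAt.comp x (contMDiffAt_gram hφ hx)
  have h2 := mvfderiv_comp_real (A := fun y => (gram φ y).det) (d := Real.sqrt)
    ((Real.contDiffAt_sqrt (n := 1) hpos.ne').differentiableAt (by simp))
    (h1.mdifferentiableAt (by simp)) v
  have h3 := mvfderiv_comp_real (x := x) (A := fun y i j => gram φ y i j)
    (d := fun A : Fin n → Fin n → ℝ => (Matrix.of A).det)
    (contDiff_det.differentiable (by simp) _)
    ((contMDiffAt_gram hφ hx).mdifferentiableAt (by simp)) v
  have h4 (i j : Fin n) : mvfderiv (𝓡 n) (fun y i j => gram φ y i j) x v i j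
      = inner ℝ (leviCivita (coordField φ i) x v) (coordField φ j x)
        + inner ℝ (coordField φ i x) (leviCivita (coordField φ j) x v) := by
    rw [← mvfderiv_inner (smoothFieldAt_coordField hφ hx i).diff
      (smoothFieldAt_coordField hφ hx j).diff]
    have h5 := mvfderiv_comp_real (x := x) (A := fun y i j => gram φ y i j)
      (d := fun A : Fin n → Fin n → ℝ => A i j) (by fun_prop)
      ((contMDiffAt_gram hφ hx).mdifferentiableAt (by simp)) v
    have h6 : HasFDerivAt (fun A : Fin n → Fin n → ℝ => A i j)
        ((ContinuousLinearMap.proj (R := ℝ) (φ := fun _ : Fin n => ℝ) j).comp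
          (ContinuousLinearMap.proj i)) (fun i j => gram φ x i j) :=
      (((ContinuousLinearMap.proj (R := ℝ) (φ := fun _ : Fin n => ℝ) j).comp
        (ContinuousLinearMap.proj i) : (Fin n → Fin n → ℝ) →L[ℝ] ℝ)).hasFDerivAt
    rw [h6.fderiv] at h5
    exact h5.symm
  rw [fderiv_det (A := fun i j => gram φ x i j) hpos.ne'] at h3
  have h7 : mvfderiv (𝓡 n) (fun y => (gram φ y).det) x v = (gram φ x).det *
      ∑ i, ∑ j, (gram φ x)⁻¹ i j * mvfderiv (𝓡 n) (fun y i j => gram φ y i j) x v j i := h3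
  have h8 (i j : Fin n) : (gram φ x)⁻¹ i j = (gram φ x)⁻¹ j i := by
    have h9 : (gram φ x).transpose = gram φ x := by
      ext i j; exact real_inner_comm (coordField φ i x) (coordField φ j x)
    conv_rhs => rw [← h9]
    rw [← Matrix.transpose_nonsing_inv, Matrix.transpose_apply]
  have h10 : ∑ i, ∑ j, (gram φ x)⁻¹ i j * mvfderiv (𝓡 n) (fun y i j => gram φ y i j) x v j i
      = 2 * ∑ i, inner ℝ (coordGrad φ i x) (leviCivita (coordField φ i) x v) := by
    simp only [h4, mul_add, Finset.sum_add_distrib, coordGrad, sum_inner, inner_smul_left]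
    rw [two_mul]
    congr 1
    · rw [Finset.sum_comm]
      refine Finset.sum_congr rfl fun i _ => Finset.sum_congr rfl fun j _ => ?_
      rw [real_inner_comm]
      rfl
    · refine Finset.sum_congr rfl fun i _ => Finset.sum_congr rfl fun j _ => ?_
      rw [h8]
      rfl
  rw [h2, h7, h10, (Real.hasDerivAt_sqrt hpos.ne').hasFDerivAt.fderiv,
    ContinuousLinearMap.toSpanSingleton_apply, smul_eq_mul]
  have h11 := Real.mul_self_sqrt hpos.le
  have h12 := (Real.sqrt_pos.2 hpos).ne'
  field_simp
  rw [pow_two, h11, mul_comm]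

end CoordGradSmooth

/-! ### The operator `d + δ` in terms of the connection -/

section Dirac

variable {n : ℕ} {M : Type*} [TopologicalSpace M] [ChartedSpace (EuclideanSpace ℝ (Fin n)) M]
  [IsManifold (𝓡 n) ∞ M] [RiemannianBundle (fun x : M => TangentSpace (𝓡 n) x)]
  [IsContMDiffRiemannianBundle (𝓡 n) ∞ (EuclideanSpace ℝ (Fin n))
    (fun x : M => TangentSpace (𝓡 n) x)]
  {η : Π x : M, Form n x} {φ : OpenPartialHomeomorph M (EuclideanSpace ℝ (Fin n))} {x : M}

/-- The derivative at `x`, in the direction `v`, of the components of `η` in the preferred chart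
at `x`. -/
noncomputable def coordDeriv (η : Π x : M, Form n x) (x : M) (v : TangentSpace (𝓡 n) x) :
    Form n x := fun k =>
  (fderiv ℝ (inChart (chartAt (EuclideanSpace ℝ (Fin n)) x) η k)
      (chartAt (EuclideanSpace ℝ (Fin n)) x x)
      (mfderiv (𝓡 n) 𝓘(ℝ, EuclideanSpace ℝ (Fin n)) (chartAt (EuclideanSpace ℝ (Fin n)) x) x
        v)).compContinuousLinearMap
      (mfderiv (𝓡 n) 𝓘(ℝ, EuclideanSpace ℝ (Fin n)) (chartAt (EuclideanSpace ℝ (Fin n)) x) x)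

theorem extD_eq_sum_coordDeriv (η : Π x : M, Form n x) (x : M) :
    extD η x = ∑ j, wedge (coordCovector (chartAt (EuclideanSpace ℝ (Fin n)) x) j x)
      (coordDeriv η x (coordField (chartAt (EuclideanSpace ℝ (Fin n)) x) j x)) := by
  have hφ := IsManifold.chart_mem_maximalAtlas (I := 𝓡 n) (n := ∞) x
  have hx : x ∈ (chartAt (EuclideanSpace ℝ (Fin n)) x).source := mem_chart_source _ x
  refine form_ext fun k w => ?_
  rw [form_sum_apply]
  cases k with
  | zero => simp [wedge_apply_zero, extD]
  | succ k =>
    simp only [wedge_apply_succ]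
    rw [Finset.sum_comm]
    have h1 : extD η x (k + 1) w = ∑ i : Fin (k + 1), (-1 : ℝ) ^ (i : ℕ) •
        coordDeriv η x (w i) k (i.removeNth w) := by
      have := ContinuousAlternatingMap.alternatizeUncurryFin_apply
        (fderiv ℝ (inChart (chartAt (EuclideanSpace ℝ (Fin n)) x) η k)
          (chartAt (EuclideanSpace ℝ (Fin n)) x x))
        (fun a => mfderiv (𝓡 n) 𝓘(ℝ, EuclideanSpace ℝ (Fin n))
          (chartAt (EuclideanSpace ℝ (Fin n)) x) x (w a))
      refine Eq.trans this (Finset.sum_congr rfl fun i _ => ?_)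
      rcases Nat.even_or_odd (i : ℕ) with h1 | h1 <;>
        simp only [h1.neg_one_pow, one_smul, neg_one_smul] <;> rfl
    rw [h1]
    refine Finset.sum_congr rfl fun i _ => ?_
    rw [← Finset.smul_sum]
    congr 1
    let L : TangentSpace (𝓡 n) x →L[ℝ] ℂ := (ContinuousAlternatingMap.apply ℝ
        (EuclideanSpace ℝ (Fin n)) ℂ fun a => mfderiv (𝓡 n) 𝓘(ℝ, EuclideanSpace ℝ (Fin n))
          (chartAt (EuclideanSpace ℝ (Fin n)) x) x (i.removeNth w a)) ∘L
      (fderiv ℝ (inChart (chartAt (EuclideanSpace ℝ (Fin n)) x) η k)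
        (chartAt (EuclideanSpace ℝ (Fin n)) x x)) ∘L
      (mfderiv (𝓡 n) 𝓘(ℝ, EuclideanSpace ℝ (Fin n)) (chartAt (EuclideanSpace ℝ (Fin n)) x) x)
    have hL (v : TangentSpace (𝓡 n) x) : coordDeriv η x v k (i.removeNth w) = L v := rfl
    simp only [hL]
    conv_lhs => rw [← sum_coord_smul_coordField hφ hx (w i)]
    rw [map_sum]
    simp only [map_smul]

/-- The exterior derivative in terms of the connection: since the connection is torsion free, the
Christoffel symbols cancel. -/
theorem extD_eq_sum_formNabla (η : Π x : M, Form n x) (x : M) :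
    extD η x = ∑ j, wedge (coordCovector (chartAt (EuclideanSpace ℝ (Fin n)) x) j x)
      (formNabla η x (coordField (chartAt (EuclideanSpace ℝ (Fin n)) x) j x)) := by
  have hφ := IsManifold.chart_mem_maximalAtlas (I := 𝓡 n) (n := ∞) x
  have hx : x ∈ (chartAt (EuclideanSpace ℝ (Fin n)) x).source := mem_chart_source _ x
  have h1 (v : TangentSpace (𝓡 n) x) : coordDeriv η x v = formNabla η x v
      + ∑ j : Fin n, wedge (coordCovector (chartAt (EuclideanSpace ℝ (Fin n)) x) j x)
        (contract (leviCivita (coordField (chartAt (EuclideanSpace ℝ (Fin n)) x) j) x v) (η x)) :=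
    (sub_add_cancel _ _).symm
  rw [extD_eq_sum_coordDeriv]
  simp only [h1, map_add, map_sum, Finset.sum_add_distrib]
  rw [add_eq_left]
  refine sum_sum_eq_zero_of_antisymm fun i j => ?_
  rw [wedge_wedge, leviCivita_coordField_comm hφ hx]

/-- The density `√(det g) η^♯` evaluates `η` on combinations of the coordinate gradients. -/
theorem raisedDensity_apply (hφ : φ ∈ IsManifold.maximalAtlas (𝓡 n) ∞ M) (hx : x ∈ φ.source)
    (η : Π x : M, Form n x) (k : ℕ) (C : Fin k → EuclideanSpace ℝ (Fin n)) :
    raisedDensity φ η k (φ x) C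
      = √(gram φ x).det • η x k fun a => ∑ j, C a j • coordGrad φ j x := by
  rw [← inChart_mfderiv_apply hφ hx, raisedDensity, φ.left_inv hx]
  refine congrArg (fun w => √(gram φ x).det • inChart φ η k (φ x) w) (funext fun a => ?_)
  simp only [coordGrad, map_sum, map_smul, mfderiv_coordField hφ hx]
  have h : Matrix.toEuclideanCLM (𝕜 := ℝ) (gram φ x)⁻¹ (C a)
      = ∑ j, C a j • ∑ l, (gram φ x)⁻¹ l j • EuclideanSpace.basisFun (Fin n) ℝ l := by
    ext l
    rw [Matrix.ofLp_toEuclideanCLM, Matrix.mulVec, dotProduct]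
    simp [Finset.sum_apply, Pi.single_apply, mul_comm]
  exact h

theorem smoothFieldAt_sum_coordGrad (hφ : φ ∈ IsManifold.maximalAtlas (𝓡 n) ∞ M) (hx : x ∈ φ.source)
    (c : Fin n → ℝ) : SmoothFieldAt (fun y => ∑ j, c j • coordGrad φ j y) x :=
  .sum_section fun j _ => contMDiffAt_const.smul_section (smoothFieldAt_coordGrad hφ hx j)

theorem fderiv_raisedDensity (hη : IsCDiffFormAt 1 η x)
    (hφ : φ ∈ IsManifold.maximalAtlas (𝓡 n) ∞ M) (hx : x ∈ φ.source) (k : ℕ)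
    (C : Fin k → EuclideanSpace ℝ (Fin n)) (i : Fin n) :
    fderiv ℝ (raisedDensity φ η k) (φ x) (EuclideanSpace.basisFun (Fin n) ℝ i) C
      = mvfderiv (𝓡 n)
          (fun y => √(gram φ y).det • η y k fun a => ∑ j, C a j • coordGrad φ j y) x
          (coordField φ i x) := by
  have h0 (C : Fin k → EuclideanSpace ℝ (Fin n)) : ContMDiffAt (𝓡 n) 𝓘(ℝ, ℂ) 1
      (fun y => √(gram φ y).det • η y k fun a => ∑ j, C a j • coordGrad φ j y) x :=
    contMDiffAt_real_smul ((contMDiffAt_sqrt_det_gram hφ hx).of_le (by simp))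
      (hη k (fun a y => ∑ j, C a j • coordGrad φ j y) fun a =>
        smoothFieldAt_sum_coordGrad hφ hx fun j => C a j)
  have h1 : ContDiffAt ℝ 1 (raisedDensity φ η k) (φ x) := by
    refine contDiffAt_of_apply_basisFun fun I => ?_
    have h2 : ContMDiffAt 𝓘(ℝ, EuclideanSpace ℝ (Fin n)) (𝓡 n) 1 φ.symm (φ x) :=
      (contMDiffAt_symm_of_mem_maximalAtlas hφ (φ.map_source hx)).of_le (by simp)
    have h3 := ContMDiffAt.comp_of_eq
      (h0 fun a => EuclideanSpace.basisFun (Fin n) ℝ (I a)) h2 (φ.left_inv hx)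
    refine (contMDiffAt_iff_contDiffAt.1 h3).congr_of_eventuallyEq ?_
    filter_upwards [φ.open_target.mem_nhds (φ.map_source hx)] with z hz
    have := raisedDensity_apply hφ (φ.map_target hz) η k
      fun a => EuclideanSpace.basisFun (Fin n) ℝ (I a)
    rwa [φ.right_inv hz] at this
  have h2 := (h1.differentiableAt (by simp)).hasFDerivAt
  have h3 := (ContinuousAlternatingMap.apply ℝ (EuclideanSpace ℝ (Fin n)) ℂ C).hasFDerivAt.comp _ h2
  have h4 := mvfderiv_comp_chart hφ hx h3.differentiableAt (coordField φ i x)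
  rw [h3.fderiv, mfderiv_coordField hφ hx] at h4
  refine h4.symm.trans ?_
  suffices h : (fun y => (ContinuousAlternatingMap.apply ℝ (EuclideanSpace ℝ (Fin n)) ℂ C ∘
      raisedDensity φ η k) (φ y)) =ᶠ[𝓝 x]
      fun y => √(gram φ y).det • η y k fun a => ∑ j, C a j • coordGrad φ j y by
    rw [mvfderiv_congr h]
  filter_upwards [φ.open_source.mem_nhds hx] with y hy
  exact raisedDensity_apply hφ hy η k C

/-- The codifferential on vectors `w`: lowering indices replaces `w` by its inner products with the
coordinate fields. -/
theorem codiff_apply (η : Π x : M, Form n x) (x : M) (k : ℕ) (w : Fin k → TangentSpace (𝓡 n) x) :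
    codiff η x k w = -(√(gram (chartAt (EuclideanSpace ℝ (Fin n)) x) x).det)⁻¹ • ∑ j : Fin n,
      fderiv ℝ (raisedDensity (chartAt (EuclideanSpace ℝ (Fin n)) x) η (k + 1))
        (chartAt (EuclideanSpace ℝ (Fin n)) x x) (EuclideanSpace.basisFun (Fin n) ℝ j)
        (Fin.cons (EuclideanSpace.basisFun (Fin n) ℝ j) fun a => WithLp.toLp 2 fun l =>
          inner ℝ (w a) (coordField (chartAt (EuclideanSpace ℝ (Fin n)) x) l x)) := by
  have hφ := IsManifold.chart_mem_maximalAtlas (I := 𝓡 n) (n := ∞) x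
  have hx : x ∈ (chartAt (EuclideanSpace ℝ (Fin n)) x).source := mem_chart_source _ x
  have h1 (v : TangentSpace (𝓡 n) x) :
      Matrix.toEuclideanCLM (𝕜 := ℝ) (gram (chartAt (EuclideanSpace ℝ (Fin n)) x) x)
        (mfderiv (𝓡 n) 𝓘(ℝ, EuclideanSpace ℝ (Fin n)) (chartAt (EuclideanSpace ℝ (Fin n)) x) x v)
      = WithLp.toLp 2 fun l =>
          inner ℝ v (coordField (chartAt (EuclideanSpace ℝ (Fin n)) x) l x) := by
    ext l
    refine Eq.trans (b := ∑ i, gram (chartAt (EuclideanSpace ℝ (Fin n)) x) x l i *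
      coordCovector (chartAt (EuclideanSpace ℝ (Fin n)) x) i x v) rfl ?_
    conv_rhs => rw [← sum_coord_smul_coordField hφ hx v]
    simp only [sum_inner, inner_smul_left]
    refine Finset.sum_congr rfl fun i _ => ?_
    rw [mul_comm, real_inner_comm]
    rfl
  simp only [← h1]
  have h2 (s : ℝ) (F : Fin n → EuclideanSpace ℝ (Fin n) [⋀^Fin k]→L[ℝ] ℂ)
      (u : Fin k → EuclideanSpace ℝ (Fin n)) : (s • ∑ j, F j) u = s • ∑ j, F j u := by
    rw [ContinuousAlternatingMap.smul_apply, ContinuousAlternatingMap.sum_apply]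
  exact h2 _ _ _

/-- Equivalently, `∑ j, ∇_(∂_j) (√(det g) grad x^j) = 0`: the inner sum over `i` is the logarithmic
derivative of `√(det g)` in the direction `∂_j`. -/
theorem sum_leviCivita_coordGrad (hφ : φ ∈ IsManifold.maximalAtlas (𝓡 n) ∞ M) (hx : x ∈ φ.source) :
    ∑ j, leviCivita (coordGrad φ j) x (coordField φ j x)
      = -∑ j, (∑ i, inner ℝ (coordGrad φ i x) (leviCivita (coordField φ i) x (coordField φ j x))) •
          coordGrad φ j x := by
  refine eq_of_inner_coordField_eq hφ hx fun l => ?_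
  simp only [sum_inner, inner_neg_left, inner_smul_left, inner_leviCivita_coordGrad hφ hx,
    inner_coordGrad_coordField hφ hx, Finset.sum_neg_distrib]
  simp [leviCivita_coordField_comm hφ hx _ l]

/-- The codifferential in terms of the connection, `δ = -∑ j, ι_(grad x^j) ∇_(∂_j)`. In the
derivative of the density, the derivatives of `√(det g)` and of the contracted coordinate gradients
cancel, and those of the remaining arguments are symmetric Christoffel symbols contracted with an
alternating form. -/
theorem codiff_eq_sum_formNabla (hη : IsCDiffFormAt 1 η x) :
    codiff η x = -∑ j, contract (coordGrad (chartAt (EuclideanSpace ℝ (Fin n)) x) j x)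
      (formNabla η x (coordField (chartAt (EuclideanSpace ℝ (Fin n)) x) j x)) := by
  have hφ := IsManifold.chart_mem_maximalAtlas (I := 𝓡 n) (n := ∞) x
  have hx : x ∈ (chartAt (EuclideanSpace ℝ (Fin n)) x).source := mem_chart_source _ x
  refine form_ext fun k w => ?_
  rw [codiff_apply, form_neg_apply, form_sum_apply]
  generalize chartAt (EuclideanSpace ℝ (Fin n)) x = φ at hφ hx ⊢
  have hs0 : √(gram φ x).det ≠ 0 := (Real.sqrt_pos.2 (gram_det_pos hφ hx)).ne'
  -- the fields with values `w` at `x` and constant components in the coordinate gradients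
  let U (a : Fin k) (y : M) : TangentSpace (𝓡 n) y :=
    ∑ l, inner ℝ (w a) (coordField φ l x) • coordGrad φ l y
  have hU (a : Fin k) : SmoothFieldAt (U a) x := smoothFieldAt_sum_coordGrad hφ hx _
  have hUx : (fun a => U a x) = w := funext fun a => sum_inner_smul_coordGrad hφ hx (w a)
  have hUd (a : Fin k) (v : TangentSpace (𝓡 n) x) : leviCivita (U a) x v
      = ∑ l, inner ℝ (w a) (coordField φ l x) • leviCivita (coordGrad φ l) x v := by
    have h1 (l : Fin n) := (smoothFieldAt_coordGrad hφ hx l).diff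
    simp only [U]
    rw [leviCivita_sum _ (F := fun l y => inner ℝ (w a) (coordField φ l x) • coordGrad φ l y)
      fun l => mdifferentiableAt_const.smul_section (h1 l)]
    simp only [sum_apply]
    refine Finset.sum_congr rfl fun l _ => ?_
    rw [leviCivita_smul (h1 l) mdifferentiableAt_const, mvfderiv_const]
    simp
  have hcons (j : Fin n) :
      (fun a => (Fin.cons (coordGrad φ j) U : Fin (k + 1) → Π x : M, TangentSpace (𝓡 n) x) a x)
        = Fin.cons (coordGrad φ j x) w :=
    funext (Fin.cases rfl fun a => congrFun hUx a)
  have hterm (j : Fin n) :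
      fderiv ℝ (raisedDensity φ η (k + 1)) (φ x) (EuclideanSpace.basisFun (Fin n) ℝ j)
        (Fin.cons (EuclideanSpace.basisFun (Fin n) ℝ j) fun a => WithLp.toLp 2 fun l =>
          inner ℝ (w a) (coordField φ l x))
      = √(gram φ x).det • (contract (coordGrad φ j x) (formNabla η x (coordField φ j x)) k w
        + contract (leviCivita (coordGrad φ j) x (coordField φ j x)
          + (∑ i, inner ℝ (coordGrad φ i x) (leviCivita (coordField φ i) x (coordField φ j x))) •
            coordGrad φ j x) (η x) k w
        + ∑ a, η x (k + 1) (Function.update (Fin.cons (coordGrad φ j x) w) a.succ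
            (leviCivita (U a) x (coordField φ j x)))) := by
    have hfam (y : M) : (fun a => ∑ l, (Fin.cons (EuclideanSpace.basisFun (Fin n) ℝ j)
          fun a => WithLp.toLp 2 fun l => inner ℝ (w a) (coordField φ l x) :
            Fin (k + 1) → EuclideanSpace ℝ (Fin n)) a l • coordGrad φ l y)
        = fun a => (Fin.cons (coordGrad φ j) U : Fin (k + 1) → Π x : M, TangentSpace (𝓡 n) x)
            a y := by
      refine funext (Fin.cases ?_ fun a => rfl)
      simp
    have hX : ∀ a, SmoothFieldAt
        ((Fin.cons (coordGrad φ j) U : Fin (k + 1) → Π x : M, TangentSpace (𝓡 n) x) a) x :=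
      Fin.cases (smoothFieldAt_coordGrad hφ hx j) hU
    have hd := mvfderiv_form_apply hη (k + 1) (fun a => (hX a).one) (coordField φ j x)
    simp only [hcons, Fin.sum_univ_succ, Fin.cons_zero, Fin.cons_succ, Fin.update_cons_zero] at hd
    rw [fderiv_raisedDensity hη hφ hx]
    simp only [hfam]
    rw [mvfderiv_real_smul ((contMDiffAt_sqrt_det_gram hφ hx).mdifferentiableAt (by simp))
      (hη.mdifferentiableAt_apply hX), hd, mvfderiv_sqrt_det_gram hφ hx, hcons, contract_add,
      contract_smul]
    simp only [form_add_apply, form_smul_apply, contract_apply]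
    module
  -- the divergence of the weighted coordinate gradients vanishes
  have hB : ∑ j, contract (leviCivita (coordGrad φ j) x (coordField φ j x)
          + (∑ i, inner ℝ (coordGrad φ i x) (leviCivita (coordField φ i) x (coordField φ j x))) •
            coordGrad φ j x) (η x) k w = 0 := by
    rw [← form_sum_apply, ← contract_sum, Finset.sum_add_distrib, sum_leviCivita_coordGrad hφ hx,
      neg_add_cancel, contract_zero]
    rfl
  -- Expanded in the coordinate gradients, `∇_(∂_j) (U a)` has coefficients symmetric in the two
  -- slots in which the alternating form is evaluated.
  have hC : ∑ j, ∑ a, η x (k + 1) (Function.update (Fin.cons (coordGrad φ j x) w) a.succ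
            (leviCivita (U a) x (coordField φ j x))) = 0 := by
    rw [Finset.sum_comm]
    refine Finset.sum_eq_zero fun a _ => ?_
    have h1 (j : Fin n) := sum_inner_smul_coordGrad hφ hx (leviCivita (U a) x (coordField φ j x))
    conv_lhs =>
      enter [2, j]
      rw [← h1 j, form_update_sum_smul]
    refine sum_symm_smul_antisymm (fun i j => ?_) fun i j => ?_
    · simp only [hUd, sum_inner, inner_smul_left, inner_leviCivita_coordGrad hφ hx]
      simp only [leviCivita_coordField_comm hφ hx i j]
    · have h2 := (η x (k + 1)).toAlternatingMap.map_swap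
        (Function.update (Fin.cons (coordGrad φ j x) w) a.succ (coordGrad φ i x))
        (show (0 : Fin (k + 1)) ≠ a.succ from (Fin.succ_ne_zero a).symm)
      refine Eq.trans (congrArg (η x (k + 1)) ?_) h2
      funext b
      refine Fin.cases ?_ (fun b => ?_) b
      · simp [Function.update_of_ne (Fin.succ_ne_zero a).symm]
      · by_cases hb : b = a
        · subst hb; simp [Function.update_of_ne (Fin.succ_ne_zero b).symm]
        · rw [Function.comp_apply, Equiv.swap_apply_of_ne_of_ne (Fin.succ_ne_zero b)
            (by simpa using hb)]
          simp [hb]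
  simp only [hterm, ← Finset.smul_sum, Finset.sum_add_distrib, hB, hC]
  rw [add_zero, add_zero, neg_smul, smul_smul, inv_mul_cancel₀ hs0, one_smul]

end Dirac

/-! ### Curvature and Clifford multiplication -/

section CliffordAlgebra

variable {A : Type*} [AddCommGroup A] [Module ℝ A] {n : ℕ} {c h : Fin n → A →ₗ[ℝ] A}
  {R : Fin n → Fin n → Fin n → Fin n → ℝ}

theorem sum_rotate {B : Type*} [AddCommMonoid B] (f : Fin n → Fin n → Fin n → B) :
    ∑ i, ∑ j, ∑ k, f j k i = ∑ i, ∑ j, ∑ k, f i j k := by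
  rw [Finset.sum_comm]
  refine Finset.sum_congr rfl fun j _ => ?_
  rw [Finset.sum_comm]

/-- By the cyclic Bianchi identity, only the Ricci part of the curvature survives in the product of
three Clifford multiplications. -/
theorem sum_curvature_clifford_three
    (hc : ∀ i j α, c i (c j α) = -c j (c i α) - (if i = j then (2 : ℝ) else 0) • α)
    {T : Fin n → Fin n → Fin n → ℝ} (hskew : ∀ i j k, T i j k = -T j i k)
    (hcyc : ∀ i j k, T i j k + T j k i + T k i j = 0) (β : A) :
    ∑ i, ∑ j, ∑ k, T i j k • c i (c j (c k β)) = -(2 : ℝ) • ∑ i, ∑ j, T i j j • c i β := by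
  set S := ∑ i, ∑ j, ∑ k, T i j k • c i (c j (c k β)) with hS
  set P := ∑ i, ∑ j, T i j j • c i β with hP
  have hT0 (i k : Fin n) : T i i k = 0 := by linarith [hskew i i k]
  have h1 : ∑ i, ∑ j, ∑ k, T i j k • c k (c i (c j β)) = S + (4 : ℝ) • P := by
    have e1 (i j k : Fin n) : T i j k • c k (c i (c j β)) = T i j k • c i (c j (c k β))
        + (if k = j then (2 * T i j k) • c i β else 0)
        - (if k = i then (2 * T i j k) • c j β else 0) := by
      rw [hc k i, hc k j]
      simp only [map_sub, map_neg, map_smul]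
      split_ifs <;> module
    have e2 : ∑ i, ∑ j, ∑ k, (if k = j then (2 * T i j k) • c i β else 0) = (2 : ℝ) • P := by
      simp [hP, Finset.smul_sum, mul_smul]
    have e3 : ∑ i, ∑ j, ∑ k, (if k = i then (2 * T i j k) • c j β else 0) = -(2 : ℝ) • P := by
      simp only [Finset.sum_ite_eq', Finset.mem_univ, if_true]
      rw [Finset.sum_comm, hP]
      simp only [Finset.smul_sum]
      refine Finset.sum_congr rfl fun i _ => Finset.sum_congr rfl fun j _ => ?_
      rw [hskew]; module
    simp only [e1, Finset.sum_sub_distrib, Finset.sum_add_distrib]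
    rw [e2, e3]
    module
  have h2 : ∑ i, ∑ j, ∑ k, T i j k • c j (c k (c i β)) = S + (2 : ℝ) • P := by
    have e1 (i j k : Fin n) : T i j k • c j (c k (c i β)) = T i j k • c i (c j (c k β))
        + (if i = j then (2 * T i j k) • c k β else 0)
        - (if k = i then (2 * T i j k) • c j β else 0) := by
      rw [hc k i, map_sub, map_neg, hc j i]
      simp only [map_smul, eq_comm (a := j) (b := i)]
      split_ifs <;> module
    have e2 : ∑ i, ∑ j, ∑ k, (if i = j then (2 * T i j k) • c k β else 0) = 0 := by
      refine Finset.sum_eq_zero fun i _ => Finset.sum_eq_zero fun j _ =>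
        Finset.sum_eq_zero fun k _ => ?_
      split_ifs with hij
      · subst hij; simp [hT0]
      · rfl
    have e3 : ∑ i, ∑ j, ∑ k, (if k = i then (2 * T i j k) • c j β else 0) = -(2 : ℝ) • P := by
      simp only [Finset.sum_ite_eq', Finset.mem_univ, if_true]
      rw [Finset.sum_comm, hP]
      simp only [Finset.smul_sum]
      refine Finset.sum_congr rfl fun i _ => Finset.sum_congr rfl fun j _ => ?_
      rw [hskew]; module
    simp only [e1, Finset.sum_sub_distrib, Finset.sum_add_distrib]
    rw [e2, e3]
    module
  -- Summing the cyclic identity against `c i (c j (c k β))` and relabelling gives `S` and the two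
  -- sums above, with total zero. Hence `3 S = -6 P`.
  have h3 : S = -(S + (4 : ℝ) • P) - (S + (2 : ℝ) • P) := by
    rw [← h1, ← h2, ← sum_rotate (fun i j k => T i j k • c k (c i (c j β))),
      sum_rotate (fun i j k => T k i j • c i (c j (c k β)))]
    simp only [hS, ← Finset.sum_neg_distrib, ← Finset.sum_sub_distrib]
    refine Finset.sum_congr rfl fun i _ => Finset.sum_congr rfl fun j _ =>
      Finset.sum_congr rfl fun k _ => ?_
    rw [show T i j k = -T j k i - T k i j by linarith [hcyc i j k]]
    module
  have h4 : (3 : ℝ) • S = -(6 : ℝ) • P := by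
    have h5 := congrArg (fun U => U + (2 : ℝ) • S) h3
    calc (3 : ℝ) • S = S + (2 : ℝ) • S := by module
      _ = -(S + (4 : ℝ) • P) - (S + (2 : ℝ) • P) + (2 : ℝ) • S := h5
      _ = -(6 : ℝ) • P := by module
  calc S = (1 / 3 : ℝ) • ((3 : ℝ) • S) := by module
    _ = -(2 : ℝ) • P := by rw [h4]; module

/-- Only the trace of a symmetric matrix survives contraction with two Clifford multiplications. -/
theorem sum_symm_clifford
    (hc : ∀ i j α, c i (c j α) = -c j (c i α) - (if i = j then (2 : ℝ) else 0) • α)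
    {S : Fin n → Fin n → ℝ} (hS : ∀ i j, S i j = S j i) (α : A) :
    ∑ i, ∑ j, S i j • c i (c j α) = -(∑ i, S i i) • α := by
  have h1 : ∑ i, ∑ j, S i j • (c i (c j α) + (if i = j then (1 : ℝ) else 0) • α) = 0 :=
    sum_symm_smul_antisymm hS fun i j => by
      rw [hc i j]
      simp only [eq_comm (a := i) (b := j)]
      split_ifs <;> module
  simp only [smul_add, Finset.sum_add_distrib] at h1
  rw [eq_neg_of_add_eq_zero_left h1]
  simp [Finset.sum_smul]

/-- The product of four Clifford multiplications against a curvature tensor is scalar. -/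
theorem sum_curvature_clifford_four
    (hc : ∀ i j α, c i (c j α) = -c j (c i α) - (if i = j then (2 : ℝ) else 0) • α)
    (hskew : ∀ i j k l, R i j k l = -R j i k l) (hpair : ∀ i j k l, R i j k l = R k l i j)
    (hcyc : ∀ i j k l, R i j k l + R j k i l + R k i j l = 0) (α : A) :
    ∑ i, ∑ j, ∑ k, ∑ l, R i j k l • c i (c j (c k (c l α)))
      = (2 * ∑ i, ∑ j, R i j j i) • α := by
  have h1 : ∑ i, ∑ j, ∑ k, ∑ l, R i j k l • c i (c j (c k (c l α)))
      = ∑ l, ∑ i, ∑ j, ∑ k, R i j k l • c i (c j (c k (c l α))) := by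
    calc _ = ∑ i, ∑ j, ∑ l, ∑ k, R i j k l • c i (c j (c k (c l α))) :=
          Finset.sum_congr rfl fun i _ => Finset.sum_congr rfl fun j _ => Finset.sum_comm
      _ = ∑ i, ∑ l, ∑ j, ∑ k, R i j k l • c i (c j (c k (c l α))) :=
          Finset.sum_congr rfl fun i _ => Finset.sum_comm
      _ = _ := Finset.sum_comm
  rw [h1]
  simp only [fun l => sum_curvature_clifford_three hc (T := fun i j k => R i j k l)
    (fun i j k => hskew i j k l) (fun i j k => hcyc i j k l) (c l α), ← Finset.smul_sum,
    ← Finset.sum_smul]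
  rw [Finset.sum_comm, sum_symm_clifford hc (S := fun i l => ∑ j, R i j j l)]
  · module
  · intro i l
    refine Finset.sum_congr rfl fun j _ => ?_
    rw [hpair, hskew, hpair, hskew, neg_neg, hpair]

theorem sum_sum_swap_four {B : Type*} [AddCommMonoid B] (f : Fin n → Fin n → Fin n → Fin n → B) :
    ∑ i, ∑ j, ∑ k, ∑ l, f i j k l = ∑ i, ∑ j, ∑ k, ∑ l, f k l i j := by
  have h1 (g : Fin n → Fin n → Fin n → Fin n → B) : ∑ i, ∑ j, ∑ k, ∑ l, g i j k l
      = ∑ p : Fin n × Fin n, ∑ q : Fin n × Fin n, g p.1 p.2 q.1 q.2 := by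
    simp only [Fintype.sum_prod_type]
  rw [h1, h1, Finset.sum_comm]

/-- The algebra of the Weitzenböck formula: `T` stands for the second covariant derivative, `hT` for
the Ricci identity, and `c`, `h` for the two Clifford actions. -/
theorem sum_clifford_hessian
    (hc : ∀ i j α, c i (c j α) = -c j (c i α) - (if i = j then (2 : ℝ) else 0) • α)
    (hch : ∀ i j α, c i (h j α) = -h j (c i α))
    (hskew : ∀ i j k l, R i j k l = -R j i k l) (hpair : ∀ i j k l, R i j k l = R k l i j)
    (hcyc : ∀ i j k l, R i j k l + R j k i l + R k i j l = 0) (α : A) {T : Fin n → Fin n → A}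
    (hT : ∀ i j, T i j - T j i = -∑ k, ∑ l, R i j k l •
      ((1 / 4 : ℝ) • (c k (h l α - c l α) + h k (h l α - c l α)))) :
    ∑ i, ∑ j, c i (c j (T i j)) = -∑ i, T i i
      + (-(1 / 8 : ℝ) • ∑ i, ∑ j, ∑ k, ∑ l, R i j k l • h i (h j (c k (c l α)))
        + (1 / 4 * ∑ i, ∑ j, R i j j i) • α) := by
  have hskew' (i j k l : Fin n) : R i j k l = -R i j l k := by
    rw [hpair, hskew, hpair]
  have hT' (i j : Fin n) : T i j - T j i = -(1 / 4 : ℝ) • ∑ k, ∑ l, R i j k l •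
      (h k (h l α) - c k (c l α)) := by
    -- The mixed products are symmetric in `k` and `l`, since `c` and `h` anticommute.
    have h7 : ∑ k, ∑ l, R i j k l • (c k (h l α) - h k (c l α)) = 0 := by
      refine sum_sum_eq_zero_of_antisymm fun k l => ?_
      rw [hskew', hch, hch]
      module
    have h8 (k l : Fin n) :
        R i j k l • ((1 / 4 : ℝ) • (c k (h l α - c l α) + h k (h l α - c l α)))
          = (1 / 4 : ℝ) • (R i j k l • (h k (h l α) - c k (c l α))
            + R i j k l • (c k (h l α) - h k (c l α))) := by
      simp only [map_sub]
      module
    rw [hT]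
    simp only [h8, ← Finset.smul_sum, Finset.sum_add_distrib]
    rw [h7]
    module
  set Q := ∑ i, ∑ j, c i (c j (T i j)) with hQ
  have h1 : Q = -∑ i, ∑ j, c i (c j (T j i)) - (2 : ℝ) • ∑ i, T i i := by
    have e (i j : Fin n) : c i (c j (T i j))
        = -c j (c i (T i j)) - if i = j then (2 : ℝ) • T i j else 0 := by
      rw [hc]
      split_ifs <;> module
    rw [Finset.sum_comm, hQ]
    simp only [e, Finset.sum_sub_distrib, Finset.sum_neg_distrib, Finset.sum_ite_eq,
      Finset.mem_univ, if_true, Finset.smul_sum]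
  have h2 : ∑ i, ∑ j, c i (c j (T i j)) - ∑ i, ∑ j, c i (c j (T j i))
      = -(1 / 4 : ℝ) • ∑ i, ∑ j, ∑ k, ∑ l, R i j k l • h i (h j (c k (c l α)))
        + (1 / 2 * ∑ i, ∑ j, R i j j i) • α := by
    have h3 : ∑ i, ∑ j, ∑ k, ∑ l, R i j k l • c i (c j (h k (h l α)))
        = ∑ i, ∑ j, ∑ k, ∑ l, R i j k l • h i (h j (c k (c l α))) := by
      rw [sum_sum_swap_four]
      simp only [hch, map_neg, neg_neg]
      refine Finset.sum_congr rfl fun i _ => Finset.sum_congr rfl fun j _ =>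
        Finset.sum_congr rfl fun k _ => Finset.sum_congr rfl fun l _ => ?_
      rw [hpair]
    have h4 := sum_curvature_clifford_four hc hskew hpair hcyc α
    have e (i j : Fin n) : c i (c j (T i j)) - c i (c j (T j i))
        = -(1 / 4 : ℝ) • (∑ k, ∑ l, R i j k l • c i (c j (h k (h l α)))
          - ∑ k, ∑ l, R i j k l • c i (c j (c k (c l α)))) := by
      rw [← map_sub, ← map_sub, hT']
      simp only [map_smul, map_sum, map_sub, smul_sub, Finset.sum_sub_distrib]
    simp only [← Finset.sum_sub_distrib, e]
    simp only [← Finset.smul_sum, Finset.sum_sub_distrib]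
    rw [h3, h4]
    module
  rw [← hQ] at h2
  have h5 : (2 : ℝ) • Q = -(2 : ℝ) • ∑ i, T i i + (-(1 / 4 : ℝ) • ∑ i, ∑ j, ∑ k, ∑ l,
      R i j k l • h i (h j (c k (c l α))) + (1 / 2 * ∑ i, ∑ j, R i j j i) • α) := by
    rw [← h2]
    have h6 := congrArg (fun U => U + Q) h1
    calc (2 : ℝ) • Q = Q + Q := two_smul _ _
      _ = -∑ i, ∑ j, c i (c j (T j i)) - (2 : ℝ) • ∑ i, T i i + Q := h6
      _ = _ := by module
  calc Q = (1 / 2 : ℝ) • ((2 : ℝ) • Q) := by module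
    _ = _ := by rw [h5]; module

end CliffordAlgebra

section DiracFormula

variable {n : ℕ} {M : Type*} [TopologicalSpace M] [ChartedSpace (EuclideanSpace ℝ (Fin n)) M]
  [IsManifold (𝓡 n) ∞ M] [RiemannianBundle (fun x : M => TangentSpace (𝓡 n) x)]
  [IsContMDiffRiemannianBundle (𝓡 n) ∞ (EuclideanSpace ℝ (Fin n))
    (fun x : M => TangentSpace (𝓡 n) x)]
  {η : Π x : M, Form n x} {X Y : Π x : M, TangentSpace (𝓡 n) x}
  {e : Fin n → Π x : M, TangentSpace (𝓡 n) x} {U : Set M} {x : M}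

/-- `D = ∑ c(e_q) ∇_(e_q)` for every orthonormal basis of the tangent space. -/
theorem hodgeD_eq_sum_cliff (hη : IsCDiffFormAt 1 η x) {v : Fin n → TangentSpace (𝓡 n) x}
    (hv : Orthonormal ℝ v) : hodgeD η x = ∑ q, cliff (v q) (formNabla η x (v q)) := by
  have hφ := IsManifold.chart_mem_maximalAtlas (I := 𝓡 n) (n := ∞) x
  have hx : x ∈ (chartAt (EuclideanSpace ℝ (Fin n)) x).source := mem_chart_source _ x
  let B : TangentSpace (𝓡 n) x →ₗ[ℝ] TangentSpace (𝓡 n) x →ₗ[ℝ] Form n x :=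
    LinearMap.mk₂ ℝ (fun u w => cliff u (formNabla η x w))
      (fun u u' w => cliff_add u u' _) (fun a u w => cliff_smul a u _)
      (fun u w w' => by rw [formNabla_add_dir hη, map_add])
      (fun a u w => by rw [formNabla_smul_dir hη, map_real_smul])
  refine Eq.trans ?_ (sum_coordField_coordGrad hφ hx B hv)
  rw [hodgeD, extD_eq_sum_formNabla, codiff_eq_sum_formNabla hη, ← sub_eq_add_neg,
    ← Finset.sum_sub_distrib]
  refine Finset.sum_congr rfl fun j _ => ?_
  rw [← innerSL_coordGrad hφ hx]
  rfl

theorem IsCDiffFormAt.hodgeD (hη : IsCDiffFormAt ∞ η x) :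
    IsCDiffFormAt ∞ (RiemannianForms.hodgeD η) x := by
  obtain ⟨e, U, he, hx⟩ := exists_isOrthonormalFrameOn (n := n) x
  have h1 : IsCDiffFormAt ∞ (fun y => ∑ q, RiemannianForms.cliff (e q y)
      (RiemannianForms.formNabla η y (e q y))) x :=
    .sum _ fun q => (hη.formNabla (he.smoothAt hx q)).cliff le_rfl (he.smoothAt hx q)
  refine h1.congr ?_
  filter_upwards [hη.eventually_one, he.isOpen.mem_nhds hx] with y hy hyU
  exact hodgeD_eq_sum_cliff hy (he.orthonormal y hyU)

/-- The second covariant derivative `∇_X ∇_Y η - ∇_(∇_X Y) η`. -/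
noncomputable def formHessian (η : Π x : M, Form n x) (X Y : Π x : M, TangentSpace (𝓡 n) x)
    (x : M) : Form n x :=
  formNabla (fun y => formNabla η y (Y y)) x (X x) - formNabla η x (leviCivita Y x (X x))

/-- The connection matrix of an orthonormal frame is skew-symmetric. -/
theorem inner_leviCivita_frame_skew (he : IsOrthonormalFrameOn e U) (hx : x ∈ U)
    (v : TangentSpace (𝓡 n) x) (j l : Fin n) :
    inner ℝ (e l x) (leviCivita (e j) x v) = -inner ℝ (e j x) (leviCivita (e l) x v) := by
  have h := mvfderiv_inner (he.smoothAt hx j).diff (he.smoothAt hx l).diff v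
  have h1 : (fun y => inner ℝ (e j y) (e l y)) =ᶠ[𝓝 x]
      fun _ => if j = l then (1 : ℝ) else 0 := by
    filter_upwards [he.isOpen.mem_nhds hx] with y hy
    exact orthonormal_iff_ite.1 (he.orthonormal y hy) j l
  rw [mvfderiv_congr h1, mvfderiv_const] at h
  have h2 : (0 : ℝ) = _ := h
  rw [real_inner_comm (e l x)] at h2
  linarith

/-- The derivatives of the frame cancel in `D²`, by metric compatibility. -/
theorem hodgeD_hodgeD_eq_sum_formHessian (hη : IsCDiffFormAt ∞ η x)
    (he : IsOrthonormalFrameOn e U) (hx : x ∈ U) :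
    hodgeD (hodgeD η) x
      = ∑ i, ∑ j, cliff (e i x) (cliff (e j x) (formHessian η (e i) (e j) x)) := by
  have hη1 := hη.of_le (show (1 : ℕ∞ω) ≤ ∞ by simp)
  have hnj (j : Fin n) : IsCDiffFormAt 1 (fun y => formNabla η y (e j y)) x :=
    (hη.formNabla (he.smoothAt hx j)).of_le (by simp)
  have h1 : IsCDiffFormAt 1 (fun y => ∑ q, cliff (e q y) (formNabla η y (e q y))) x :=
    .sum _ fun q => (hnj q).cliff (by simp) (he.smoothAt hx q)
  rw [hodgeD_eq_sum_cliff (hη.hodgeD.of_le (by simp)) (he.orthonormal x hx)]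
  refine Finset.sum_congr rfl fun i _ => ?_
  rw [formNabla_congr h1, formNabla_sum _ fun q => (hnj q).cliff (by simp) (he.smoothAt hx q),
    ← map_sum]
  · congr 1
    simp only [formNabla_cliff (hnj _) (he.smoothAt hx _), formHessian, map_sub,
      Finset.sum_add_distrib, Finset.sum_sub_distrib]
    rw [add_comm, sub_eq_add_neg]
    congr 1
    have hexp (j : Fin n) := (sum_inner_smul (he.orthonormal x hx)
      (leviCivita (e j) x (e i x))).symm
    have e1 (j : Fin n) : cliff (leviCivita (e j) x (e i x)) (formNabla η x (e j x))
        = ∑ l, inner ℝ (e l x) (leviCivita (e j) x (e i x)) •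
            cliff (e l x) (formNabla η x (e j x)) := by
      conv_lhs => rw [hexp j]
      rw [cliff_sum_smul]
    have e2 (j : Fin n) : cliff (e j x) (formNabla η x (leviCivita (e j) x (e i x)))
        = ∑ l, inner ℝ (e l x) (leviCivita (e j) x (e i x)) •
            cliff (e j x) (formNabla η x (e l x)) := by
      conv_lhs => rw [hexp j, formNabla_sum_dir hη1, map_sum]
      simp only [map_real_smul]
    simp only [e1, e2]
    rw [Finset.sum_comm, ← Finset.sum_neg_distrib]
    refine Finset.sum_congr rfl fun l _ => ?_
    rw [← Finset.sum_neg_distrib]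
    refine Finset.sum_congr rfl fun j _ => ?_
    rw [inner_leviCivita_frame_skew he hx]
    module
  · filter_upwards [hη.eventually_one, he.isOpen.mem_nhds hx] with y hy hyU
    exact hodgeD_eq_sum_cliff hy (he.orthonormal y hyU)

end DiracFormula

/-! ### The curvature of the connection on forms -/

section FormCurvature

variable {n : ℕ} {M : Type*} [TopologicalSpace M] [ChartedSpace (EuclideanSpace ℝ (Fin n)) M]
  [IsManifold (𝓡 n) ∞ M] [RiemannianBundle (fun x : M => TangentSpace (𝓡 n) x)]
  [IsContMDiffRiemannianBundle (𝓡 n) ∞ (EuclideanSpace ℝ (Fin n))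
    (fun x : M => TangentSpace (𝓡 n) x)]
  {η : Π x : M, Form n x} {X Y : Π x : M, TangentSpace (𝓡 n) x}
  {e : Fin n → Π x : M, TangentSpace (𝓡 n) x} {U : Set M} {x : M}

theorem mvfderiv_mlieBracket_complex {f : M → ℂ} (hf : ContMDiffAt (𝓡 n) 𝓘(ℝ, ℂ) ∞ f x)
    (hX : SmoothFieldAt X x) (hY : SmoothFieldAt Y x) :
    mvfderiv (𝓡 n) f x (mlieBracket (𝓡 n) X Y x)
      = mvfderiv (𝓡 n) (fun y => mvfderiv (𝓡 n) f y (Y y)) x (X x)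
        - mvfderiv (𝓡 n) (fun y => mvfderiv (𝓡 n) f y (X y)) x (Y x) := by
  have key (L : ℂ →L[ℝ] ℝ) : L (mvfderiv (𝓡 n) f x (mlieBracket (𝓡 n) X Y x))
      = L (mvfderiv (𝓡 n) (fun y => mvfderiv (𝓡 n) f y (Y y)) x (X x)
        - mvfderiv (𝓡 n) (fun y => mvfderiv (𝓡 n) f y (X y)) x (Y x)) := by
    have h0 {g : M → ℂ} {y : M} (hg : MDifferentiableAt (𝓡 n) 𝓘(ℝ, ℂ) g y)
        (v : TangentSpace (𝓡 n) y) :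
        mvfderiv (𝓡 n) (fun z => L (g z)) y v = L (mvfderiv (𝓡 n) g y v) := by
      rw [mvfderiv_comp_real L.differentiableAt hg, L.fderiv]
    have h1 {Z : Π x : M, TangentSpace (𝓡 n) x} (hZ : SmoothFieldAt Z x)
        (v : TangentSpace (𝓡 n) x) :
        mvfderiv (𝓡 n) (fun y => mvfderiv (𝓡 n) (fun z => L (f z)) y (Z y)) x v
          = L (mvfderiv (𝓡 n) (fun y => mvfderiv (𝓡 n) f y (Z y)) x v) := by
      rw [← h0 ((contMDiffAt_mvfderiv_apply le_rfl hf hZ).mdifferentiableAt (by simp))]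
      suffices h : (fun y => mvfderiv (𝓡 n) (fun z => L (f z)) y (Z y)) =ᶠ[𝓝 x]
          fun y => L (mvfderiv (𝓡 n) f y (Z y)) by rw [mvfderiv_congr h]
      filter_upwards [eventually_mdifferentiableAt hf] with y hy
      exact h0 hy _
    have h2 := mvfderiv_mlieBracket_real (L.contDiff.contMDiff.contMDiffAt.comp x hf) hX hY
    rw [map_sub, ← h1 hX, ← h1 hY, ← h0 (hf.mdifferentiableAt (by simp))]
    exact h2
  exact Complex.ext (key Complex.reCLM) (key Complex.imCLM)

/-- The iterated covariant derivative of a form on fields `W` that are parallel at `x`. -/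
theorem formNabla_formNabla_apply (hη : IsCDiffFormAt ∞ η x)
    (hY : SmoothFieldAt Y x) {k : ℕ} {W : Fin k → Π x : M, TangentSpace (𝓡 n) x}
    (hW : ∀ a, SmoothFieldAt (W a) x) (hW0 : ∀ a, leviCivita (W a) x = 0) :
    formNabla (fun y => formNabla η y (Y y)) x (X x) k (fun a => W a x)
      = mvfderiv (𝓡 n) (fun y => mvfderiv (𝓡 n) (fun z => η z k fun a => W a z) y (Y y)) x (X x)
        - ∑ a, η x k (Function.update (fun a => W a x) a
            (leviCivita (fun y => leviCivita (W a) y (Y y)) x (X x))) := by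
  have hη1 := hη.of_le (show (1 : ℕ∞ω) ≤ ∞ by simp)
  rw [formNabla_apply_of_parallel ((hη.formNabla hY).of_le (by simp)) hW hW0]
  -- Near `x` the Leibniz rule has a correction term for each slot. Differentiating it at `x`, only
  -- the slot that is already differentiated contributes, as the other fields are parallel there.
  have hW' (a : Fin k) : ∀ b, SmoothFieldAt
      (Function.update W a (fun y => leviCivita (W a) y (Y y)) b) x := fun b => by
    by_cases hb : b = a
    · subst hb; simpa using SmoothFieldAt.nabla (hW b) hY
    · simpa [hb] using hW b
  have h1 (a : Fin k) : ContMDiffAt (𝓡 n) 𝓘(ℝ, ℂ) ∞ (fun y => η y k fun b =>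
      Function.update W a (fun y => leviCivita (W a) y (Y y)) b y) x := hη k _ (hW' a)
  have h2 : ContMDiffAt (𝓡 n) 𝓘(ℝ, ℂ) ∞
      (fun y => mvfderiv (𝓡 n) (fun z => η z k fun a => W a z) y (Y y)) x :=
    contMDiffAt_mvfderiv_apply le_rfl (hη k W hW) hY
  have h3 : (fun y => formNabla η y (Y y) k fun a => W a y) =ᶠ[𝓝 x] fun y =>
      mvfderiv (𝓡 n) (fun z => η z k fun a => W a z) y (Y y) - ∑ a, η y k fun b =>
        Function.update W a (fun y => leviCivita (W a) y (Y y)) b y := by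
    have h2 : ∀ᶠ y in 𝓝 x, ∀ a, ContMDiffAt (𝓡 n) (𝓡 n).tangent 1 (T% (W a)) y :=
      Filter.eventually_all.2 fun a => ((contMDiffAt_iff_contMDiffAt_nhds (by simp)).1
        (SmoothFieldAt.one (hW a)))
    filter_upwards [hη.eventually_one, h2] with y hy1 hy2
    rw [mvfderiv_form_apply hy1 k hy2, eq_sub_iff_add_eq]
    congr 1
    refine Finset.sum_congr rfl fun a _ => congrArg (η y k) (funext fun b => ?_)
    by_cases hb : b = a
    · subst hb; simp
    · simp [hb]
  rw [mvfderiv_congr h3]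
  have h4 := mvfderiv_fun_sub (h2.mdifferentiableAt (by simp))
    ((contMDiffAt_finsetSum (t := Finset.univ) fun a _ => h1 a).mdifferentiableAt (by simp))
  refine (congr($h4 (X x))).trans ?_
  rw [sub_apply, mvfderiv_fun_sum _ fun a => (h1 a).of_le (by simp)]
  congr 1
  refine Finset.sum_congr rfl fun a _ => ?_
  rw [mvfderiv_form_apply hη1 k fun b => (hW' a b).one, Finset.sum_eq_single a]
  · rw [(formNabla η x (X x) k).map_coord_zero a (by simp [hW0 a]), zero_add]
    refine congrArg (η x k) (funext fun b => ?_)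
    by_cases hb : b = a
    · subst hb; simp
    · simp [hb]
  · intro b _ hb
    refine (η x k).map_coord_zero b ?_
    simp [hb, hW0 b]
  · simp

/-- The curvature of the connection on forms is induced by the Riemann curvature. -/
theorem formHessian_sub_formHessian (hη : IsCDiffFormAt ∞ η x) (hX : SmoothFieldAt X x)
    (hY : SmoothFieldAt Y x) (he : IsOrthonormalFrameOn e U) (hx : x ∈ U) :
    formHessian η X Y x - formHessian η Y X x
      = -∑ k, wedge (innerSL ℝ (e k x)) (contract (curvature X Y (e k) x) (η x)) := by
  have hη1 := hη.of_le (show (1 : ℕ∞ω) ≤ ∞ by simp)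
  have h0 : formHessian η X Y x - formHessian η Y X x
      = formNabla (fun y => formNabla η y (Y y)) x (X x)
        - formNabla (fun y => formNabla η y (X y)) x (Y x)
        - formNabla η x (mlieBracket (𝓡 n) X Y x) := by
    have h1 : formNabla η x (mlieBracket (𝓡 n) X Y x) = formNabla η x (leviCivita Y x (X x))
        - formNabla η x (leviCivita X x (Y x)) := by
      rw [mlieBracket_eq_leviCivita hX.diff hY.diff]
      exact map_sub (formNablaLinear hη1) _ _
    rw [h1, formHessian, formHessian]
    abel
  rw [h0]
  refine form_ext fun k w => ?_
  obtain ⟨W, hW, rfl, hW0⟩ := exists_parallel_family w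
  rw [form_sub_apply, form_sub_apply, form_neg_apply, form_sum_apply,
    formNabla_formNabla_apply hη hY hW hW0, formNabla_formNabla_apply hη hX hW hW0,
    formNabla_apply_of_parallel hη1 hW hW0, mvfderiv_mlieBracket_complex (hη k W hW) hX hY]
  simp only [wedge_contract_apply, innerSL_apply_apply]
  rw [Finset.sum_comm]
  have h1 (a : Fin k) : ∑ i, inner ℝ (e i x) (W a x) • η x k (Function.update (fun a => W a x) a
      (curvature X Y (e i) x)) = η x k (Function.update (fun a => W a x) a
        (leviCivita (fun y => leviCivita (W a) y (Y y)) x (X x)))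
      - η x k (Function.update (fun a => W a x) a
        (leviCivita (fun y => leviCivita (W a) y (X y)) x (Y x))) := by
    rw [← form_update_sum_smul, ← he.curvature_eq hx hX hY (hW a), curvature, hW0 a,
      zero_apply, sub_zero, ContinuousAlternatingMap.map_update_sub]
  simp only [h1, Finset.sum_sub_distrib]
  abel

end FormCurvature

/-! ### The Weitzenböck formula -/

section Weitzenbock

variable {n : ℕ} {M : Type*} [TopologicalSpace M] [ChartedSpace (EuclideanSpace ℝ (Fin n)) M]
  [IsManifold (𝓡 n) ∞ M] [RiemannianBundle (fun x : M => TangentSpace (𝓡 n) x)]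
  [IsContMDiffRiemannianBundle (𝓡 n) ∞ (EuclideanSpace ℝ (Fin n))
    (fun x : M => TangentSpace (𝓡 n) x)]
  {η : Π x : M, Form n x} {X Y : Π x : M, TangentSpace (𝓡 n) x}
  {e : Fin n → Π x : M, TangentSpace (𝓡 n) x} {U : Set M} {x : M}

theorem weitzenbock_apply (e : Fin n → Π x : M, TangentSpace (𝓡 n) x) (x : M) (α : Form n x) :
    weitzenbock e x α = -(1 / 8 : ℝ) • ∑ i, ∑ j, ∑ k, ∑ l, riem e x i j k l •
        cliffHat (e i x) (cliffHat (e j x) (cliff (e k x) (cliff (e l x) α)))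
      + (1 / 4 * ∑ i, ∑ j, riem e x i j j i) • α := by
  simp only [weitzenbock, scalarCurvature, LinearMap.add_apply, LinearMap.smul_apply,
    LinearMap.sum_apply, Module.End.mul_apply, Module.End.one_apply]

/-- The action `u^* ∧ ι_w` of a rank one endomorphism on forms, in terms of the Clifford actions. -/
theorem wedge_contract_eq_clifford (u w : TangentSpace (𝓡 n) x) (α : Form n x) :
    wedge (innerSL ℝ u) (contract w α) = (1 / 4 : ℝ) • (cliff u (cliffHat w α - cliff w α)
      + cliffHat u (cliffHat w α - cliff w α)) := by
  have h : cliffHat w α - cliff w α = (2 : ℝ) • contract w α := by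
    rw [cliffHat_apply, cliff_apply]; module
  rw [h, map_real_smul, map_real_smul, cliffHat_apply, cliff_apply]
  module

/-- The Weitzenböck formula for `(d + δ)²`. -/
theorem hodgeD_hodgeD_eq (hη : IsCDiffFormAt ∞ η x) (he : IsOrthonormalFrameOn e U) (hx : x ∈ U) :
    hodgeD (hodgeD η) x = -∑ i, formHessian η (e i) (e i) x + weitzenbock e x (η x) := by
  have hs := he.smoothAt hx
  rw [hodgeD_hodgeD_eq_sum_formHessian hη he hx, weitzenbock_apply]
  refine sum_clifford_hessian (c := fun i => (cliff (e i x)).restrictScalars ℝ)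
    (h := fun i => (cliffHat (e i x)).restrictScalars ℝ) (R := riem e x) (α := η x)
    (T := fun i j => formHessian η (e i) (e j) x) ?_ ?_ ?_ ?_ ?_ ?_
  · intro i j α
    have h := orthonormal_iff_ite.1 (he.orthonormal x hx) i j
    refine (cliff_cliff (e i x) (e j x) α).trans ?_
    rw [h, show (2 * if i = j then (1 : ℝ) else 0) = if i = j then 2 else 0 by split_ifs <;> simp]
    rfl
  · exact fun i j α => cliff_cliffHat (e i x) (e j x) α
  · intro i j k l
    rw [riem, riem, curvature_swap, inner_neg_left]
  · exact fun i j k l => inner_curvature_pair (hs i) (hs j) (hs k) (hs l)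
  · intro i j k l
    rw [riem, riem, riem, ← inner_add_left, ← inner_add_left,
      curvature_cyclic (hs i) (hs j) (hs k), inner_zero_left]
  · intro i j
    rw [formHessian_sub_formHessian hη (hs i) (hs j) he hx]
    congr 1
    refine Finset.sum_congr rfl fun k _ => ?_
    have h1 : curvature (e i) (e j) (e k) x = ∑ l, riem e x i j k l • e l x := by
      rw [← sum_inner_smul (he.orthonormal x hx) (curvature (e i) (e j) (e k) x)]
      refine Finset.sum_congr rfl fun l _ => ?_
      rw [real_inner_comm]
      rfl
    rw [h1, contract_sum, map_sum]
    refine Finset.sum_congr rfl fun l _ => ?_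
    rw [contract_smul, map_real_smul, wedge_contract_eq_clifford]
    rfl

/-- The second covariant derivative is tensorial. -/
theorem formHessian_eq_sum (hη : IsCDiffFormAt ∞ η x) (hY : SmoothFieldAt Y x)
    (he : IsOrthonormalFrameOn e U) (hx : x ∈ U) :
    formHessian η X Y x = ∑ q, ∑ p, (inner ℝ (e q x) (Y x) * inner ℝ (e p x) (X x)) •
      formHessian η (e p) (e q) x := by
  have hη1 := hη.of_le (show (1 : ℕ∞ω) ≤ ∞ by simp)
  have hf (q : Fin n) : ContMDiffAt (𝓡 n) 𝓘(ℝ, ℝ) ∞ (fun y => inner ℝ (e q y) (Y y)) x :=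
    contMDiffAt_inner (he.smoothAt hx q) hY le_rfl
  have hnq (q : Fin n) : IsCDiffFormAt 1 (fun y => formNabla η y (e q y)) x :=
    (hη.formNabla (he.smoothAt hx q)).of_le (by simp)
  have hfn (q : Fin n) : IsCDiffFormAt 1
      (fun y => inner ℝ (e q y) (Y y) • formNabla η y (e q y)) x :=
    IsCDiffFormAt.smul ((hf q).of_le (by simp)) (hnq q)
  have h1 : formNabla (fun y => formNabla η y (Y y)) x (X x)
      = ∑ q, (inner ℝ (e q x) (Y x) • formNabla (fun y => formNabla η y (e q y)) x (X x)
        + mvfderiv (𝓡 n) (fun y => inner ℝ (e q y) (Y y)) x (X x) • formNabla η x (e q x)) := by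
    rw [formNabla_congr (.sum Finset.univ hfn), formNabla_sum _ hfn]
    · exact Finset.sum_congr rfl fun q _ => formNabla_smul ((hf q).of_le (by simp)) (hnq q) _
    · filter_upwards [hη.eventually_one, he.isOpen.mem_nhds hx] with y hy hyU
      conv_lhs => rw [← sum_inner_smul (he.orthonormal y hyU) (Y y)]
      rw [formNabla_sum_dir hy]
  have h2 : leviCivita Y x (X x) = ∑ q, (inner ℝ (e q x) (Y x) • leviCivita (e q) x (X x)
        + mvfderiv (𝓡 n) (fun y => inner ℝ (e q y) (Y y)) x (X x) • e q x) := by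
    rw [leviCivita_congr (Y := fun y => ∑ q, inner ℝ (e q y) (Y y) • e q y) hY.diff,
      leviCivita_sum _ (F := fun q y => inner ℝ (e q y) (Y y) • e q y)
        fun q => ((hf q).mdifferentiableAt (by simp)).smul_section (he.smoothAt hx q).diff]
    · simp only [sum_apply]
      exact Finset.sum_congr rfl fun q _ => leviCivita_smul (he.smoothAt hx q).diff
        ((hf q).mdifferentiableAt (by simp)) _
    · filter_upwards [he.isOpen.mem_nhds hx] with y hyU
      exact (sum_inner_smul (he.orthonormal y hyU) (Y y)).symm
  have h3 : formNabla η x (leviCivita Y x (X x))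
      = ∑ q, (inner ℝ (e q x) (Y x) • formNabla η x (leviCivita (e q) x (X x))
        + mvfderiv (𝓡 n) (fun y => inner ℝ (e q y) (Y y)) x (X x) • formNabla η x (e q x)) := by
    rw [h2]
    change formNablaLinear hη1 _ = _
    simp only [map_sum, map_add, map_smul]
    rfl
  rw [formHessian, h1, h3, ← Finset.sum_sub_distrib]
  refine Finset.sum_congr rfl fun q _ => ?_
  have h4 : formHessian η X (e q) x = ∑ p, inner ℝ (e p x) (X x) • formHessian η (e p) (e q) x := by
    have h5 := (sum_inner_smul (he.orthonormal x hx) (X x)).symm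
    have h6 : formNabla (fun y => formNabla η y (e q y)) x (X x) = ∑ p, inner ℝ (e p x) (X x) •
        formNabla (fun y => formNabla η y (e q y)) x (e p x) := by
      conv_lhs => rw [h5]
      rw [formNabla_sum_dir (hnq q)]
    have h7 : formNabla η x (leviCivita (e q) x (X x)) = ∑ p, inner ℝ (e p x) (X x) •
        formNabla η x (leviCivita (e q) x (e p x)) := by
      conv_lhs => rw [h5, map_sum]
      simp only [map_smul]
      rw [formNabla_sum_dir hη1]
    rw [formHessian, h6, h7, ← Finset.sum_sub_distrib]
    refine Finset.sum_congr rfl fun p _ => ?_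
    rw [formHessian]
    module
  simp only [mul_smul, ← Finset.smul_sum]
  rw [← h4, formHessian]
  module

/-- Tracing a bilinear map with the inverse metric in coordinates. -/
theorem sum_gram_inv_smul {φ : OpenPartialHomeomorph M (EuclideanSpace ℝ (Fin n))}
    (hφ : φ ∈ IsManifold.maximalAtlas (𝓡 n) ∞ M) (hx : x ∈ φ.source)
    {A : Type*} [AddCommGroup A] [Module ℝ A]
    (B : TangentSpace (𝓡 n) x →ₗ[ℝ] TangentSpace (𝓡 n) x →ₗ[ℝ] A)
    {v : Fin n → TangentSpace (𝓡 n) x} (hv : Orthonormal ℝ v) :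
    ∑ i, ∑ j, (gram φ x)⁻¹ i j • B (coordField φ i x) (coordField φ j x) = ∑ q, B (v q) (v q) := by
  rw [← sum_coordField_coordGrad hφ hx B hv, Finset.sum_comm]
  refine Finset.sum_congr rfl fun j _ => ?_
  rw [coordGrad, map_sum, LinearMap.sum_apply]
  simp only [map_smul, LinearMap.smul_apply]

/-- Tensoriality of the second covariant derivative allows its coordinate trace to be computed in a
frame. -/
theorem sum_gram_inv_smul_formHessian (hη : IsCDiffFormAt ∞ η x)
    {φ : OpenPartialHomeomorph M (EuclideanSpace ℝ (Fin n))}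
    (hφ : φ ∈ IsManifold.maximalAtlas (𝓡 n) ∞ M) (hxφ : x ∈ φ.source)
    (he : IsOrthonormalFrameOn e U) (hx : x ∈ U) :
    ∑ i, ∑ j, (gram φ x)⁻¹ i j • formHessian η (coordField φ i) (coordField φ j) x
      = ∑ i, formHessian η (e i) (e i) x := by
  -- the second covariant derivative as a bilinear map on the tangent space
  let B : TangentSpace (𝓡 n) x →ₗ[ℝ] TangentSpace (𝓡 n) x →ₗ[ℝ] Form n x :=
    LinearMap.mk₂ ℝ (fun u w => ∑ q, ∑ p, (inner ℝ (e q x) w * inner ℝ (e p x) u) •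
      formHessian η (e p) (e q) x)
      (fun u u' w => by
        simp only [inner_add_right, mul_add, ← Finset.sum_add_distrib]
        refine Finset.sum_congr rfl fun q _ => Finset.sum_congr rfl fun p _ => ?_
        module)
      (fun a u w => by
        simp only [inner_smul_right, Finset.smul_sum]
        refine Finset.sum_congr rfl fun q _ => Finset.sum_congr rfl fun p _ => ?_
        module)
      (fun u w w' => by
        simp only [inner_add_right, add_mul, ← Finset.sum_add_distrib]
        refine Finset.sum_congr rfl fun q _ => Finset.sum_congr rfl fun p _ => ?_
        module)
      (fun a u w => by
        simp only [inner_smul_right, Finset.smul_sum]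
        refine Finset.sum_congr rfl fun q _ => Finset.sum_congr rfl fun p _ => ?_
        module)
  have hB {X Y : Π x : M, TangentSpace (𝓡 n) x} (hY : SmoothFieldAt Y x) :
      formHessian η X Y x = B (X x) (Y x) := formHessian_eq_sum hη hY he hx
  simp only [hB (he.smoothAt hx _), hB (smoothFieldAt_coordField hφ hxφ _)]
  exact sum_gram_inv_smul hφ hxφ B (he.orthonormal x hx)

/-- The trace in coordinates equals the trace in an orthonormal frame. -/
theorem traceHessian_formNabla (hη : IsCDiffFormAt ∞ η x)
    {φ : OpenPartialHomeomorph M (EuclideanSpace ℝ (Fin n))}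
    (hφ : φ ∈ IsManifold.maximalAtlas (𝓡 n) ∞ M) (hxφ : x ∈ φ.source)
    (he : IsOrthonormalFrameOn e U) (hx : x ∈ U) :
    traceHessian formNabla φ η x = ∑ i, formHessian η (e i) (e i) x :=
  sum_gram_inv_smul_formHessian hη hφ hxφ he hx

end Weitzenbock

/-! ### The twisted connection -/

section TwistedConnection

variable {n : ℕ} {M : Type*} [TopologicalSpace M] [ChartedSpace (EuclideanSpace ℝ (Fin n)) M]
  [IsManifold (𝓡 n) ∞ M] [RiemannianBundle (fun x : M => TangentSpace (𝓡 n) x)]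
  [IsContMDiffRiemannianBundle (𝓡 n) ∞ (EuclideanSpace ℝ (Fin n))
    (fun x : M => TangentSpace (𝓡 n) x)]
  {η : Π x : M, Form n x} {V X Y : Π x : M, TangentSpace (𝓡 n) x}
  {e : Fin n → Π x : M, TangentSpace (𝓡 n) x} {U : Set M} {x : M}

theorem cliffNabla_apply {ι : Type} [Fintype ι] (v : ι → TangentSpace (𝓡 n) x) (α : Form n x) :
    cliffNabla V x v α = cliffHat (V x) (∑ q, cliffHat (leviCivita V x (v q)) (cliff (v q) α)) := by
  simp only [cliffNabla, Module.End.mul_apply, LinearMap.sum_apply]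

/-- The endomorphism `ĉ(V) ∑ ĉ(∇_(e_q) V) c(e_q)` does not depend on the orthonormal basis. -/
theorem cliffNabla_eq_of_orthonormal {ι : Type} [Fintype ι]
    (b : OrthonormalBasis ι ℝ (TangentSpace (𝓡 n) x)) {v : Fin n → TangentSpace (𝓡 n) x}
    (hv : Orthonormal ℝ v) : cliffNabla V x b = cliffNabla V x v := by
  refine LinearMap.ext fun α => ?_
  rw [cliffNabla_apply, cliffNabla_apply]
  congr 1
  have h1 (q : ι) : cliffHat (leviCivita V x (b q)) (cliff (b q) α)
      = ∑ p, inner ℝ (v p) (b q) • cliffHat (leviCivita V x (b q)) (cliff (v p) α) := by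
    have h : cliff (b q) α = ∑ p, inner ℝ (v p) (b q) • cliff (v p) α := by
      conv_lhs => rw [← sum_inner_smul hv (b q)]
      rw [cliff_sum_smul]
    rw [h, map_sum]
    simp only [map_real_smul]
  have h2 (p : Fin n) : cliffHat (leviCivita V x (v p)) (cliff (v p) α)
      = ∑ q, inner ℝ (v p) (b q) • cliffHat (leviCivita V x (b q)) (cliff (v p) α) := by
    have h : leviCivita V x (v p) = ∑ q, inner ℝ (v p) (b q) • leviCivita V x (b q) := by
      conv_lhs => rw [← b.sum_repr' (v p), map_sum]
      simp only [map_smul, real_inner_comm]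
    rw [h, cliffHat_sum_smul]
  simp only [h1, h2]
  exact Finset.sum_comm

/-- The twisted connection, computed in a local orthonormal frame. -/
theorem twistedNabla_eq (he : IsOrthonormalFrameOn e U) (hx : x ∈ U) (u : TangentSpace (𝓡 n) x) :
    twistedNabla V η x u
      = formNabla η x u - (1 / 2 : ℝ) • cliffNabla V x (fun q => e q x) (cliff u (η x)) := by
  rw [twistedNabla, cliffNabla_eq_of_orthonormal _ (he.orthonormal x hx)]

/-- The covariant derivative of the field of endomorphisms `ĉ(V) ∑ ĉ(∇_(e_q) V) c(e_q)` in the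
direction `u`, as given by the product rule. -/
noncomputable def cliffNablaDeriv (V : Π x : M, TangentSpace (𝓡 n) x)
    (e : Fin n → Π x : M, TangentSpace (𝓡 n) x) (x : M) (u : TangentSpace (𝓡 n) x) :
    Module.End ℂ (Form n x) :=
  cliffHat (leviCivita V x u) * ∑ q, cliffHat (leviCivita V x (e q x)) * cliff (e q x)
    + cliffHat (V x) * ∑ q, (cliffHat (leviCivita (fun y => leviCivita V y (e q y)) x u)
        * cliff (e q x) + cliffHat (leviCivita V x (e q x)) * cliff (leviCivita (e q) x u))

theorem cliffNablaDeriv_apply (u : TangentSpace (𝓡 n) x) (α : Form n x) :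
    cliffNablaDeriv V e x u α
      = cliffHat (leviCivita V x u)
          (∑ q, cliffHat (leviCivita V x (e q x)) (cliff (e q x) α))
        + cliffHat (V x) (∑ q, (cliffHat (leviCivita (fun y => leviCivita V y (e q y)) x u)
            (cliff (e q x) α) + cliffHat (leviCivita V x (e q x))
              (cliff (leviCivita (e q) x u) α))) := by
  simp only [cliffNablaDeriv, LinearMap.add_apply, Module.End.mul_apply, LinearMap.sum_apply]

theorem cliffNablaDeriv_add (u w : TangentSpace (𝓡 n) x) (α : Form n x) :
    cliffNablaDeriv V e x (u + w) α = cliffNablaDeriv V e x u α + cliffNablaDeriv V e x w α := by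
  simp only [cliffNablaDeriv_apply, map_add, cliff_add, cliffHat_add, Finset.sum_add_distrib]
  abel

theorem cliffNablaDeriv_smul (a : ℝ) (u : TangentSpace (𝓡 n) x) (α : Form n x) :
    cliffNablaDeriv V e x (a • u) α = a • cliffNablaDeriv V e x u α := by
  simp only [cliffNablaDeriv_apply, map_smul, cliff_smul, cliffHat_smul, map_real_smul,
    Finset.sum_add_distrib, map_add, map_sum, ← Finset.smul_sum]
  module

theorem IsCDiffFormAt.cliffNabla (hη : IsCDiffFormAt ∞ η x) (hV : SmoothFieldAt V x)
    (he : IsOrthonormalFrameOn e U) (hx : x ∈ U) :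
    IsCDiffFormAt ∞ (fun y => RiemannianForms.cliffNabla V y (fun q => e q y) (η y)) x := by
  simp only [cliffNabla_apply]
  exact IsCDiffFormAt.cliffHat (.sum _ fun q => (hη.cliff le_rfl (he.smoothAt hx q)).cliffHat le_rfl
    (SmoothFieldAt.nabla hV (he.smoothAt hx q))) le_rfl hV

/-- The product rule for `T η`, where `T = ĉ(V) ∑ ĉ(∇_(e_q) V) c(e_q)`. -/
theorem formNabla_cliffNabla (hη : IsCDiffFormAt ∞ η x) (hV : SmoothFieldAt V x)
    (he : IsOrthonormalFrameOn e U) (hx : x ∈ U) (u : TangentSpace (𝓡 n) x) :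
    formNabla (fun y => cliffNabla V y (fun q => e q y) (η y)) x u
      = cliffNablaDeriv V e x u (η x) + cliffNabla V x (fun q => e q x) (formNabla η x u) := by
  have hη1 := hη.of_le (show (1 : ℕ∞ω) ≤ ∞ by simp)
  have hN (q : Fin n) : SmoothFieldAt (fun y => leviCivita V y (e q y)) x :=
    SmoothFieldAt.nabla hV (he.smoothAt hx q)
  have h1 (q : Fin n) : IsCDiffFormAt 1 (fun y => cliff (e q y) (η y)) x :=
    hη1.cliff (by simp) (he.smoothAt hx q)
  have h2 (q : Fin n) : IsCDiffFormAt 1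
      (fun y => cliffHat (leviCivita V y (e q y)) (cliff (e q y) (η y))) x :=
    (h1 q).cliffHat (by simp) (hN q)
  simp only [cliffNabla_apply, cliffNablaDeriv_apply]
  rw [formNabla_cliffHat (.sum _ h2) hV, formNabla_sum _ h2, add_assoc, ← map_add,
    ← Finset.sum_add_distrib]
  congr 2
  refine Finset.sum_congr rfl fun q _ => ?_
  rw [formNabla_cliffHat (h1 q) (hN q), formNabla_cliff hη1 (he.smoothAt hx q), map_add]
  abel

theorem extendForm_self (α : Form n x) : extendForm α x = α := by
  refine form_ext fun k w => congrArg (α k) (funext fun a => ?_)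
  exact (isInvertible_mfderiv_chart (IsManifold.chart_mem_maximalAtlas x)
    (mem_chart_source _ x)).inverse_apply_self (w a)

theorem isCDiffFormAt_extendForm (α : Form n x) : IsCDiffFormAt ∞ (extendForm α) x := by
  have hφ := IsManifold.chart_mem_maximalAtlas (I := 𝓡 n) (n := ∞) x
  refine isCDiffFormAt_of_inChart le_rfl hφ (mem_chart_source _ x) fun k => ?_
  let c : EuclideanSpace ℝ (Fin n) [⋀^Fin k]→L[ℝ] ℂ := (α k).compContinuousLinearMap
    (mfderiv (𝓡 n) 𝓘(ℝ, EuclideanSpace ℝ (Fin n)) (chartAt (EuclideanSpace ℝ (Fin n)) x) x).inverse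
  refine (contDiffAt_const (c := c)).congr_of_eventuallyEq ?_
  filter_upwards [(chartAt (EuclideanSpace ℝ (Fin n)) x).open_target.mem_nhds
    (mem_chart_target _ x)] with z hz
  ext w
  refine congrArg (α k) (funext fun a => congrArg (mfderiv (𝓡 n) 𝓘(ℝ, EuclideanSpace ℝ (Fin n))
    (chartAt (EuclideanSpace ℝ (Fin n)) x) x).inverse ?_)
  exact congr($((chart_mdifferentiable hφ).comp_symm_deriv hz) (w a))

theorem endNabla_cliffNabla (hV : SmoothFieldAt V x) (he : IsOrthonormalFrameOn e U) (hx : x ∈ U)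
    (u : TangentSpace (𝓡 n) x) (α : Form n x) :
    endNabla (fun y => cliffNabla V y (fun q => e q y)) x u α = cliffNablaDeriv V e x u α := by
  rw [endNabla, formNabla_cliffNabla (isCDiffFormAt_extendForm α) hV he hx, extendForm_self,
    add_sub_cancel_right]

/-- The second covariant derivative for the twisted connection. -/
theorem twistedNabla_twistedNabla (hη : IsCDiffFormAt ∞ η x) (hV : SmoothFieldAt V x)
    (hY : SmoothFieldAt Y x) (he : IsOrthonormalFrameOn e U) (hx : x ∈ U) :
    twistedNabla V (fun y => twistedNabla V η y (Y y)) x (X x)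
        - twistedNabla V η x (leviCivita Y x (X x))
      = formHessian η X Y x - (1 / 2 : ℝ) • (cliffNablaDeriv V e x (X x) (cliff (Y x) (η x))
        + cliffNabla V x (fun q => e q x) (cliff (Y x) (formNabla η x (X x)))
        + cliffNabla V x (fun q => e q x) (cliff (X x) (formNabla η x (Y x))))
      + (1 / 4 : ℝ) • cliffNabla V x (fun q => e q x) (cliff (X x)
          (cliffNabla V x (fun q => e q x) (cliff (Y x) (η x)))) := by
  have hη1 := hη.of_le (show (1 : ℕ∞ω) ≤ ∞ by simp)
  have hc : IsCDiffFormAt ∞ (fun y => cliff (Y y) (η y)) x := hη.cliff le_rfl hY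
  have hT := hc.cliffNabla hV he hx
  have hT' : IsCDiffFormAt ∞ (fun y => (-(1 / 2) : ℝ) •
      cliffNabla V y (fun q => e q y) (cliff (Y y) (η y))) x :=
    IsCDiffFormAt.smul contMDiffAt_const hT
  have hev : ∀ᶠ y in 𝓝 x, twistedNabla V η y (Y y) = formNabla η y (Y y)
      + (-(1 / 2) : ℝ) • cliffNabla V y (fun q => e q y) (cliff (Y y) (η y)) := by
    filter_upwards [he.isOpen.mem_nhds hx] with y hy
    rw [twistedNabla_eq he hy]
    module
  have hN := (hη.formNabla hY).of_le (show (1 : ℕ∞ω) ≤ ∞ by simp)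
  have h1 : formNabla (fun y => twistedNabla V η y (Y y)) x (X x)
      = formNabla (fun y => formNabla η y (Y y)) x (X x)
        + (-(1 / 2) : ℝ) • (cliffNablaDeriv V e x (X x) (cliff (Y x) (η x))
          + cliffNabla V x (fun q => e q x) (cliff (leviCivita Y x (X x)) (η x)
            + cliff (Y x) (formNabla η x (X x)))) := by
    rw [formNabla_congr (hN.add (hT'.of_le (by simp))) hev,
      formNabla_add hN (hT'.of_le (by simp)),
      formNabla_smul contMDiffAt_const (hT.of_le (by simp)),
      formNabla_cliffNabla hc hV he hx, formNabla_cliff hη1 hY, mvfderiv_const]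
    simp only [zero_apply]
    module
  rw [twistedNabla_eq he hx, twistedNabla_eq he hx, h1, twistedNabla_eq he hx, formHessian]
  simp only [map_add, map_sub, map_real_smul]
  module

/-- The trace of the second covariant derivative for the twisted connection. Both cross terms
contribute half of `T ∑ c(e_i) ∇_(e_i) = T D`, where `T = ĉ(V) ∑ ĉ(∇_(e_q) V) c(e_q)`. -/
theorem traceHessian_twistedNabla (hη : IsCDiffFormAt ∞ η x) (hV : SmoothFieldAt V x)
    {φ : OpenPartialHomeomorph M (EuclideanSpace ℝ (Fin n))}
    (hφ : φ ∈ IsManifold.maximalAtlas (𝓡 n) ∞ M) (hxφ : x ∈ φ.source)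
    (he : IsOrthonormalFrameOn e U) (hx : x ∈ U) :
    traceHessian (twistedNabla V) φ η x = ∑ i, formHessian η (e i) (e i) x
      - (1 / 2 : ℝ) • ∑ i, cliffNablaDeriv V e x (e i x) (cliff (e i x) (η x))
      - cliffNabla V x (fun q => e q x) (hodgeD η x)
      + (1 / 4 : ℝ) • ∑ i, ((cliffNabla V x (fun q => e q x) * cliff (e i x)) ^ 2) (η x) := by
  have hη1 := hη.of_le (show (1 : ℕ∞ω) ≤ ∞ by simp)
  let T := cliffNabla V x fun q => e q x
  -- the difference of the second covariant derivatives of the two connections, which is bilinear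
  let B : TangentSpace (𝓡 n) x →ₗ[ℝ] TangentSpace (𝓡 n) x →ₗ[ℝ] Form n x :=
    LinearMap.mk₂ ℝ (fun u w => (-(1 / 2) : ℝ) • (cliffNablaDeriv V e x u (cliff w (η x))
        + T (cliff w (formNabla η x u)) + T (cliff u (formNabla η x w)))
        + (1 / 4 : ℝ) • T (cliff u (T (cliff w (η x)))))
      (fun u u' w => by
        simp only [formNabla_add_dir hη1, cliffNablaDeriv_add, cliff_add, map_add]
        module)
      (fun a u w => by
        simp only [formNabla_smul_dir hη1, cliffNablaDeriv_smul, cliff_smul, map_real_smul]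
        module)
      (fun u w w' => by
        simp only [formNabla_add_dir hη1, cliff_add, map_add]
        module)
      (fun a u w => by
        simp only [formNabla_smul_dir hη1, cliff_smul, map_real_smul]
        module)
  have h1 : traceHessian (twistedNabla V) φ η x
      = ∑ i, ∑ j, (gram φ x)⁻¹ i j • formHessian η (coordField φ i) (coordField φ j) x
        + ∑ i, ∑ j, (gram φ x)⁻¹ i j • B (coordField φ i x) (coordField φ j x) := by
    rw [traceHessian]
    simp only [← Finset.sum_add_distrib]
    refine Finset.sum_congr rfl fun i _ => Finset.sum_congr rfl fun j _ => ?_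
    rw [twistedNabla_twistedNabla hη hV (smoothFieldAt_coordField hφ hxφ j) he hx]
    simp only [B, LinearMap.mk₂_apply]
    module
  rw [h1, sum_gram_inv_smul_formHessian hη hφ hxφ he hx,
    sum_gram_inv_smul hφ hxφ B (he.orthonormal x hx),
    hodgeD_eq_sum_cliff hη1 (he.orthonormal x hx), map_sum, sub_sub, sub_add_eq_add_sub,
    add_sub_assoc]
  congr 1
  simp only [Finset.smul_sum, ← Finset.sum_add_distrib, ← Finset.sum_sub_distrib]
  refine Finset.sum_congr rfl fun i _ => ?_
  simp only [B, LinearMap.mk₂_apply, pow_two, Module.End.mul_apply, T]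
  module

theorem isFormConnection_twistedNabla (hV : ContMDiff (𝓡 n) (𝓡 n).tangent ∞ (T% V)) :
    IsFormConnection (twistedNabla V) where
  add_dir σ x v w hσ := by
    rw [twistedNabla, isFormConnection_formNabla.add_dir σ x v w hσ, cliff_add, map_add]
    simp only [twistedNabla]
    module
  smul_dir σ x a v hσ := by
    rw [twistedNabla, isFormConnection_formNabla.smul_dir σ x a v hσ, cliff_smul, map_real_smul]
    simp only [twistedNabla]
    module
  add σ τ x v hσ hτ := by
    rw [twistedNabla, isFormConnection_formNabla.add σ τ x v hσ hτ, Pi.add_apply, map_add, map_add]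
    simp only [twistedNabla]
    module
  leibniz f σ x v hf hσ := by
    rw [twistedNabla, isFormConnection_formNabla.leibniz f σ x v hf hσ, map_smul, map_smul,
      smul_comm (1 / 2 : ℝ)]
    simp only [twistedNabla, smul_sub]
    abel
  smooth σ X x hσ hX := by
    rw [isSmoothFormAt_iff] at hσ ⊢
    obtain ⟨e, U, he, hx⟩ := exists_isOrthonormalFrameOn (n := n) x
    refine ((hσ.formNabla hX).sub (IsCDiffFormAt.smul (f := fun _ => (1 / 2 : ℝ)) contMDiffAt_const
      ((hσ.cliff le_rfl hX).cliffNabla (hV x) he hx))).congr ?_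
    filter_upwards [he.isOpen.mem_nhds hx] with y hy
    exact twistedNabla_eq he hy _

/-! ### The operators `D_V^* D_V` and `D_V^2` -/

theorem hodgeD_csmul (hη : IsCDiffFormAt 1 η x) (a : ℂ) :
    hodgeD (fun y => a • η y) x = a • hodgeD η x := by
  obtain ⟨e, U, he, hx⟩ := exists_isOrthonormalFrameOn (n := n) x
  rw [hodgeD_eq_sum_cliff (IsCDiffFormAt.csmul contMDiffAt_const hη) (he.orthonormal x hx),
    hodgeD_eq_sum_cliff hη (he.orthonormal x hx), Finset.smul_sum]
  refine Finset.sum_congr rfl fun q _ => ?_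
  rw [formNabla_csmul contMDiffAt_const hη, mvfderiv_const, ← map_smul, zero_apply]
  congr 1
  exact (congrArg _ (zero_smul ℂ (η x))).trans (add_zero _)

theorem cliffHat_cliffHat_self {v : TangentSpace (𝓡 n) x} (hv : ‖v‖ = 1) (α : Form n x) :
    cliffHat v (cliffHat v α) = α := by
  have h := cliffHat_cliffHat v v α
  have h1 : inner ℝ v v = (1 : ℝ) := by
    have := real_inner_self_eq_norm_sq v
    rw [this, hv, one_pow]
  rw [h1] at h
  calc cliffHat v (cliffHat v α)
      = (1 / 2 : ℝ) • (cliffHat v (cliffHat v α) + cliffHat v (cliffHat v α)) := by module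
    _ = (1 / 2 : ℝ) • (cliffHat v (cliffHat v α) + (-cliffHat v (cliffHat v α)
          + (2 * 1 : ℝ) • α)) := congrArg (fun β => (1 / 2 : ℝ) • (cliffHat v (cliffHat v α) + β)) h
    _ = α := by module

/-- Since `ĉ(V)² = |V|² = 1`, the vector field disappears from `D_V^* D_V`. -/
theorem opDVStar_opDV (hη : IsSmoothForm η) (hunit : ∀ x, ‖V x‖ = 1) :
    opDVStar V (opDV V η) = hodgeD (hodgeD η) := by
  funext x
  have h : (fun y => cliffHat (V y) (opDV V η y)) = fun y => Complex.I • hodgeD η y := by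
    funext y
    rw [opDV, map_smul, cliffHat_cliffHat_self (hunit y)]
  rw [opDVStar, h, hodgeD_csmul ((hη.at x).hodgeD.of_le (by simp)), smul_smul]
  simp

/-- Moving `ĉ(V)` through `D = ∑ c(e_q) ∇_(e_q)`, with which it anticommutes up to the
derivatives of `V`, gives `D_V² = D² + ĉ(V) ∑ ĉ(∇_(e_q) V) c(e_q) D`. -/
theorem opDV_opDV (hη : IsCDiffFormAt ∞ η x) (hV : SmoothFieldAt V x) (hunit : ‖V x‖ = 1)
    (he : IsOrthonormalFrameOn e U) (hx : x ∈ U) :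
    opDV V (opDV V η) x
      = hodgeD (hodgeD η) x + cliffNabla V x (fun q => e q x) (hodgeD η x) := by
  have h1 : IsCDiffFormAt 1 (hodgeD η) x := hη.hodgeD.of_le (by simp)
  have h2 : IsCDiffFormAt 1 (fun y => cliffHat (V y) (hodgeD η y)) x := h1.cliffHat (by simp) hV
  have h3 : hodgeD (opDV V η) x = Complex.I • hodgeD (fun y => cliffHat (V y) (hodgeD η y)) x :=
    hodgeD_csmul h2 _
  have h4 : hodgeD (fun y => cliffHat (V y) (hodgeD η y)) x
      = -(∑ q, cliffHat (leviCivita V x (e q x)) (cliff (e q x) (hodgeD η x))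
        + cliffHat (V x) (hodgeD (hodgeD η) x)) := by
    rw [hodgeD_eq_sum_cliff h2 (he.orthonormal x hx), hodgeD_eq_sum_cliff h1 (he.orthonormal x hx),
      map_sum, ← Finset.sum_add_distrib, ← Finset.sum_neg_distrib]
    refine Finset.sum_congr rfl fun q _ => ?_
    rw [formNabla_cliffHat h1 hV, map_add, cliff_cliffHat, cliff_cliffHat]
    abel
  rw [opDV, h3, map_smul, smul_smul, Complex.I_mul_I, h4, map_neg, map_add,
    cliffHat_cliffHat_self hunit, cliffNabla_apply]
  rw [smul_neg, neg_smul, one_smul, neg_neg, add_comm]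

end TwistedConnection

/-! ### Connections associated with operators of Laplace type -/

section LaplaceType

variable {n : ℕ} {M : Type*} [TopologicalSpace M] [ChartedSpace (EuclideanSpace ℝ (Fin n)) M]
  [IsManifold (𝓡 n) ∞ M] [RiemannianBundle (fun x : M => TangentSpace (𝓡 n) x)]
  [IsContMDiffRiemannianBundle (𝓡 n) ∞ (EuclideanSpace ℝ (Fin n))
    (fun x : M => TangentSpace (𝓡 n) x)]
  {η : Π x : M, Form n x} {V : Π x : M, TangentSpace (𝓡 n) x}
  {e : Fin n → Π x : M, TangentSpace (𝓡 n) x} {U : Set M} {x : M}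
  {φ : OpenPartialHomeomorph M (EuclideanSpace ℝ (Fin n))}
  {cov cov' : (Π x : M, Form n x) → Π x : M, TangentSpace (𝓡 n) x → Form n x}
  {P : (Π x : M, Form n x) → Π x : M, Form n x}

theorem opDVStar_opDV_eq_traceHessian (hη : IsSmoothForm η) (hunit : ∀ x, ‖V x‖ = 1)
    (hφ : φ ∈ IsManifold.maximalAtlas (𝓡 n) ∞ M) (hxφ : x ∈ φ.source)
    (he : IsOrthonormalFrameOn e U) (hx : x ∈ U) :
    opDVStar V (opDV V η) x = -traceHessian formNabla φ η x + weitzenbock e x (η x) := by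
  rw [opDVStar_opDV hη hunit, hodgeD_hodgeD_eq (hη.at x) he hx,
    traceHessian_formNabla (hη.at x) hφ hxφ he hx]

/-- The first order term of `D_V²` is absorbed by the twist of the connection, at the cost of the
terms of order zero. -/
theorem opDV_opDV_eq_traceHessian (hη : IsCDiffFormAt ∞ η x) (hV : SmoothFieldAt V x)
    (hunit : ‖V x‖ = 1)
    (hφ : φ ∈ IsManifold.maximalAtlas (𝓡 n) ∞ M) (hxφ : x ∈ φ.source)
    (he : IsOrthonormalFrameOn e U) (hx : x ∈ U) :
    opDV V (opDV V η) x = -traceHessian (twistedNabla V) φ η x + weitzenbock e x (η x)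
      + (1 / 4 : ℝ) • ∑ i, ((cliffNabla V x (fun q => e q x) * cliff (e i x)) ^ 2) (η x)
      - (1 / 2 : ℝ) • ∑ j, cliffNablaDeriv V e x (e j x) (cliff (e j x) (η x)) := by
  rw [opDV_opDV hη hV hunit he hx, hodgeD_hodgeD_eq hη he hx,
    traceHessian_twistedNabla hη hV hφ hxφ he hx]
  abel

theorem isLaplaceConnection_formNabla (hunit : ∀ x, ‖V x‖ = 1) :
    IsLaplaceConnection (fun η : Π x : M, Form n x => opDVStar V (opDV V η)) formNabla := by
  choose e U he hU using fun x : M => exists_isOrthonormalFrameOn (n := n) x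
  refine ⟨isFormConnection_formNabla, fun x => -weitzenbock (e x) x, fun η hη φ hφ x hx => ?_⟩
  beta_reduce
  rw [opDVStar_opDV_eq_traceHessian hη hunit hφ hx (he x) (hU x), LinearMap.neg_apply]
  abel

/-- The endomorphism field is read off from the formula for `D_V²` in a local orthonormal frame
chosen around each point. -/
theorem isLaplaceConnection_twistedNabla (hV : ContMDiff (𝓡 n) (𝓡 n).tangent ∞ (T% V))
    (hunit : ∀ x, ‖V x‖ = 1) :
    IsLaplaceConnection (fun η : Π x : M, Form n x => opDV V (opDV V η)) (twistedNabla V) := by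
  choose e U he hU using fun x : M => exists_isOrthonormalFrameOn (n := n) x
  refine ⟨isFormConnection_twistedNabla hV, fun x => -(weitzenbock (e x) x
    + (1 / 4 : ℝ) • ∑ i, (cliffNabla V x (fun q => e x q x) * cliff (e x i x)) ^ 2
    - (1 / 2 : ℝ) • ∑ j, cliffNablaDeriv V (e x) x (e x j x) * cliff (e x j x)),
    fun η hη φ hφ x hx => ?_⟩
  beta_reduce
  rw [opDV_opDV_eq_traceHessian (hη.at x) (hV x) (hunit x) hφ hx (he x) (hU x)]
  simp only [LinearMap.neg_apply, LinearMap.sub_apply, LinearMap.add_apply, LinearMap.smul_apply,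
    LinearMap.sum_apply, Module.End.mul_apply]
  abel

/-- On a Hausdorff manifold every covector at `x` is the differential of a globally smooth function
that vanishes at `x`. -/
theorem exists_contMDiff_mvfderiv_eq [T2Space M] (x : M) (ξ : TangentSpace (𝓡 n) x →L[ℝ] ℝ) :
    ∃ f : M → ℂ, ContMDiff (𝓡 n) 𝓘(ℝ, ℂ) ∞ f ∧ f x = 0 ∧
      ∀ v, mvfderiv (𝓡 n) f x v = (ξ v : ℂ) := by
  have hφ := IsManifold.chart_mem_maximalAtlas (I := 𝓡 n) (n := ∞) x
  have hx : x ∈ (chartAt (EuclideanSpace ℝ (Fin n)) x).source := mem_chart_source _ x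
  let L : EuclideanSpace ℝ (Fin n) →L[ℝ] ℂ := (Complex.ofRealCLM.comp ξ).comp
    (mfderiv (𝓡 n) 𝓘(ℝ, EuclideanSpace ℝ (Fin n)) (chartAt (EuclideanSpace ℝ (Fin n)) x) x).inverse
  let g : EuclideanSpace ℝ (Fin n) → ℂ := fun z => L (z - chartAt (EuclideanSpace ℝ (Fin n)) x x)
  have hg : ContDiff ℝ ∞ g := by fun_prop
  obtain ⟨b⟩ : Nonempty (SmoothBumpFunction (𝓡 n) x) := inferInstance
  refine ⟨fun y => b y • g (chartAt (EuclideanSpace ℝ (Fin n)) x y),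
    b.contMDiff_smul fun y hy => (hg.contDiffAt.contMDiffAt.comp y
      (contMDiffAt_of_mem_maximalAtlas hφ hy)).contMDiffWithinAt, by simp [g], fun v => ?_⟩
  have h1 : (fun y => b y • g (chartAt (EuclideanSpace ℝ (Fin n)) x y)) =ᶠ[𝓝 x]
      fun y => g (chartAt (EuclideanSpace ℝ (Fin n)) x y) := by
    filter_upwards [b.eventuallyEq_one] with y hy
    rw [hy, Pi.one_apply, one_smul]
  have h2 : fderiv ℝ g (chartAt (EuclideanSpace ℝ (Fin n)) x x) = L := by
    simp only [g]
    rw [fderiv_comp_sub, L.fderiv]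
  rw [mvfderiv_congr h1, mvfderiv_comp_chart hφ hx (hg.differentiable (by simp)).differentiableAt,
    h2]
  exact congrArg (fun w => (ξ w : ℂ)) ((isInvertible_mfderiv_chart hφ hx).inverse_apply_self v)

/-- The trace of the second covariant derivative of `f η` at a zero of `f`: the connection
enters only through the first derivatives of `η`. -/
theorem IsFormConnection.traceHessian_smul (h : IsFormConnection cov) (hη : IsSmoothForm η)
    {f : M → ℂ} (hf : ContMDiff (𝓡 n) 𝓘(ℝ, ℂ) ∞ f) (hfx : f x = 0)
    (hφ : φ ∈ IsManifold.maximalAtlas (𝓡 n) ∞ M) (hx : x ∈ φ.source) :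
    traceHessian cov φ (fun y => f y • η y) x = ∑ i, ∑ j, (gram φ x)⁻¹ i j •
        (mvfderiv (𝓡 n) f x (coordField φ i x) • cov η x (coordField φ j x)
          + mvfderiv (𝓡 n) f x (coordField φ j x) • cov η x (coordField φ i x))
      + ∑ i, ∑ j, (gram φ x)⁻¹ i j •
        (mvfderiv (𝓡 n) (fun y => mvfderiv (𝓡 n) f y (coordField φ j y)) x (coordField φ i x)
          - mvfderiv (𝓡 n) f x (leviCivita (coordField φ j) x (coordField φ i x))) • η x := by
  have hs (y : M) : IsSmoothFormAt η y := isSmoothFormAt_iff.2 (hη.at y)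
  rw [traceHessian, ← Finset.sum_add_distrib]
  refine Finset.sum_congr rfl fun i _ => ?_
  rw [← Finset.sum_add_distrib]
  refine Finset.sum_congr rfl fun j _ => ?_
  have hX := smoothFieldAt_coordField hφ hx j
  have hd : ContMDiffAt (𝓡 n) 𝓘(ℝ, ℂ) ∞ (fun y => mvfderiv (𝓡 n) f y (coordField φ j y)) x :=
    contMDiffAt_mvfderiv_apply le_rfl (hf x) hX
  have h1 : (fun y => cov (fun y => f y • η y) y (coordField φ j y))
      = (fun y => f y • cov η y (coordField φ j y))
        + fun y => mvfderiv (𝓡 n) f y (coordField φ j y) • η y :=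
    funext fun y => h.leibniz f η y _ (hf y) (hs y)
  have hc : IsSmoothFormAt (fun y => cov η y (coordField φ j y)) x := h.smooth η _ x (hs x) hX
  rw [h1, h.add _ _ x _
      (isSmoothFormAt_iff.2 (IsCDiffFormAt.csmul (hf x) (isSmoothFormAt_iff.1 hc)))
      (isSmoothFormAt_iff.2 (IsCDiffFormAt.csmul hd (hη.at x))),
    h.leibniz f _ x _ (hf x) hc, h.leibniz _ η x _ hd (hs x), h.leibniz f η x _ (hf x) (hs x), hfx]
  refine Eq.trans ?_ (smul_add _ _ _)
  congr 1
  module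

/-- The connection associated with an operator of Laplace type is unique: applying the operator to
`f η`, where `f` vanishes at `x` and `df` is a given covector there, recovers the first derivatives
of `η`. -/
theorem IsLaplaceConnection.unique [T2Space M] (h : IsLaplaceConnection P cov)
    (h' : IsLaplaceConnection P cov') (hη : IsSmoothForm η) : cov η = cov' η := by
  obtain ⟨h, F, hF⟩ := h
  obtain ⟨h', F', hF'⟩ := h'
  funext x u
  have hs : IsSmoothFormAt η x := isSmoothFormAt_iff.2 (hη.at x)
  have hφ := IsManifold.chart_mem_maximalAtlas (I := 𝓡 n) (n := ∞) x
  have hx : x ∈ (chartAt (EuclideanSpace ℝ (Fin n)) x).source := mem_chart_source _ x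
  obtain ⟨e, U, he, hxU⟩ := exists_isOrthonormalFrameOn (n := n) x
  obtain ⟨f, hf, hfx, hdf⟩ := exists_contMDiff_mvfderiv_eq x (innerSL ℝ u)
  have hfη : IsSmoothForm fun y => f y • η y := isSmoothForm_iff.2 fun y =>
    IsCDiffFormAt.csmul (hf y) (hη.at y)
  let Δ : TangentSpace (𝓡 n) x →ₗ[ℝ] Form n x :=
    { toFun := fun v => cov η x v - cov' η x v
      map_add' := fun v w => by rw [h.add_dir η x v w hs, h'.add_dir η x v w hs]; abel
      map_smul' := fun a v => by
        rw [h.smul_dir η x a v hs, h'.smul_dir η x a v hs, RingHom.id_apply, smul_sub] }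
  -- the difference of the second covariant derivatives of `f η` at `x`, whose trace is `2 Δ u`
  let B : TangentSpace (𝓡 n) x →ₗ[ℝ] TangentSpace (𝓡 n) x →ₗ[ℝ] Form n x :=
    LinearMap.mk₂ ℝ (fun v w => (inner ℝ u v : ℝ) • Δ w + (inner ℝ u w : ℝ) • Δ v)
      (fun v v' w => by simp only [inner_add_right, map_add]; module)
      (fun a v w => by simp only [inner_smul_right, map_smul]; module)
      (fun v w w' => by simp only [inner_add_right, map_add]; module)
      (fun a v w => by simp only [inner_smul_right, map_smul]; module)
  -- The endomorphism fields do not contribute, because `f η` vanishes at `x`.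
  have h1 := (hF _ hfη _ hφ x hx).symm.trans (hF' _ hfη _ hφ x hx)
  have h0 (α : Form n x) : (0 : ℂ) • α = 0 := by module
  have h2 : F x (f x • η x) = 0 := by rw [hfx, h0, map_zero]
  have h3 : F' x (f x • η x) = 0 := by rw [hfx, h0, map_zero]
  simp only [h2, h3, add_zero] at h1
  rw [neg_inj, h.traceHessian_smul hη hf hfx hφ hx, h'.traceHessian_smul hη hf hfx hφ hx,
    add_left_inj, ← sub_eq_zero, ← Finset.sum_sub_distrib] at h1
  have h4 : ∑ i, ∑ j, (gram (chartAt (EuclideanSpace ℝ (Fin n)) x) x)⁻¹ i j •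
      B (coordField (chartAt (EuclideanSpace ℝ (Fin n)) x) i x)
        (coordField (chartAt (EuclideanSpace ℝ (Fin n)) x) j x) = 0 := by
    rw [← h1]
    refine Finset.sum_congr rfl fun i _ => ?_
    rw [← Finset.sum_sub_distrib]
    refine Finset.sum_congr rfl fun j _ => ?_
    refine Eq.trans ?_ (smul_sub _ _ _)
    rw [hdf, hdf]
    congr 1
    have hr (a : ℝ) (α : Form n x) : (a : ℂ) • α = a • α := rfl
    simp only [B, Δ, LinearMap.mk₂_apply, LinearMap.coe_mk, AddHom.coe_mk, hr,
      innerSL_apply_apply]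
    module
  rw [sum_gram_inv_smul hφ hx B (he.orthonormal x hxU)] at h4
  have h5 : Δ u = 0 := by
    have h6 : Δ u = ∑ q, (inner ℝ u (e q x) : ℝ) • Δ (e q x) := by
      conv_lhs => rw [← sum_inner_smul (he.orthonormal x hxU) u, map_sum]
      simp only [map_smul, real_inner_comm]
    calc Δ u = (1 / 2 : ℝ) • ∑ q, B (e q x) (e q x) := by
          rw [h6, Finset.smul_sum]
          refine Finset.sum_congr rfl fun q _ => ?_
          simp only [B, LinearMap.mk₂_apply]
          module
      _ = 0 := by rw [h4]; module
  exact sub_eq_zero.1 h5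

end LaplaceType

end RiemannianForms

theorem mainTheorem4 {n : ℕ} {M : Type*} [TopologicalSpace M] [T2Space M]
    [ChartedSpace (EuclideanSpace ℝ (Fin n)) M] [IsManifold (𝓡 n) ∞ M]
    [RiemannianBundle (fun x : M => TangentSpace (𝓡 n) x)]
    [IsContMDiffRiemannianBundle (𝓡 n) ∞ (EuclideanSpace ℝ (Fin n))
      (fun x : M => TangentSpace (𝓡 n) x)]
    (V : Π x : M, TangentSpace (𝓡 n) x)
    (hV : ContMDiff (𝓡 n) (𝓡 n).tangent ∞ (T% V)) (hunit : ∀ x, ‖V x‖ = 1) :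
    -- the connections of the two operators
    (IsLaplaceConnection (fun η : Π x : M, Form n x => opDVStar V (opDV V η)) formNabla ∧
      ∀ cov, IsLaplaceConnection (fun η : Π x : M, Form n x => opDVStar V (opDV V η)) cov →
        ∀ η, IsSmoothForm η → cov η = formNabla η) ∧
    (IsLaplaceConnection (fun η : Π x : M, Form n x => opDV V (opDV V η)) (twistedNabla V) ∧
      ∀ cov, IsLaplaceConnection (fun η : Π x : M, Form n x => opDV V (opDV V η)) cov →
        ∀ η, IsSmoothForm η → cov η = twistedNabla V η) ∧
    -- the two formulas
    ∀ η : Π x : M, Form n x, IsSmoothForm η →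
      opDVStar V (opDV V η) = hodgeD (hodgeD η) ∧
      ∀ φ ∈ IsManifold.maximalAtlas (𝓡 n) ∞ M,
      ∀ (e : Fin n → Π x : M, TangentSpace (𝓡 n) x) (U : Set M), IsOrthonormalFrameOn e U →
      ∀ x ∈ φ.source ∩ U,
        opDVStar V (opDV V η) x = -traceHessian formNabla φ η x + weitzenbock e x (η x) ∧
        opDV V (opDV V η) x = -traceHessian (twistedNabla V) φ η x + weitzenbock e x (η x)
          + (1 / 4 : ℝ) • ∑ i, ((cliffNabla V x (fun q => e q x) * cliff (e i x)) ^ 2) (η x)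
          - (1 / 2 : ℝ) • ∑ j, endNabla (fun y => cliffNabla V y (fun q => e q y)) x (e j x)
              (cliff (e j x) (η x)) := by
  refine ⟨⟨isLaplaceConnection_formNabla hunit, fun cov h η hη =>
      h.unique (isLaplaceConnection_formNabla hunit) hη⟩,
    ⟨isLaplaceConnection_twistedNabla hV hunit, fun cov h η hη =>
      h.unique (isLaplaceConnection_twistedNabla hV hunit) hη⟩,
    fun η hη => ⟨opDVStar_opDV hη hunit, fun φ hφ e U he x hx =>
      ⟨opDVStar_opDV_eq_traceHessian hη hunit hφ hx.1 he hx.2, ?_⟩⟩⟩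
  simp only [endNabla_cliffNabla (hV x) he hx.2]
  exact opDV_opDV_eq_traceHessian (hη.at x) (hV x) (hunit x) hφ hx.1 he hx.2
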